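/- Knot diagrams are diagrams in the oriented plane $\mathbb R^2$ (generic immersed closed curves with over/under information at the double points, called crossings), considered up to planar isotopy. A Reidemeister sequence is a finite sequence of planar isotopies and Reidemeister moves: $\Omega_1$ (create or remove a kink), $\Omega_2$ (create or remove a bigon between two strands, one of which lies over the other) and $\Omega_3$ (move a strand across a crossing). A pair of diagrams is $\Omega_n$-dependent if no Reidemeister sequence from one to the other avoids $\Omega_n$-moves. Let $D$ be a knot diagram. A polygon of $D$ is the boundary of a connected component (bounded or not) of the complement of $D$ in the plane. It is a $0$-gon if $D$ has no crossings; otherwise it is an $n$-gon if removing the crossings of $D$ that lie on it leaves exactly $n$ open intervals, called edges. A $(1,1)$-tangle is a single strand in a disc joining two boundary points; it is unknotted if its closure is a diagram of the unknot. **Theorem.** Let $D$ be a knot diagram such that 1. $D$ has no $0$-gons, $1$-gons or $2$-gons; 2. no $\Omega_3$-move can be applied to $D$ (up to planar isotopy), that is, none of its $3$-gons admits an $\Omega_3$-move. Then every diagram obtained from $D$ by a Reidemeister sequence that contains no $\Omega_2$-move is planar isotopic to a diagram obtained from $D$ by replacing each edge of $D$ by an unknotted $(1,1)$-tangle. Furthermore,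 there is an $\Omega_2$-move on $D$ that creates two crossings between two distinct edges of $D$, and for every diagram $D'$ obtained from $D$ by a single such move the pair $\{D,D'\}$ is $\Omega_2$-dependent. -/

import Mathlib

/-!
# Planar knot diagrams and Reidemeister moves

A knot diagram in the (oriented) plane is a connected plane graph, considered up to orientation
preserving homeomorphism of the plane, whose vertices are the crossings (degree 4, decorated with
over/under information) and possibly some auxiliary marked points of degree 2 on the curve (they
let a closed curve without crossings have a vertex, and otherwise carry no information).
Such a graph is given by its rotation system on half-edges ("darts"), subject to Euler's formula
for the sphere, together with the complementary region that is unbounded in the plane.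
-/

/-- A decorated rotation system.  A dart is a half-edge, pointing away from its vertex; `edge`
exchanges the two halves of an edge, `rot` sends a dart to the next dart counterclockwise around
the same vertex, and `isOver` tells whether a dart at a crossing belongs to the over strand. -/
structure CurveMap where
  /-- half-edges -/
  Dart : Type
  /-- there are finitely many half-edges -/
  finite : Finite Dart
  /-- the other half of the same edge -/
  edge : Equiv.Perm Dart
  /-- the next half-edge counterclockwise around the vertex -/
  rot : Equiv.Perm Dart
  /-- the half-edge belongs to the over strand (only meaningful at a crossing) -/
  isOver : Dart → Bool

namespace CurveMap

variable (M : CurveMap)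

/-- The dart starts at a marked point, a vertex of degree 2. -/
def IsPoint (x : M.Dart) : Prop := M.rot (M.rot x) = x

/-- The dart starts at a crossing, a vertex of degree 4. -/
def IsCrossing (x : M.Dart) : Prop := ¬ M.IsPoint x

/-- Vertices: the orbits of the rotation. -/
abbrev Vertex : Type := Quotient (Equiv.Perm.SameCycle.setoid M.rot)

/-- Segments between consecutive vertices, marked points included. -/
abbrev Segment : Type := Quotient (Equiv.Perm.SameCycle.setoid M.edge)

/-- Walking along the dart `x` with a region on the left, `M.next x` is the dart along which one
continues around the same region. -/
def next : Equiv.Perm M.Dart := M.rot⁻¹ * M.edge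

/-- The connected components of the complement of the curve: the orbits of `next`. -/
abbrev Face : Type := Quotient (Equiv.Perm.SameCycle.setoid M.next)

/-- The component of the complement on the left of a dart. -/
def faceOf (x : M.Dart) : M.Face := Quotient.mk _ x

/-- `y` is the dart through which a traveller arriving at the vertex of `x` along `x` leaves:
the opposite dart at the same vertex. -/
def Opposite (x y : M.Dart) : Prop :=
  (M.IsPoint x ∧ y = M.rot x) ∨ (M.IsCrossing x ∧ y = M.rot (M.rot x))

/-- One step along the knot: to the other half of the segment or straight through a vertex. -/
def Straight (x y : M.Dart) : Prop := y = M.edge x ∨ M.Opposite x y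

/-- One step within an edge of the diagram: to the other half of the segment, or through a marked
point (but never through a crossing). -/
def AlongEdge (x y : M.Dart) : Prop := y = M.edge x ∨ (M.IsPoint x ∧ y = M.rot x)

/-- The edges of the diagram: what remains of the curve when the crossings are removed falls into
these pieces.  Marked points do not separate edges. -/
abbrev Edge : Type := Quotient (Relation.EqvGen.setoid M.AlongEdge)

/-- The edge of the diagram containing a dart. -/
def edgeOf (x : M.Dart) : M.Edge := Quotient.mk _ x

/-- The edges lying on the polygon that bounds a given region. -/
def edgesOn (F : M.Face) : Set M.Edge := {ε | ∃ x, M.faceOf x = F ∧ M.edgeOf x = ε}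

/-- The polygon that bounds `F` is an `n`-gon: a 0-gon if the diagram has no crossings;
otherwise `n` is the number of edges on it. -/
def IsGon (n : ℕ) (F : M.Face) : Prop :=
  (n = 0 ∧ ∀ x, ¬ M.IsCrossing x) ∨ ((∃ x, M.IsCrossing x) ∧ (M.edgesOn F).ncard = n)

end CurveMap

/-- A planar diagram of an (unoriented) knot. -/
structure KnotDiagram extends CurveMap where
  edge_edge : ∀ x, edge (edge x) = x
  edge_ne : ∀ x, edge x ≠ x
  /-- every vertex has degree 2 or 4 -/
  rot_ne : ∀ x, rot x ≠ x
  rot_four : ∀ x, rot (rot (rot (rot x))) = x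
  /-- at a crossing one of the two strands is over, the other one is under -/
  isOver_rot : ∀ x, toCurveMap.IsCrossing x → isOver (rot x) = !isOver x
  /-- the curve has a single component -/
  one_component : ∀ x y, Relation.EqvGen toCurveMap.Straight x y
  /-- Euler's formula: the rotation system is one of a graph embedded in the sphere -/
  euler : Nat.card toCurveMap.Vertex + Nat.card toCurveMap.Face = Nat.card toCurveMap.Segment + 2
  /-- the region that is unbounded in the plane -/
  outer : toCurveMap.Face

namespace KnotDiagram

/-- The two diagrams differ by an orientation preserving homeomorphism of the plane. -/
def Iso (D D' : KnotDiagram) : Prop :=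
  ∃ f : D.Dart ≃ D'.Dart,
    (∀ x, f (D.edge x) = D'.edge (f x)) ∧
    (∀ x, f (D.rot x) = D'.rot (f x)) ∧
    (∀ x, D.IsCrossing x → D'.isOver (f x) = D.isOver x) ∧
    (∃ x, D.faceOf x = D.outer ∧ D'.faceOf (f x) = D'.outer)

/-- `D'` arises from `D` by forgetting one marked point, the one at which `p` starts (it must not
be the only vertex of a closed curve). -/
def Forget (D D' : KnotDiagram) : Prop :=
  ∃ (p : D.Dart) (f : D'.Dart → D.Dart),
    D.IsPoint p ∧ D.edge p ≠ D.rot p ∧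
    Function.Injective f ∧ Set.range f = {p, D.rot p}ᶜ ∧
    (∀ x, D.edge (f x) = p → f (D'.edge x) = D.edge (D.rot p)) ∧
    (∀ x, D.edge (f x) = D.rot p → f (D'.edge x) = D.edge p) ∧
    (∀ x, D.edge (f x) ≠ p → D.edge (f x) ≠ D.rot p → f (D'.edge x) = D.edge (f x)) ∧
    (∀ x, f (D'.rot x) = D.rot (f x)) ∧
    (∀ x, D'.IsCrossing x → D'.isOver x = D.isOver (f x)) ∧
    (∃ x, D'.faceOf x = D'.outer ∧ D.faceOf (f x) = D.outer)

/-- Planar isotopy.  Marked points are irrelevant, so they may be added and forgotten. -/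
def PlanarIsotopic : KnotDiagram → KnotDiagram → Prop :=
  Relation.EqvGen fun D D' => Iso D D' ∨ Forget D D'

/-- `D'` arises from `D` by removing a kink.  The bounded region on the left of `t` is a disc whose
boundary has the single vertex of `t`.  Its two darts are deleted, and the other two darts at the
crossing become a marked point of `D'`; nothing else changes. -/
def RemoveKink (D D' : KnotDiagram) : Prop :=
  ∃ (t : D.Dart) (f : D'.Dart → D.Dart),
    D.IsCrossing t ∧ D.edge t = D.rot t ∧ D.faceOf t ≠ D.outer ∧
    Function.Injective f ∧ Set.range f = {t, D.rot t}ᶜ ∧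
    (∀ x, f (D'.edge x) = D.edge (f x)) ∧
    (∀ x, f x = D.rot (D.rot t) → f (D'.rot x) = D.rot (D.rot (D.rot t))) ∧
    (∀ x, f x = D.rot (D.rot (D.rot t)) → f (D'.rot x) = D.rot (D.rot t)) ∧
    (∀ x, f x ≠ D.rot (D.rot t) → f x ≠ D.rot (D.rot (D.rot t)) →
      f (D'.rot x) = D.rot (f x)) ∧
    (∀ x, D'.IsCrossing x → D'.isOver x = D.isOver (f x)) ∧
    (∃ x, D'.faceOf x = D'.outer ∧ D.faceOf (f x) = D.outer)

/-- `D'` arises from `D` by pulling apart two strands that bound a bigon, where after the move the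
two strands belong to the edges `ε₁`, `ε₂` of `D'`.  The bounded region on the left of `t` and of
`u` is a disc whose boundary has exactly the two vertices of `t` and `u`.  The strand through `t`
is over at both of them or under at both of them.  The four darts on the boundary of the disc are
deleted, and the four others at the two crossings are joined in pairs along the two strands, as
two marked points of `D'`; nothing else changes. -/
def RemoveBigonAt (D D' : KnotDiagram) (ε₁ ε₂ : D'.Edge) : Prop :=
  ∃ (t u : D.Dart) (f : D'.Dart → D.Dart),
    D.IsCrossing t ∧ D.IsCrossing u ∧ ¬ D.rot.SameCycle t u ∧
    D.edge t = D.rot u ∧ D.edge u = D.rot t ∧ D.isOver t = D.isOver (D.rot u) ∧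
    D.faceOf t ≠ D.outer ∧
    Function.Injective f ∧ Set.range f = {t, D.rot t, u, D.rot u}ᶜ ∧
    (∀ x, f (D'.edge x) = D.edge (f x)) ∧
    (∀ x, f x = D.rot (D.rot t) → f (D'.rot x) = D.rot (D.rot (D.rot u))) ∧
    (∀ x, f x = D.rot (D.rot (D.rot u)) → f (D'.rot x) = D.rot (D.rot t)) ∧
    (∀ x, f x = D.rot (D.rot u) → f (D'.rot x) = D.rot (D.rot (D.rot t))) ∧
    (∀ x, f x = D.rot (D.rot (D.rot t)) → f (D'.rot x) = D.rot (D.rot u)) ∧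
    (∀ x, ¬ D.rot.SameCycle t (f x) → ¬ D.rot.SameCycle u (f x) →
      f (D'.rot x) = D.rot (f x)) ∧
    (∀ x, D'.IsCrossing x → D'.isOver x = D.isOver (f x)) ∧
    (∃ x, D'.faceOf x = D'.outer ∧ D.faceOf (f x) = D.outer) ∧
    (∃ x, f x = D.rot (D.rot t) ∧ D'.edgeOf x = ε₁) ∧
    (∃ x, f x = D.rot (D.rot u) ∧ D'.edgeOf x = ε₂)

/-- `D'` arises from `D` by a triple point move.  The bounded region on the left of `t 0`, `t 1`,
`t 2` is a disc whose boundary has exactly the vertices of these three darts, which are distinct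
crossings.  Three strands pass through them, the `k`-th one through the darts
`rot (rot (t k))`, `t k`, `rot (t (k+1))`, `rot (rot (rot (t (k+1))))` in this order, and one of
the strands is over the two others, and one is under the two others.  After the move every strand
passes through its two crossings in the opposite order, with its direction at both crossings
unchanged; thus the two darts `rot (rot (t k))`, `rot (rot (rot (t (k+1))))` are joined to each
other, and what was attached to them is attached to `rot (t (k+1))` and `t k`, respectively. The
permutation `π` records this change of attachment. -/
def TripleMove (D D' : KnotDiagram) : Prop :=
  ∃ (t : Fin 3 → D.Dart) (π : D.Dart → D.Dart) (f : D.Dart ≃ D'.Dart),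
    (∀ k, D.IsCrossing (t k)) ∧ (∀ k l, k ≠ l → ¬ D.rot.SameCycle (t k) (t l)) ∧
    (∀ k, D.edge (t k) = D.rot (t (k + 1))) ∧
    ¬ (D.isOver (t 0) = D.isOver (t 1) ∧ D.isOver (t 1) = D.isOver (t 2)) ∧
    D.faceOf (t 0) ≠ D.outer ∧
    (∀ k, π (t k) = D.rot (D.rot (D.rot (t (k + 1)))) ∧
      π (D.rot (D.rot (D.rot (t (k + 1))))) = t k ∧
      π (D.rot (D.rot (t k))) = D.rot (t (k + 1)) ∧
      π (D.rot (t (k + 1))) = D.rot (D.rot (t k))) ∧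
    (∀ x, (∀ k, ¬ D.rot.SameCycle (t k) x) → π x = x) ∧
    (∀ x, D'.edge (f (π x)) = f (π (D.edge x))) ∧
    (∀ x, D'.rot (f x) = f (D.rot x)) ∧
    (∀ x, D.IsCrossing x → D'.isOver (f x) = D.isOver x) ∧
    (∃ x, (∀ k, x ≠ t k ∧ x ≠ D.rot (t k)) ∧
      D.faceOf x = D.outer ∧ D'.faceOf (f (π x)) = D'.outer)

/-- The Reidemeister moves `Ω₁`, `Ω₂`, `Ω₃`, each in both directions. -/
def IsMove : ℕ → KnotDiagram → KnotDiagram → Prop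
  | 1, D, D' => RemoveKink D D' ∨ RemoveKink D' D
  | 2, D, D' => (∃ ε₁ ε₂, RemoveBigonAt D D' ε₁ ε₂) ∨ (∃ ε₁ ε₂, RemoveBigonAt D' D ε₁ ε₂)
  | 3, D, D' => TripleMove D D' ∨ TripleMove D' D
  | _, _, _ => False

/-- There is a Reidemeister sequence from `D` to `D'`. -/
def Equivalent : KnotDiagram → KnotDiagram → Prop :=
  Relation.ReflTransGen fun A B => PlanarIsotopic A B ∨ ∃ n, IsMove n A B

/-- There is a Reidemeister sequence from `D` to `D'` that contains no `Ωₙ`-move: the pair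
`{D, D'}` is `Ωₙ`-independent. -/
def Independent (n : ℕ) : KnotDiagram → KnotDiagram → Prop :=
  Relation.ReflTransGen fun A B => PlanarIsotopic A B ∨ ∃ m, m ≠ n ∧ IsMove m A B

/-- The pair `{D, D'}` is `Ωₙ`-dependent. -/
def Dependent (n : ℕ) (D D' : KnotDiagram) : Prop := ¬ Independent n D D'

/-- A diagram of the unknot. -/
def IsUnknotted (D : KnotDiagram) : Prop := ∃ U, Equivalent D U ∧ ∀ x, ¬ U.IsCrossing x

/-- `D'` arises from `D`, after a planar isotopy, by one `Ω₂`-move that creates two crossings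
between two distinct edges of the diagram. -/
def CrossTwoEdges (D D' : KnotDiagram) : Prop :=
  ∃ (D₁ : KnotDiagram) (ε₁ ε₂ : D₁.Edge),
    PlanarIsotopic D D₁ ∧ ε₁ ≠ ε₂ ∧ RemoveBigonAt D' D₁ ε₁ ε₂

end KnotDiagram

/-- A diagram of a (1,1)-tangle, that is, of a single strand in a disc joining two boundary points.
It is given by its closure, obtained by joining the two ends by an arc outside of the disc; the
tangle is recovered by cutting the closure open on the segment `cut`, which borders the unbounded
region.  The ends of the tangle are the halves `cut` and `edge cut` of the segment. -/
structure Tangle where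
  closure : KnotDiagram
  cut : closure.Dart
  cut_outer : closure.faceOf cut = closure.outer

namespace Tangle

/-- The knot type of a (1,1)-tangle is that of its closure. -/
def IsUnknotted (T : Tangle) : Prop := T.closure.IsUnknotted

end Tangle

namespace KnotDiagram

/-- `E` arises from `D` by replacing every edge `ε` of `D` by the (1,1)-tangle `T ε`: a segment of
`ε`, with halves `x ε` and `edge (x ε)`, is cut, and the two ends are joined to the two ends of the
tangle. -/
def ReplaceEdges (D : KnotDiagram) (T : D.Edge → Tangle) (E : KnotDiagram) : Prop :=
  ∃ (x : D.Edge → D.Dart) (i : D.Dart → E.Dart) (j : ∀ ε, (T ε).closure.Dart → E.Dart),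
    (∀ ε, D.edgeOf (x ε) = ε) ∧
    Function.Bijective (Sum.elim i fun p : Σ ε, (T ε).closure.Dart => j p.1 p.2) ∧
    (∀ ε, E.edge (i (x ε)) = j ε ((T ε).closure.edge (T ε).cut)) ∧
    (∀ ε, E.edge (i (D.edge (x ε))) = j ε (T ε).cut) ∧
    (∀ a, (∀ ε, a ≠ x ε ∧ a ≠ D.edge (x ε)) → E.edge (i a) = i (D.edge a)) ∧
    (∀ ε b, b ≠ (T ε).cut → b ≠ (T ε).closure.edge (T ε).cut →
      E.edge (j ε b) = j ε ((T ε).closure.edge b)) ∧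
    (∀ a, E.rot (i a) = i (D.rot a)) ∧
    (∀ ε b, E.rot (j ε b) = j ε ((T ε).closure.rot b)) ∧
    (∀ a, D.IsCrossing a → E.isOver (i a) = D.isOver a) ∧
    (∀ ε b, (T ε).closure.IsCrossing b → E.isOver (j ε b) = (T ε).closure.isOver b) ∧
    (∃ a, D.faceOf a = D.outer ∧ E.faceOf (i a) = E.outer)

end KnotDiagram

/-!
The diagram `D` may be replaced by its reduction `R`, the same diagram without marked points. Since
`D` has no polygons with fewer than three edges, `R` has no monogons and no bigons (`IsBase`). The
proof follows a class of diagrams that is invariant under all moves but `Ω₂`. A diagram `F` is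
`Tangled` if it looks like `R` with every edge replaced by an unknotted tangle. This is recorded by
a decomposition (`Decomp`): the crossings of `R` are embedded into `F` as the core, and every dart
of `F` is labelled by an edge of `R`, the label changing only at core crossings. The darts with a
given label form the tangle in that edge; its closure is obtained by joining the two core ends, at a
marked point adjacent to infinity.

Let a move be applied to a tangled diagram.

* Planar isotopies and marked points do no harm (`Tangled.of_planarIsotopic`).
* A kink at a core crossing would make an edge of `R` bound a monogon. Every other kink is removed
  or created within one tangle, whose closure stays unknotted (`Tangled.of_removeKink`).
* The sides of a triangle at which an `Ω₃`-move takes place are segments. If no corner is a core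
  crossing, the labels show that the whole triangle lies in one tangle. If some corners are core
  crossings and others are not, then `R` would have a monogon or a bigon. If all corners are core
  crossings, then the triangle is a region of `R`, and as it is bounded in `F` it is bounded in `R`;
  so `R`, which is planar isotopic to `D`, would admit an `Ω₃`-move (`Tangled.of_tripleMove`).

Hence all diagrams that are obtained from `D` without `Ω₂`-moves are tangled
(`Tangled.of_independent`), and cutting the closed tangles open inside the edges of `D` gives
diagrams that agree with them up to marked points (`Tangled.exists_replaceEdges`).

Moves and gluings are first treated for maps without a chosen unbounded region. That planarity is
preserved rests on two facts: for a connected curve Euler's formula says that there are two more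
regions than crossings (`IsKnot.isPlanar_iff`), and the regions of two maps with common darts can be
compared through the first returns of the boundary walks to these darts
(`faceOf_eq_iff_of_returns`).

An `Ω₂`-move between two distinct edges is possible at two consecutive edges of the unbounded region
(`exists_crossTwoEdges`); these are distinct because `D` has no loop, that is, no edge that leaves
its crossing by two adjacent darts. Suppose that a diagram `D'` obtained from `D` by such a move
were tangled. It has two crossings more than `D`, and these lie in the tangles, so some tangle has
one or two crossings. By counting regions, the closure of this tangle has a loop that avoids the
point where it is closed up (`IsKnot.exists_loop`), and so `D'` has a loop
(`Decomp.hasLoop_of_card`). But the move creates no loop, because the two strands through the new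
crossings belong to different edges of `D` (`RemoveBigonAt.hasLoop_and_card_crossing`).
-/

/-! ### Orbits of permutations and first returns -/

/-- `Returns p S x y`: the orbit of `x` under `p`, after having left `x`, meets `S` for the first
time at `y`. -/
inductive Returns {X : Type*} (p : X → X) (S : Set X) : X → X → Prop
  | here {x : X} (h : p x ∈ S) : Returns p S x (p x)
  | skip {x y : X} (h : p x ∉ S) (hy : Returns p S (p x) y) : Returns p S x y

theorem Returns.here_eq {X : Type*} {p : X → X} {S : Set X} {x y : X} (h : p x = y) (hy : y ∈ S) :
    Returns p S x y := by
  subst h; exact .here hy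

theorem Returns.skip_eq {X : Type*} {p : X → X} {S : Set X} {x y z : X} (h : p x = z) (hz : z ∉ S)
    (hy : Returns p S z y) : Returns p S x y := by
  subst h; exact .skip hz hy

theorem Returns.sameCycle {X : Type*} {p : Equiv.Perm X} {S : Set X} {x y : X}
    (h : Returns p S x y) : p.SameCycle x y := by
  induction h with
  | here _ => exact (Equiv.Perm.SameCycle.refl p _).apply_right
  | skip _ _ ih => exact Equiv.Perm.sameCycle_apply_left.1 ih

theorem Returns.le_iterate {X : Type*} {p : X → X} {S : Set X} {x y : X} (h : Returns p S x y)
    (n : ℕ) (hn : p^[n + 1] x ∈ S) : ∃ m ≤ n, p^[m] y = p^[n + 1] x := by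
  induction h generalizing n with
  | here _ => exact ⟨n, le_rfl, rfl⟩
  | skip h _ ih =>
    cases n with
    | zero => exact absurd hn h
    | succ n =>
      obtain ⟨m, hm, he⟩ := ih n hn
      exact ⟨m, hm.trans n.le_succ, he⟩

theorem sameCycle_iff_iterate {X : Type*} [Finite X] (p : Equiv.Perm X) {x y : X} :
    p.SameCycle x y ↔ ∃ n : ℕ, p^[n] x = y := by
  constructor
  · intro h
    obtain ⟨n, hn⟩ := h.exists_nat_pow_eq
    exact ⟨n, by rw [← hn, Equiv.Perm.coe_pow]⟩
  · rintro ⟨n, hn⟩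
    refine ⟨n, ?_⟩
    rw [zpow_natCast, Equiv.Perm.coe_pow, hn]

/-- The cycles of a permutation, restricted to a subset, are the cycles of the first return map. -/
theorem sameCycle_iff_of_returns {X Y : Type*} [Finite X] (p : Equiv.Perm X) (h : Y → X)
    (n : Y → Y) (hi : Function.Injective h) (hr : ∀ y, Returns p (Set.range h) (h y) (h (n y)))
    {y y' : Y} : p.SameCycle (h y) (h y') ↔ ∃ i : ℕ, n^[i] y = y' := by
  constructor
  · intro hc
    obtain ⟨k, hk⟩ := (sameCycle_iff_iterate p).1 hc
    induction k using Nat.strong_induction_on generalizing y with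
    | _ k ih =>
      cases k with
      | zero => exact ⟨0, hi hk⟩
      | succ k =>
        obtain ⟨m, hm, he⟩ := (hr y).le_iterate k (hk ▸ ⟨y', rfl⟩)
        have he' : p^[m] (h (n y)) = h y' := he.trans hk
        obtain ⟨i, h_i⟩ := ih m (by omega) ((sameCycle_iff_iterate p).2 ⟨m, he'⟩) he'
        exact ⟨i + 1, h_i⟩
  · rintro ⟨i, rfl⟩
    induction i generalizing y with
    | zero => exact .refl _ _
    | succ i ih => exact (hr y).sameCycle.trans (ih (y := n y))

theorem Equiv.Perm.SameCycle.mem_of_forward_closed {X : Type*} [Finite X] {p : Equiv.Perm X}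
    {x y : X} (h : p.SameCycle x y) (S : Set X) (hx : x ∈ S) (hS : ∀ z ∈ S, p z ∈ S) : y ∈ S := by
  obtain ⟨n, rfl⟩ := (sameCycle_iff_iterate p).1 h
  clear h
  induction n generalizing x with
  | zero => exact hx
  | succ n ih => exact ih (hS x hx)

open Classical in
theorem card_cycles_mul {X : Type*} [Fintype X] (p : Equiv.Perm X) (w : X → ℕ) (c : ℕ)
    (h : ∀ x, ∑ y with p.SameCycle x y, w y = c) :
    Nat.card (Quotient (Equiv.Perm.SameCycle.setoid p)) * c = ∑ x, w x := by
  have : Fintype (Quotient (Equiv.Perm.SameCycle.setoid p)) := Fintype.ofFinite _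
  rw [← Finset.sum_fiberwise Finset.univ
    (fun x => (Quotient.mk (Equiv.Perm.SameCycle.setoid p) x)) w, Nat.card_eq_fintype_card]
  rw [Finset.sum_congr rfl (g := fun _ => c)]
  · simp
  · intro v _
    induction v using Quotient.inductionOn with
    | _ x =>
      rw [← h x]
      refine Finset.sum_congr ?_ fun _ _ => rfl
      ext y
      simp only [Finset.mem_filter, Finset.mem_univ, true_and]
      rw [Quotient.eq]
      exact Equiv.Perm.sameCycle_comm

theorem eq_or_eq_apply_of_sameCycle {X : Type*} [Finite X] {p : Equiv.Perm X} {x y : X}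
    (hp : p (p x) = x) (h : p.SameCycle x y) : y = x ∨ y = p x := by
  refine h.mem_of_forward_closed {z | z = x ∨ z = p x} (Or.inl rfl) ?_
  rintro z (rfl | rfl)
  · exact Or.inr rfl
  · exact Or.inl hp

theorem mem_four_of_sameCycle {X : Type*} [Finite X] {p : Equiv.Perm X} {x y : X}
    (hp : p (p (p (p x))) = x) (h : p.SameCycle x y) :
    y = x ∨ y = p x ∨ y = p (p x) ∨ y = p (p (p x)) := by
  refine h.mem_of_forward_closed {z | z = x ∨ z = p x ∨ z = p (p x) ∨ z = p (p (p x))}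
    (Or.inl rfl) ?_
  rintro z (rfl | rfl | rfl | rfl)
  · simp
  · simp
  · simp
  · exact Or.inl hp

namespace CurveMap

instance (M : CurveMap) : Finite M.Dart := M.finite

variable {M N : CurveMap}

/-! ### Diagrams without a choice of the unbounded region -/

/-- The axioms of a knot diagram, except for planarity and for the choice of the unbounded region:
a knot diagram on some closed oriented surface. -/
structure IsKnot (M : CurveMap) : Prop where
  edge_edge : ∀ x, M.edge (M.edge x) = x
  edge_ne : ∀ x, M.edge x ≠ x
  rot_ne : ∀ x, M.rot x ≠ x
  rot_four : ∀ x, M.rot (M.rot (M.rot (M.rot x))) = x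
  isOver_rot : ∀ x, M.IsCrossing x → M.isOver (M.rot x) = !M.isOver x
  one_component : ∀ x y, Relation.EqvGen M.Straight x y

/-- Euler's formula for the sphere. -/
def IsPlanar (M : CurveMap) : Prop :=
  Nat.card M.Vertex + Nat.card M.Face = Nat.card M.Segment + 2

theorem faceOf_eq {x y : M.Dart} : M.faceOf x = M.faceOf y ↔ M.next.SameCycle x y := Quotient.eq

theorem edgeOf_eq {x y : M.Dart} :
    M.edgeOf x = M.edgeOf y ↔ Relation.EqvGen M.AlongEdge x y := Quotient.eq

theorem faceOf_surj (F : M.Face) : ∃ x, M.faceOf x = F := Quotient.exists_rep F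

theorem edgeOf_surj (ε : M.Edge) : ∃ x, M.edgeOf x = ε := Quotient.exists_rep ε

theorem next_apply (x : M.Dart) : M.next x = M.rot.symm (M.edge x) := rfl

theorem faceOf_next (x : M.Dart) : M.faceOf (M.next x) = M.faceOf x :=
  faceOf_eq.2 (Equiv.Perm.SameCycle.refl _ _).apply_left

theorem edgeOf_edge (x : M.Dart) : M.edgeOf (M.edge x) = M.edgeOf x :=
  (edgeOf_eq.2 (.rel _ _ (Or.inl rfl))).symm

theorem edgeOf_rot {x : M.Dart} (h : M.IsPoint x) : M.edgeOf (M.rot x) = M.edgeOf x :=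
  (edgeOf_eq.2 (.rel _ _ (Or.inr ⟨h, rfl⟩))).symm

theorem eq_of_edgeOf_eq {α : Sort*} (κ : M.Dart → α) (he : ∀ x, κ (M.edge x) = κ x)
    (hr : ∀ x, M.IsPoint x → κ (M.rot x) = κ x) {x y : M.Dart} (h : M.edgeOf x = M.edgeOf y) :
    κ x = κ y := by
  induction edgeOf_eq.1 h with
  | rel a b hab =>
    rcases hab with rfl | ⟨hp, rfl⟩
    · exact (he a).symm
    · exact (hr a hp).symm
  | refl => rfl
  | symm a b _ ih => exact (ih (edgeOf_eq.2 (by assumption))).symm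
  | trans a b c h1 h2 ih1 ih2 => exact (ih1 (edgeOf_eq.2 h1)).trans (ih2 (edgeOf_eq.2 h2))

theorem IsPoint.rot {x : M.Dart} (h : M.IsPoint x) : M.IsPoint (M.rot x) := by
  unfold IsPoint at h ⊢; rw [h]

theorem isPoint_rot_iff {x : M.Dart} : M.IsPoint (M.rot x) ↔ M.IsPoint x :=
  ⟨fun h => M.rot.injective h, IsPoint.rot⟩

theorem isCrossing_rot_iff {x : M.Dart} : M.IsCrossing (M.rot x) ↔ M.IsCrossing x :=
  not_congr isPoint_rot_iff

theorem IsPoint.rot_symm {x : M.Dart} (h : M.IsPoint x) : M.rot.symm x = M.rot x := by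
  rw [Equiv.symm_apply_eq]; exact h.symm

/-- Knots on a surface have one component, so a property that is preserved by walking straight on
and holds for one dart holds for all of them. -/
theorem IsKnot.forall_of_straight (hM : M.IsKnot) (Q : M.Dart → Prop) (x : M.Dart) (hx : Q x)
    (hQ : ∀ a b, M.Straight a b → (Q a ↔ Q b)) (y : M.Dart) : Q y := by
  have : Q x ↔ Q y := by
    clear hx
    induction hM.one_component x y with
    | rel a b h => exact hQ a b h
    | refl => rfl
    | symm a b _ ih => exact ih.symm
    | trans a b c _ _ ih1 ih2 => exact ih1.trans ih2
  exact this.1 hx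

namespace IsKnot

theorem rot_symm (hM : M.IsKnot) (x : M.Dart) : M.rot.symm x = M.rot (M.rot (M.rot x)) := by
  rw [Equiv.symm_apply_eq, hM.rot_four]

theorem edge_eq_iff (hM : M.IsKnot) {x y : M.Dart} : M.edge x = y ↔ x = M.edge y := by
  constructor
  · rintro rfl; exact (hM.edge_edge x).symm
  · rintro rfl; exact hM.edge_edge y

theorem rot_rot_rot_ne (hM : M.IsKnot) (x : M.Dart) : M.rot (M.rot (M.rot x)) ≠ x := by
  intro h
  have := congrArg M.rot h
  rw [hM.rot_four] at this
  exact hM.rot_ne x this.symm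

/-- Euler's formula in terms of crossings only: with `n` crossings there are `n + 2` regions. -/
theorem isPlanar_iff (hM : M.IsKnot) :
    M.IsPlanar ↔ 4 * Nat.card M.Face = Nat.card {x // M.IsCrossing x} + 8 := by
  classical
  have : Fintype M.Dart := Fintype.ofFinite _
  have hs : Nat.card M.Segment * 2 = ∑ x : M.Dart, 1 := by
    refine card_cycles_mul M.edge (fun _ => 1) 2 fun x => ?_
    have : (Finset.univ.filter fun y => M.edge.SameCycle x y) = {x, M.edge x} := by
      ext y
      simp only [Finset.mem_filter, Finset.mem_univ, true_and, Finset.mem_insert,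
        Finset.mem_singleton]
      refine ⟨eq_or_eq_apply_of_sameCycle (hM.edge_edge x), ?_⟩
      rintro (rfl | rfl)
      · exact .refl _ _
      · exact (Equiv.Perm.SameCycle.refl _ _).apply_right
    rw [this, Finset.sum_pair (hM.edge_ne x).symm]
  -- Every vertex gets the weight four, shared equally among its two or four darts.
  have hv : Nat.card M.Vertex * 4 = ∑ x : M.Dart, if M.IsPoint x then 2 else 1 := by
    refine card_cycles_mul M.rot (fun x => if M.IsPoint x then 2 else 1) 4 fun x => ?_
    by_cases hx : M.IsPoint x
    · have : (Finset.univ.filter fun y => M.rot.SameCycle x y) = {x, M.rot x} := by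
        ext y
        simp only [Finset.mem_filter, Finset.mem_univ, true_and, Finset.mem_insert,
          Finset.mem_singleton]
        refine ⟨eq_or_eq_apply_of_sameCycle hx, ?_⟩
        rintro (rfl | rfl)
        · exact .refl _ _
        · exact (Equiv.Perm.SameCycle.refl _ _).apply_right
      rw [this, Finset.sum_pair (hM.rot_ne x).symm]
      simp [hx, hx.rot]
    · have : (Finset.univ.filter fun y => M.rot.SameCycle x y) =
          {x, M.rot x, M.rot (M.rot x), M.rot (M.rot (M.rot x))} := by
        ext y
        simp only [Finset.mem_filter, Finset.mem_univ, true_and, Finset.mem_insert,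
          Finset.mem_singleton]
        refine ⟨mem_four_of_sameCycle (hM.rot_four x), ?_⟩
        rintro (rfl | rfl | rfl | rfl)
        · exact .refl _ _
        all_goals simp [Equiv.Perm.sameCycle_apply_right, Equiv.Perm.SameCycle.refl]
      have hx' : M.rot (M.rot x) ≠ x := hx
      have h1 := hM.rot_ne x
      have h3 := hM.rot_rot_rot_ne x
      have e1 : M.IsPoint (M.rot x) ↔ M.IsPoint x := isPoint_rot_iff
      have e2 : M.IsPoint (M.rot (M.rot x)) ↔ M.IsPoint x := isPoint_rot_iff.trans e1
      have e3 : M.IsPoint (M.rot (M.rot (M.rot x))) ↔ M.IsPoint x := isPoint_rot_iff.trans e2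
      rw [this, Finset.sum_insert, Finset.sum_insert, Finset.sum_insert, Finset.sum_singleton]
      · simp [e1, e2, e3, hx]
      · simpa using fun h => hM.rot_ne x h.symm
      · simp only [Finset.mem_insert, Finset.mem_singleton, not_or]
        exact ⟨fun h => h1 (M.rot.injective h.symm), fun h => hx' (M.rot.injective h.symm)⟩
      · simp only [Finset.mem_insert, Finset.mem_singleton, not_or]
        exact ⟨h1.symm, hx'.symm, h3.symm⟩
  have hc : Nat.card {x // M.IsCrossing x} = ∑ x : M.Dart, if M.IsPoint x then 0 else 1 := by
    rw [Nat.card_eq_fintype_card, Fintype.card_subtype, Finset.card_filter]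
    refine Finset.sum_congr rfl fun x _ => ?_
    by_cases hx : M.IsPoint x <;> simp [IsCrossing, hx]
  -- Marked points contribute as many vertices as segments, and crossings half as many.
  have key : Nat.card M.Vertex * 4 + Nat.card {x // M.IsCrossing x} = Nat.card M.Segment * 4 := by
    rw [hv, hc, ← Finset.sum_add_distrib, show Nat.card M.Segment * 4 =
      (Nat.card M.Segment * 2) * 2 by ring, hs, Finset.sum_mul]
    refine Finset.sum_congr rfl fun x _ => ?_
    split_ifs <;> rfl
  unfold IsPlanar
  omega

end IsKnot

/-- Comparison of the numbers of regions of two maps through a set `S` of common darts. -/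
theorem card_face_add {S : Type*} (h₁ : S → M.Dart) (h₂ : S → N.Dart)
    (h : ∀ s s', M.faceOf (h₁ s) = M.faceOf (h₁ s') ↔ N.faceOf (h₂ s) = N.faceOf (h₂ s'))
    (A : Set M.Face) (B : Set N.Face) (hA : ∀ F, F ∈ A ↔ ∀ s, M.faceOf (h₁ s) ≠ F)
    (hB : ∀ F, F ∈ B ↔ ∀ s, N.faceOf (h₂ s) ≠ F) :
    Nat.card M.Face + B.ncard = Nat.card N.Face + A.ncard := by
  have hA' : Aᶜ = Set.range fun s => M.faceOf (h₁ s) := by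
    ext F; simp [hA]
  have hB' : Bᶜ = Set.range fun s => N.faceOf (h₂ s) := by
    ext F; simp [hB]
  have e : Aᶜ.ncard = Bᶜ.ncard := by
    rw [hA', hB']
    refine Set.ncard_congr' ?_
    have lift : ∀ F ∈ Set.range (fun s => M.faceOf (h₁ s)), ∃ s, M.faceOf (h₁ s) = F :=
      fun F hF => hF
    refine Equiv.ofBijective
      (fun F => ⟨N.faceOf (h₂ (lift F.1 F.2).choose), _, rfl⟩) ⟨?_, ?_⟩
    · rintro ⟨F, hF⟩ ⟨G, hG⟩ hFG
      have := (h _ _).2 (congrArg Subtype.val hFG)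
      rw [(lift F hF).choose_spec, (lift G hG).choose_spec] at this
      exact Subtype.ext this
    · rintro ⟨_, s, rfl⟩
      refine ⟨⟨M.faceOf (h₁ s), s, rfl⟩, Subtype.ext ?_⟩
      exact (h _ _).1 (lift (M.faceOf (h₁ s)) ⟨s, rfl⟩).choose_spec
  have h1 := Set.ncard_add_ncard_compl A
  have h2 := Set.ncard_add_ncard_compl B
  omega

theorem card_face_eq (f : M.Dart → N.Dart)
    (h : ∀ x y, M.faceOf x = M.faceOf y ↔ N.faceOf (f x) = N.faceOf (f y))
    (hs : ∀ z, ∃ x, N.faceOf (f x) = N.faceOf z) : Nat.card M.Face = Nat.card N.Face := by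
  have := card_face_add (M := M) (N := N) id f h ∅ ∅
    (fun F => by
      obtain ⟨x, rfl⟩ := faceOf_surj F
      simp only [id, Set.mem_empty_iff_false, false_iff, not_forall, not_not]
      exact ⟨x, rfl⟩)
    (fun F => by obtain ⟨z, rfl⟩ := faceOf_surj F; simpa using hs z)
  simpa using this

theorem card_face_add_one (f : M.Dart → N.Dart) (t : N.Dart)
    (h : ∀ x y, M.faceOf x = M.faceOf y ↔ N.faceOf (f x) = N.faceOf (f y))
    (ht : ∀ x, N.faceOf (f x) ≠ N.faceOf t)
    (hs : ∀ z, N.faceOf z = N.faceOf t ∨ ∃ x, N.faceOf (f x) = N.faceOf z) :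
    Nat.card M.Face + 1 = Nat.card N.Face := by
  have := card_face_add (M := M) (N := N) id f h ∅ {N.faceOf t}
    (fun F => by
      obtain ⟨x, rfl⟩ := faceOf_surj F
      simp only [id, Set.mem_empty_iff_false, false_iff, not_forall, not_not]
      exact ⟨x, rfl⟩)
    (fun F => by
      obtain ⟨z, rfl⟩ := faceOf_surj F
      rw [Set.mem_singleton_iff]
      refine ⟨fun e => e ▸ ht, fun e => (hs z).resolve_right fun ⟨x, hx⟩ => e x hx⟩)
  simpa using this

/-- The regions of `M` and `N` agree on common darts, when the two first return maps do. -/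
theorem faceOf_eq_iff_of_returns {S : Type*} (h₁ : S → M.Dart) (h₂ : S → N.Dart) (n : S → S)
    (i₁ : Function.Injective h₁) (i₂ : Function.Injective h₂)
    (r₁ : ∀ s, Returns M.next (Set.range h₁) (h₁ s) (h₁ (n s)))
    (r₂ : ∀ s, Returns N.next (Set.range h₂) (h₂ s) (h₂ (n s))) (s s' : S) :
    M.faceOf (h₁ s) = M.faceOf (h₁ s') ↔ N.faceOf (h₂ s) = N.faceOf (h₂ s') := by
  rw [faceOf_eq, faceOf_eq, sameCycle_iff_of_returns _ h₁ n i₁ r₁,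
    sameCycle_iff_of_returns _ h₂ n i₂ r₂]

theorem faceOf_eq_iff_of_returns_next (f : M.Dart → N.Dart) (hi : Function.Injective f)
    (r : ∀ x, Returns N.next (Set.range f) (f x) (f (M.next x))) (x y : M.Dart) :
    M.faceOf x = M.faceOf y ↔ N.faceOf (f x) = N.faceOf (f y) :=
  faceOf_eq_iff_of_returns id f M.next Function.injective_id hi
    (fun _ => .here (by simp)) r x y

end CurveMap

/-! ### Marked points -/

/-- The knot diagram with given underlying map and unbounded region. -/
def KnotDiagram.ofMap (M : CurveMap) (hM : M.IsKnot) (hp : M.IsPlanar) (o : M.Face) :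
    KnotDiagram :=
  { M with
    edge_edge := hM.edge_edge
    edge_ne := hM.edge_ne
    rot_ne := hM.rot_ne
    rot_four := hM.rot_four
    isOver_rot := hM.isOver_rot
    one_component := hM.one_component
    euler := hp
    outer := o }

theorem KnotDiagram.isKnot (D : KnotDiagram) : D.toCurveMap.IsKnot :=
  ⟨D.edge_edge, D.edge_ne, D.rot_ne, D.rot_four, D.isOver_rot, D.one_component⟩

theorem KnotDiagram.isPlanar (D : KnotDiagram) : D.toCurveMap.IsPlanar := D.euler

namespace CurveMap

variable {M N M' : CurveMap}

theorem card_crossing_eq (f : M'.Dart → M.Dart)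
    (hi : ∀ x y, M'.IsCrossing x → M'.IsCrossing y → f x = f y → x = y)
    (hc : ∀ x, M'.IsCrossing x → M.IsCrossing (f x))
    (hs : ∀ z, M.IsCrossing z → ∃ x, M'.IsCrossing x ∧ f x = z) :
    Nat.card {x // M'.IsCrossing x} = Nat.card {x // M.IsCrossing x} := by
  refine Nat.card_eq_of_bijective (fun x => ⟨f x.1, hc x.1 x.2⟩) ⟨?_, ?_⟩
  · rintro ⟨x, hx⟩ ⟨y, hy⟩ h
    exact Subtype.ext (hi x y hx hy (congrArg Subtype.val h))
  · rintro ⟨z, hz⟩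
    obtain ⟨x, hx, rfl⟩ := hs z hz
    exact ⟨⟨x, hx⟩, rfl⟩

/-- A map that respects generating relations respects the equivalence relations. -/
theorem eqvGen_of_kernel {X Y : Type*} {r : X → X → Prop} {s : Y → Y → Prop} (ρ : X → Y)
    (h : ∀ a b, r a b → Relation.EqvGen s (ρ a) (ρ b)) {x y : X} (hxy : Relation.EqvGen r x y) :
    Relation.EqvGen s (ρ x) (ρ y) := by
  induction hxy with
  | rel a b hab => exact h a b hab
  | refl => exact .refl _
  | symm a b _ ih => exact .symm _ _ ih
  | trans a b c _ _ ih1 ih2 => exact .trans _ _ _ ih1 ih2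

/-- `KnotDiagram.Forget` without the condition on the unbounded regions. -/
structure ForgetAt (M M' : CurveMap) (p : M.Dart) (f : M'.Dart → M.Dart) : Prop where
  point : M.IsPoint p
  edge_ne_rot : M.edge p ≠ M.rot p
  inj : Function.Injective f
  range : Set.range f = {p, M.rot p}ᶜ
  edge_left : ∀ x, M.edge (f x) = p → f (M'.edge x) = M.edge (M.rot p)
  edge_right : ∀ x, M.edge (f x) = M.rot p → f (M'.edge x) = M.edge p
  edge_other : ∀ x, M.edge (f x) ≠ p → M.edge (f x) ≠ M.rot p → f (M'.edge x) = M.edge (f x)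
  rot : ∀ x, f (M'.rot x) = M.rot (f x)
  isOver : ∀ x, M'.IsCrossing x → M'.isOver x = M.isOver (f x)

namespace ForgetAt

variable {p : M.Dart} {f : M'.Dart → M.Dart}

theorem exists_eq (h : ForgetAt M M' p f) {x : M.Dart} (h1 : x ≠ p) (h2 : x ≠ M.rot p) :
    ∃ y, f y = x := by
  have : x ∈ Set.range f := by rw [h.range]; simp [h1, h2]
  exact this

theorem ne_left (h : ForgetAt M M' p f) (x : M'.Dart) : f x ≠ p := by
  have : f x ∈ Set.range f := ⟨x, rfl⟩
  rw [h.range] at this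
  simp only [Set.mem_compl_iff, Set.mem_insert_iff, Set.mem_singleton_iff, not_or] at this
  exact this.1

theorem ne_right (h : ForgetAt M M' p f) (x : M'.Dart) : f x ≠ M.rot p := by
  have : f x ∈ Set.range f := ⟨x, rfl⟩
  rw [h.range] at this
  simp only [Set.mem_compl_iff, Set.mem_insert_iff, Set.mem_singleton_iff, not_or] at this
  exact this.2

theorem isPoint_iff (h : ForgetAt M M' p f) (x : M'.Dart) : M'.IsPoint x ↔ M.IsPoint (f x) := by
  unfold IsPoint
  rw [← h.rot, ← h.rot, h.inj.eq_iff]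

theorem isCrossing_iff (h : ForgetAt M M' p f) (x : M'.Dart) :
    M'.IsCrossing x ↔ M.IsCrossing (f x) := not_congr (h.isPoint_iff x)

theorem rot_symm (h : ForgetAt M M' p f) (x : M'.Dart) :
    f (M'.rot.symm x) = M.rot.symm (f x) := by
  rw [Equiv.eq_symm_apply, ← h.rot, Equiv.apply_symm_apply]

/-- The darts on the two sides of the marked point. -/
theorem exists_sides (h : ForgetAt M M' p f) (hM : M.IsKnot) :
    ∃ a b, f a = M.edge p ∧ f b = M.edge (M.rot p) ∧ M'.edge a = b ∧ M'.edge b = a := by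
  obtain ⟨a, ha⟩ := h.exists_eq (hM.edge_ne p) h.edge_ne_rot
  obtain ⟨b, hb⟩ := h.exists_eq (x := M.edge (M.rot p))
    (fun e => h.edge_ne_rot (by rw [← e, hM.edge_edge, e])) (hM.edge_ne _)
  refine ⟨a, b, ha, hb, h.inj ?_, h.inj ?_⟩
  · rw [h.edge_left a (by rw [ha, hM.edge_edge]), hb]
  · rw [h.edge_right b (by rw [hb, hM.edge_edge]), ha]

theorem edge_cases (h : ForgetAt M M' p f) (hM : M.IsKnot) (x : M'.Dart) :
    (f x = M.edge p ∧ f (M'.edge x) = M.edge (M.rot p)) ∨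
    (f x = M.edge (M.rot p) ∧ f (M'.edge x) = M.edge p) ∨
    (f x ≠ M.edge p ∧ f x ≠ M.edge (M.rot p) ∧ f (M'.edge x) = M.edge (f x)) := by
  by_cases h1 : M.edge (f x) = p
  · exact Or.inl ⟨hM.edge_eq_iff.1 h1, h.edge_left x h1⟩
  · by_cases h2 : M.edge (f x) = M.rot p
    · exact Or.inr (Or.inl ⟨hM.edge_eq_iff.1 h2, h.edge_right x h2⟩)
    · exact Or.inr (Or.inr ⟨fun e => h1 (hM.edge_eq_iff.2 e), fun e => h2 (hM.edge_eq_iff.2 e),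
        h.edge_other x h1 h2⟩)

/-- The boundary walks of `M` and `M'` agree, once the marked point is skipped. -/
theorem returns (h : ForgetAt M M' p f) (hM : M.IsKnot) (x : M'.Dart) :
    Returns M.next (Set.range f) (f x) (f (M'.next x)) := by
  rw [next_apply, h.rot_symm]
  have hp : M.rot (M.rot p) = p := h.point
  rcases h.edge_cases hM x with ⟨h1, h2⟩ | ⟨h1, h2⟩ | ⟨-, -, h2⟩
  · refine .skip_eq (z := M.rot p) ?_ ?_ (.here_eq ?_ ?_)
    · rw [next_apply, h1, hM.edge_edge, h.point.rot_symm]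
    · rintro ⟨y, hy⟩; exact h.ne_right y hy
    · rw [next_apply, h2]
    · exact ⟨_, h.rot_symm _⟩
  · refine .skip_eq (z := p) ?_ ?_ (.here_eq ?_ ?_)
    · rw [next_apply, h1, hM.edge_edge, h.point.rot.rot_symm, hp]
    · rintro ⟨y, hy⟩; exact h.ne_left y hy
    · rw [next_apply, h2]
    · exact ⟨_, h.rot_symm _⟩
  · exact .here_eq (by rw [next_apply, h2]) ⟨_, h.rot_symm _⟩

theorem faceOf_eq_iff (h : ForgetAt M M' p f) (hM : M.IsKnot) (x y : M'.Dart) :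
    M'.faceOf x = M'.faceOf y ↔ M.faceOf (f x) = M.faceOf (f y) :=
  faceOf_eq_iff_of_returns_next f h.inj (h.returns hM) x y

theorem exists_same_face_edge (h : ForgetAt M M' p f) (hM : M.IsKnot) (z : M.Dart) :
    ∃ x, M.faceOf (f x) = M.faceOf z ∧ M.edgeOf (f x) = M.edgeOf z := by
  obtain ⟨a, b, ha, hb, -, -⟩ := h.exists_sides hM
  have hp : M.rot (M.rot p) = p := h.point
  by_cases h1 : z = p
  · refine ⟨b, ?_, ?_⟩
    · rw [← faceOf_next, next_apply, hb, hM.edge_edge, h.point.rot.rot_symm, hp, h1]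
    · rw [hb, edgeOf_edge, edgeOf_rot h.point, h1]
  by_cases h2 : z = M.rot p
  · refine ⟨a, ?_, ?_⟩
    · rw [← faceOf_next, next_apply, ha, hM.edge_edge, h.point.rot_symm, h2]
    · rw [ha, edgeOf_edge, h2, edgeOf_rot h.point]
  obtain ⟨x, rfl⟩ := h.exists_eq h1 h2
  exact ⟨x, rfl, rfl⟩

theorem card_face (h : ForgetAt M M' p f) (hM : M.IsKnot) :
    Nat.card M'.Face = Nat.card M.Face :=
  card_face_eq f (h.faceOf_eq_iff hM) fun z => (h.exists_same_face_edge hM z).imp fun _ hx => hx.1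

theorem card_crossing (h : ForgetAt M M' p f) :
    Nat.card {x // M'.IsCrossing x} = Nat.card {x // M.IsCrossing x} := by
  refine card_crossing_eq f (fun x y _ _ e => h.inj e) (fun x => (h.isCrossing_iff x).1) ?_
  intro z hz
  obtain ⟨x, rfl⟩ := h.exists_eq (x := z) (fun e => hz (e ▸ h.point))
    (fun e => hz (e ▸ h.point.rot))
  exact ⟨x, (h.isCrossing_iff x).2 hz, rfl⟩

/-- Sends the two darts of the marked point to the neighbouring darts that remain. -/
theorem exists_retraction (h : ForgetAt M M' p f) (hM : M.IsKnot) :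
    ∃ ρ : M.Dart → M'.Dart, (∀ x, ρ (f x) = x) ∧ f (ρ p) = M.edge p ∧
      f (ρ (M.rot p)) = M.edge (M.rot p) ∧ M'.edge (ρ p) = ρ (M.rot p) := by
  classical
  obtain ⟨a, b, ha, hb, hab, -⟩ := h.exists_sides hM
  have : Nonempty M'.Dart := ⟨a⟩
  refine ⟨fun x => if x = p then a else if x = M.rot p then b else
    Function.invFun (fun y : M'.Dart => f y) x, ?_, ?_, ?_, ?_⟩
  · intro x
    simp only [h.ne_left, h.ne_right, if_false]
    exact Function.leftInverse_invFun h.inj x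
  · simpa using ha
  · simpa [hM.rot_ne] using hb
  · simpa [hM.rot_ne] using hab

theorem edgeOf_eq_iff (h : ForgetAt M M' p f) (hM : M.IsKnot) (x y : M'.Dart) :
    M'.edgeOf x = M'.edgeOf y ↔ M.edgeOf (f x) = M.edgeOf (f y) := by
  have hp : M.rot (M.rot p) = p := h.point
  constructor
  · refine fun e => eq_of_edgeOf_eq (fun x => M.edgeOf (f x)) (fun x => ?_) (fun x hx => ?_) e
    · rcases h.edge_cases hM x with ⟨h1, h2⟩ | ⟨h1, h2⟩ | ⟨-, -, h2⟩
      · simp only [h1, h2, edgeOf_edge, edgeOf_rot h.point]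
      · simp only [h1, h2, edgeOf_edge, edgeOf_rot h.point]
      · simp only [h2, edgeOf_edge]
    · simp only [h.rot]
      exact edgeOf_rot ((h.isPoint_iff x).1 hx)
  · intro e
    obtain ⟨ρ, h1, h2, h3, h4⟩ := h.exists_retraction hM
    have hn : M'.edgeOf (ρ (M.rot p)) = M'.edgeOf (ρ p) := by rw [← h4, edgeOf_edge]
    have := eq_of_edgeOf_eq (fun x => M'.edgeOf (ρ x)) (fun x => ?_) (fun x hx => ?_) e
    · simpa [h1] using this
    · by_cases e1 : x = p
      · rw [e1, ← h2, h1]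
      by_cases e2 : x = M.rot p
      · rw [e2, ← h3, h1]
      obtain ⟨x, rfl⟩ := h.exists_eq e1 e2
      by_cases e3 : M.edge (f x) = p
      · rw [e3, h1, h.inj (h2.trans (hM.edge_eq_iff.1 e3).symm)]
      by_cases e4 : M.edge (f x) = M.rot p
      · rw [e4, h1, h.inj (h3.trans (hM.edge_eq_iff.1 e4).symm)]
      rw [← h.edge_other x e3 e4, h1, h1, edgeOf_edge]
    · by_cases e1 : x = p
      · rw [e1, hn]
      by_cases e2 : x = M.rot p
      · rw [e2, hp, hn]
      obtain ⟨x, rfl⟩ := h.exists_eq e1 e2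
      rw [← h.rot, h1, h1, edgeOf_rot ((h.isPoint_iff x).2 hx)]

theorem isKnot (h : ForgetAt M M' p f) (hM : M.IsKnot) : M'.IsKnot where
  edge_edge x := by
    have hp : M.rot (M.rot p) = p := h.point
    apply h.inj
    rcases h.edge_cases hM x with ⟨h1, h2⟩ | ⟨h1, h2⟩ | ⟨h1, h2, h3⟩
    · rw [h.edge_right _ (by rw [h2, hM.edge_edge]), h1]
    · rw [h.edge_left _ (by rw [h2, hM.edge_edge]), h1]
    · rw [h.edge_other, h3, hM.edge_edge]
      · rw [h3, hM.edge_edge]; exact h.ne_left x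
      · rw [h3, hM.edge_edge]; exact h.ne_right x
  edge_ne x e := by
    have := congrArg f e
    rcases h.edge_cases hM x with ⟨h1, h2⟩ | ⟨h1, h2⟩ | ⟨h1, h2, h3⟩
    · rw [h1, h2] at this; exact hM.rot_ne p (M.edge.injective this)
    · rw [h1, h2] at this; exact hM.rot_ne p (M.edge.injective this).symm
    · rw [h3] at this; exact hM.edge_ne _ this
  rot_ne x e := hM.rot_ne (f x) (by rw [← h.rot, e])
  rot_four x := h.inj (by simp only [h.rot, hM.rot_four])
  isOver_rot x hx := by
    rw [h.isOver x hx, h.isOver _ (isCrossing_rot_iff.2 hx), h.rot,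
      hM.isOver_rot _ ((h.isCrossing_iff x).1 hx)]
  one_component x y := by
    have hp : M.rot (M.rot p) = p := h.point
    obtain ⟨ρ, h1, h2, h3, h4⟩ := h.exists_retraction hM
    rw [← h1 x, ← h1 y]
    refine eqvGen_of_kernel ρ ?_ (hM.one_component (f x) (f y))
    intro a b hab
    by_cases e1 : a = p
    · subst e1
      rcases hab with rfl | ⟨-, rfl⟩ | ⟨hc, -⟩
      · rw [← h2, h1]; exact .refl _
      · exact .rel _ _ (Or.inl h4.symm)
      · exact absurd h.point hc
    by_cases e2 : a = M.rot p
    · subst e2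
      rcases hab with rfl | ⟨-, rfl⟩ | ⟨hc, -⟩
      · rw [← h3, h1]; exact .refl _
      · rw [hp]; exact .symm _ _ (.rel _ _ (Or.inl h4.symm))
      · exact absurd h.point.rot hc
    obtain ⟨x, rfl⟩ := h.exists_eq e1 e2
    rw [h1]
    rcases hab with rfl | ⟨hc, rfl⟩ | ⟨hc, rfl⟩
    · by_cases e3 : M.edge (f x) = p
      · rw [e3, h.inj (h2.trans (hM.edge_eq_iff.1 e3).symm)]; exact .refl _
      by_cases e4 : M.edge (f x) = M.rot p
      · rw [e4, h.inj (h3.trans (hM.edge_eq_iff.1 e4).symm)]; exact .refl _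
      rw [← h.edge_other x e3 e4, h1]
      exact .rel _ _ (Or.inl rfl)
    · rw [← h.rot, h1]
      exact .rel _ _ (Or.inr (Or.inl ⟨(h.isPoint_iff x).2 hc, rfl⟩))
    · rw [← h.rot, ← h.rot, h1]
      exact .rel _ _ (Or.inr (Or.inr ⟨(h.isCrossing_iff x).2 hc, rfl⟩))

theorem isPlanar_iff (h : ForgetAt M M' p f) (hM : M.IsKnot) : M.IsPlanar ↔ M'.IsPlanar := by
  rw [hM.isPlanar_iff, (h.isKnot hM).isPlanar_iff, h.card_face hM, h.card_crossing]

theorem planarIsotopic (h : ForgetAt M M' p f) {hM : M.IsKnot} {hM' : M'.IsKnot}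
    {hp : M.IsPlanar} {hp' : M'.IsPlanar} (c : M'.Dart) :
    (KnotDiagram.ofMap M hM hp (M.faceOf (f c))).PlanarIsotopic
      (KnotDiagram.ofMap M' hM' hp' (M'.faceOf c)) :=
  .rel _ _ (Or.inr ⟨p, f, h.point, h.edge_ne_rot, h.inj, h.range, h.edge_left, h.edge_right,
    h.edge_other, h.rot, h.isOver, c, rfl, rfl⟩)

end ForgetAt

open Classical in
/-- Every marked point that is not the only vertex of the curve can be forgotten. -/
theorem IsKnot.exists_forgetAt (hM : M.IsKnot) {p : M.Dart} (hp : M.IsPoint p)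
    (hne : M.edge p ≠ M.rot p) :
    ∃ (M' : CurveMap) (f : M'.Dart → M.Dart), ForgetAt M M' p f := by
  have hp' : M.rot (M.rot p) = p := hp
  have hpr := hM.rot_ne p
  let e : M.Dart → M.Dart := fun x =>
    if M.edge x = p then M.edge (M.rot p) else if M.edge x = M.rot p then M.edge p else M.edge x
  have hne2 : M.edge (M.rot p) ≠ p := fun h => hne (by rw [← h, hM.edge_edge, h])
  have he : ∀ x, x ≠ p ∧ x ≠ M.rot p → e x ≠ p ∧ e x ≠ M.rot p := by
    intro x hx
    simp only [e]
    split_ifs with h1 h2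
    · exact ⟨hne2, hM.edge_ne _⟩
    · exact ⟨hM.edge_ne _, hne⟩
    · exact ⟨h1, h2⟩
  have hee : ∀ x, x ≠ p ∧ x ≠ M.rot p → e (e x) = x := by
    intro x hx
    simp only [e]
    split_ifs with h1 h2 h3 h4 h5 h6 h7 h8
    · rw [hM.edge_edge] at h2; exact absurd h2 hpr
    · exact (hM.edge_eq_iff.1 h1).symm
    · rw [hM.edge_edge] at h3; exact absurd rfl h3
    · exact (hM.edge_eq_iff.1 h4).symm
    · rw [hM.edge_edge] at h5; exact absurd rfl h5
    · rw [hM.edge_edge] at h5; exact absurd rfl h5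
    · rw [hM.edge_edge] at h7; exact absurd h7 hx.1
    · rw [hM.edge_edge] at h8; exact absurd h8 hx.2
    · exact hM.edge_edge x
  let M' : CurveMap :=
    { Dart := {x : M.Dart // x ≠ p ∧ x ≠ M.rot p}
      finite := inferInstance
      edge := Function.Involutive.toPerm (fun x => ⟨e x.1, he x.1 x.2⟩)
        (fun x => Subtype.ext (hee x.1 x.2))
      rot := M.rot.subtypePerm fun x => by
        constructor
        · rintro ⟨h1, h2⟩
          exact ⟨fun h => h2 (by rw [h]), fun h => h1 (by rw [h, hp'])⟩
        · rintro ⟨h1, h2⟩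
          exact ⟨fun h => h2 (by rw [← h, M.rot.injective (h.trans hp'.symm), hp']),
            fun h => h1 (M.rot.injective h)⟩
      isOver := fun x => M.isOver x.1 }
  refine ⟨M', Subtype.val, hp, hne, Subtype.val_injective, ?_, ?_, ?_, ?_, fun _ => rfl,
    fun _ _ => rfl⟩
  · ext x; simp [not_or, M']
  · intro x h; exact if_pos h
  · intro x h; exact (if_neg (by rw [h]; exact hpr)).trans (if_pos h)
  · intro x h1 h2; exact (if_neg h1).trans (if_neg h2)

end CurveMap

namespace CurveMap

variable {M N : CurveMap}

theorem IsKnot.forall_of_closed (hM : M.IsKnot) (Q : M.Dart → Prop) (x : M.Dart) (hx : Q x)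
    (he : ∀ a, Q a → Q (M.edge a)) (hp : ∀ a, M.IsPoint a → Q a → Q (M.rot a))
    (hc : ∀ a, M.IsCrossing a → Q a → Q (M.rot (M.rot a))) (y : M.Dart) : Q y := by
  refine hM.forall_of_straight Q x hx ?_ y
  rintro a b (rfl | ⟨h, rfl⟩ | ⟨h, rfl⟩)
  · exact ⟨he a, fun h => hM.edge_edge a ▸ he _ h⟩
  · refine ⟨hp a h, fun h' => ?_⟩
    have := hp _ h.rot h'
    rwa [show M.rot (M.rot a) = a from h] at this
  · refine ⟨hc a h, fun h' => ?_⟩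
    have := hc _ (isCrossing_rot_iff.2 (isCrossing_rot_iff.2 h)) h'
    rwa [hM.rot_four] at this

/-! ### Isomorphic maps -/

/-- `KnotDiagram.Iso` without the condition on the unbounded regions. -/
structure IsoAt (M N : CurveMap) (f : M.Dart → N.Dart) : Prop where
  bij : Function.Bijective f
  edge : ∀ x, f (M.edge x) = N.edge (f x)
  rot : ∀ x, f (M.rot x) = N.rot (f x)
  isOver : ∀ x, M.IsCrossing x → N.isOver (f x) = M.isOver x

namespace IsoAt

variable {f : M.Dart → N.Dart}

theorem isPoint_iff (h : IsoAt M N f) (x : M.Dart) : M.IsPoint x ↔ N.IsPoint (f x) := by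
  unfold IsPoint
  rw [← h.rot, ← h.rot, h.bij.1.eq_iff]

theorem isCrossing_iff (h : IsoAt M N f) (x : M.Dart) : M.IsCrossing x ↔ N.IsCrossing (f x) :=
  not_congr (h.isPoint_iff x)

theorem next (h : IsoAt M N f) (x : M.Dart) : f (M.next x) = N.next (f x) := by
  rw [next_apply, next_apply, Equiv.eq_symm_apply, ← h.rot, Equiv.apply_symm_apply, h.edge]

theorem faceOf_eq_iff (h : IsoAt M N f) (x y : M.Dart) :
    M.faceOf x = M.faceOf y ↔ N.faceOf (f x) = N.faceOf (f y) :=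
  faceOf_eq_iff_of_returns_next f h.bij.1 (fun x => .here_eq (h.next x).symm ⟨_, rfl⟩) x y

theorem isPlanar_iff (h : IsoAt M N f) (hM : M.IsKnot) (hN : N.IsKnot) :
    M.IsPlanar ↔ N.IsPlanar := by
  rw [hM.isPlanar_iff, hN.isPlanar_iff, card_face_eq f h.faceOf_eq_iff fun z => by
      obtain ⟨x, rfl⟩ := h.bij.2 z; exact ⟨x, rfl⟩,
    card_crossing_eq f (fun x y _ _ e => h.bij.1 e) (fun x => (h.isCrossing_iff x).1) fun z hz => by
      obtain ⟨x, rfl⟩ := h.bij.2 z; exact ⟨x, (h.isCrossing_iff x).2 hz, rfl⟩]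

theorem planarIsotopic (h : IsoAt M N f) {hM : M.IsKnot} {hN : N.IsKnot}
    {hp : M.IsPlanar} {hp' : N.IsPlanar} (c : M.Dart) :
    (KnotDiagram.ofMap M hM hp (M.faceOf c)).PlanarIsotopic
      (KnotDiagram.ofMap N hN hp' (N.faceOf (f c))) :=
  .rel _ _ (Or.inl ⟨Equiv.ofBijective f h.bij, h.edge, h.rot, h.isOver, c, rfl, rfl⟩)

end IsoAt

/-! ### Reduced diagrams -/

/-- `R` arises from `M` by forgetting all marked points: its darts are, through `ι`, the darts of
`M` at crossings, and its edges are those of the diagram `M`. -/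
structure IsReduction (M R : CurveMap) (ι : R.Dart → M.Dart) : Prop where
  inj : Function.Injective ι
  crossing : ∀ r, M.IsCrossing (ι r)
  exists_eq : ∀ x, M.IsCrossing x → ∃ r, ι r = x
  rot : ∀ r, ι (R.rot r) = M.rot (ι r)
  isOver : ∀ r, R.isOver r = M.isOver (ι r)
  edgeOf_eq_iff : ∀ r r', M.edgeOf (ι r) = M.edgeOf (ι r') ↔ r' = r ∨ r' = R.edge r
  faceOf_eq_iff : ∀ r r', R.faceOf r = R.faceOf r' ↔ M.faceOf (ι r) = M.faceOf (ι r')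
  exists_same_face_edge : ∀ x, ∃ r, M.faceOf (ι r) = M.faceOf x ∧ M.edgeOf (ι r) = M.edgeOf x

namespace IsReduction

variable {R : CurveMap} {ι : R.Dart → M.Dart}

theorem isCrossing (h : IsReduction M R ι) (r : R.Dart) : R.IsCrossing r := by
  intro hr
  refine h.crossing r ?_
  unfold IsPoint
  rw [← h.rot, ← h.rot, hr]

theorem edgeOf_edge (h : IsReduction M R ι) (r : R.Dart) :
    M.edgeOf (ι (R.edge r)) = M.edgeOf (ι r) := ((h.edgeOf_eq_iff _ _).2 (Or.inr rfl)).symm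

theorem isPlanar_iff (h : IsReduction M R ι) (hM : M.IsKnot) (hR : R.IsKnot) :
    M.IsPlanar ↔ R.IsPlanar := by
  rw [hM.isPlanar_iff, hR.isPlanar_iff,
    card_face_eq ι h.faceOf_eq_iff fun z => (h.exists_same_face_edge z).imp fun _ hx => hx.1,
    card_crossing_eq ι (fun x y _ _ e => h.inj e) (fun x _ => h.crossing x) fun z hz => by
      obtain ⟨r, rfl⟩ := h.exists_eq z hz; exact ⟨r, h.isCrossing r, rfl⟩]

end IsReduction

theorem edgeOf_eq_iff_of_no_point (hM : M.IsKnot) (h : ∀ x, M.IsCrossing x) (x y : M.Dart) :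
    M.edgeOf x = M.edgeOf y ↔ y = x ∨ y = M.edge x := by
  constructor
  · intro e
    have := eq_of_edgeOf_eq (fun z => ({z, M.edge z} : Set M.Dart))
      (fun z => by rw [hM.edge_edge, Set.pair_comm]) (fun z hz => absurd hz (h z)) e
    have hy : y ∈ ({y, M.edge y} : Set M.Dart) := Or.inl rfl
    rw [← this] at hy
    exact hy
  · rintro (rfl | rfl)
    · rfl
    · rw [edgeOf_edge]

/-- Marked points are irrelevant: a diagram with crossings is planar isotopic to its reduction. -/
theorem IsKnot.exists_reduction (hM : M.IsKnot) (hx : ∃ x, M.IsCrossing x) :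
    ∃ (R : CurveMap) (ι : R.Dart → M.Dart), R.IsKnot ∧ IsReduction M R ι ∧
      ∀ (hM : M.IsKnot) (hR : R.IsKnot) (hp : M.IsPlanar) (hp' : R.IsPlanar) (r : R.Dart),
        (KnotDiagram.ofMap M hM hp (M.faceOf (ι r))).PlanarIsotopic
          (KnotDiagram.ofMap R hR hp' (R.faceOf r)) := by
  induction hn : Nat.card M.Dart using Nat.strong_induction_on generalizing M with
  | _ n ih =>
    by_cases hpt : ∃ p, M.IsPoint p
    · obtain ⟨p, hp⟩ := hpt
      have hp' : M.rot (M.rot p) = p := hp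
      -- The marked point is not the only vertex, since there is a crossing.
      have hne : M.edge p ≠ M.rot p := by
        intro he
        obtain ⟨x, hx⟩ := hx
        have : x = p ∨ x = M.rot p := by
          refine hM.forall_of_closed (fun x => x = p ∨ x = M.rot p) p (Or.inl rfl) ?_ ?_ ?_ x
          · rintro _ (rfl | rfl)
            · exact Or.inr he
            · rw [← he, hM.edge_edge]; exact Or.inl rfl
          · rintro _ - (rfl | rfl)
            · exact Or.inr rfl
            · exact Or.inl hp'
          · rintro _ h (rfl | rfl)
            · exact absurd hp h
            · exact absurd hp.rot h
        rcases this with rfl | rfl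
        · exact hx hp
        · exact hx hp.rot
      obtain ⟨M', f, hf⟩ := hM.exists_forgetAt hp hne
      have hM' := hf.isKnot hM
      have hx' : ∃ x, M'.IsCrossing x := by
        obtain ⟨x, hx⟩ := hx
        obtain ⟨y, rfl⟩ := hf.exists_eq (x := x) (fun e => hx (e ▸ hp)) (fun e => hx (e ▸ hp.rot))
        exact ⟨y, (hf.isCrossing_iff y).2 hx⟩
      have hcard : Nat.card M'.Dart < n := by
        rw [← hn]
        have := Fintype.ofFinite M.Dart
        have := Fintype.ofFinite M'.Dart
        rw [Nat.card_eq_fintype_card, Nat.card_eq_fintype_card]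
        refine Fintype.card_lt_of_injective_of_notMem f hf.inj (b := p) ?_
        rintro ⟨y, hy⟩
        exact hf.ne_left y hy
      obtain ⟨R, ι, hR, hι, hPI⟩ := ih _ hcard hM' hx' rfl
      refine ⟨R, fun r => f (ι r), hR, ⟨hf.inj.comp hι.inj, ?_, ?_, ?_, ?_, ?_, ?_, ?_⟩, ?_⟩
      · exact fun r => (hf.isCrossing_iff _).1 (hι.crossing r)
      · intro x hx
        obtain ⟨y, rfl⟩ := hf.exists_eq (x := x) (fun e => hx (e ▸ hp)) (fun e => hx (e ▸ hp.rot))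
        obtain ⟨r, rfl⟩ := hι.exists_eq y ((hf.isCrossing_iff y).2 hx)
        exact ⟨r, rfl⟩
      · intro r; rw [hι.rot, hf.rot]
      · intro r; rw [hι.isOver, hf.isOver _ (hι.crossing r)]
      · intro r r'; rw [← hf.edgeOf_eq_iff hM, hι.edgeOf_eq_iff]
      · intro r r'; rw [← hf.faceOf_eq_iff hM, hι.faceOf_eq_iff]
      · intro x
        obtain ⟨y, h1, h2⟩ := hf.exists_same_face_edge hM x
        obtain ⟨r, h3, h4⟩ := hι.exists_same_face_edge y
        exact ⟨r, ((hf.faceOf_eq_iff hM _ _).1 h3).trans h1,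
          ((hf.edgeOf_eq_iff hM _ _).1 h4).trans h2⟩
      · intro _ hR h1 h2 r
        have h3 := (hf.isPlanar_iff hM).1 h1
        exact .trans _ _ _ (hf.planarIsotopic (hM' := hM') (hp' := h3) (ι r)) (hPI hM' hR h3 h2 r)
    · have hpt' : ∀ x, M.IsCrossing x := fun x h => hpt ⟨x, h⟩
      refine ⟨M, id, hM, ⟨Function.injective_id, hpt', fun x _ => ⟨x, rfl⟩, fun _ => rfl,
        fun _ => rfl, edgeOf_eq_iff_of_no_point hM hpt', fun _ _ => Iff.rfl,
        fun x => ⟨x, rfl, rfl⟩⟩, fun _ _ _ _ _ => .refl _⟩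

/-- Two diagrams agree up to marked points if their crossings agree and are joined by edges in the
same way. -/
structure SameCrossings (M N : CurveMap) (φ : M.Dart → N.Dart) : Prop where
  crossing : ∀ x, M.IsCrossing x → N.IsCrossing (φ x)
  inj : ∀ x y, M.IsCrossing x → M.IsCrossing y → φ x = φ y → x = y
  surj : ∀ z, N.IsCrossing z → ∃ x, M.IsCrossing x ∧ φ x = z
  rot : ∀ x, M.IsCrossing x → φ (M.rot x) = N.rot (φ x)
  isOver : ∀ x, M.IsCrossing x → N.isOver (φ x) = M.isOver x
  edgeOf_eq : ∀ x y, M.IsCrossing x → M.IsCrossing y → M.edgeOf x = M.edgeOf y →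
    N.edgeOf (φ x) = N.edgeOf (φ y)

namespace SameCrossings

variable {φ : M.Dart → N.Dart}

/-- The reductions have only crossings, so they are determined by what `SameCrossings` records. -/
theorem exists_iso_reductions (h : SameCrossings M N φ) {R R' : CurveMap} {ι : R.Dart → M.Dart}
    {ι' : R'.Dart → N.Dart} (hR : R.IsKnot) (hι : IsReduction M R ι)
    (hι' : IsReduction N R' ι') : ∃ ψ, IsoAt R R' ψ ∧ ∀ r, ι' (ψ r) = φ (ι r) := by
  have := fun r => hι'.exists_eq _ (h.crossing _ (hι.crossing r))
  choose ψ hψ using this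
  have hinj : Function.Injective ψ := fun r r' e => hι.inj
    (h.inj _ _ (hι.crossing _) (hι.crossing _) (by rw [← hψ, ← hψ, e]))
  refine ⟨ψ, ⟨⟨hinj, ?_⟩, ?_, ?_, ?_⟩, hψ⟩
  · intro z
    obtain ⟨x, hx, he⟩ := h.surj _ (hι'.crossing z)
    obtain ⟨r, rfl⟩ := hι.exists_eq x hx
    exact ⟨r, hι'.inj (by rw [hψ, he])⟩
  · intro r
    have := h.edgeOf_eq _ _ (hι.crossing _) (hι.crossing _) (hι.edgeOf_edge r).symm
    rw [← hψ, ← hψ, hι'.edgeOf_eq_iff] at this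
    exact this.resolve_left fun e => hR.edge_ne r (hinj e)
  · intro r
    apply hι'.inj
    rw [hψ, hι.rot, h.rot _ (hι.crossing r), hι'.rot, hψ]
  · intro r _
    rw [hι'.isOver, hψ, h.isOver _ (hι.crossing r), hι.isOver]

theorem isPlanar_iff (h : SameCrossings M N φ) (hM : M.IsKnot) (hN : N.IsKnot)
    (hx : ∃ x, M.IsCrossing x) : M.IsPlanar ↔ N.IsPlanar := by
  obtain ⟨R, ι, hR, hι, -⟩ := hM.exists_reduction hx
  obtain ⟨R', ι', hR', hι', -⟩ := hN.exists_reduction (hx.imp' φ h.crossing)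
  obtain ⟨ψ, hψ, -⟩ := h.exists_iso_reductions hR hι hι'
  rw [hι.isPlanar_iff hM hR, hι'.isPlanar_iff hN hR', hψ.isPlanar_iff hR hR']

theorem planarIsotopic (h : SameCrossings M N φ) (hM : M.IsKnot) (hN : N.IsKnot)
    (hp : M.IsPlanar) (hp' : N.IsPlanar) {c : M.Dart} (hc : M.IsCrossing c) :
    (KnotDiagram.ofMap M hM hp (M.faceOf c)).PlanarIsotopic
      (KnotDiagram.ofMap N hN hp' (N.faceOf (φ c))) := by
  obtain ⟨R, ι, hR, hι, h1⟩ := hM.exists_reduction ⟨c, hc⟩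
  obtain ⟨R', ι', hR', hι', h2⟩ := hN.exists_reduction ⟨φ c, h.crossing c hc⟩
  obtain ⟨ψ, hψ, hψ'⟩ := h.exists_iso_reductions hR hι hι'
  obtain ⟨r, rfl⟩ := hι.exists_eq c hc
  have hpR := (hι.isPlanar_iff hM hR).1 hp
  have hpR' := (hι'.isPlanar_iff hN hR').1 hp'
  rw [← hψ']
  exact .trans _ _ _ (h1 hM hR hp hpR r) (.trans _ _ _
    (hψ.planarIsotopic (hM := hR) (hN := hR') (hp := hpR) (hp' := hpR') r)
    (.symm _ _ (h2 hN hR' hp' hpR' (ψ r))))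

end SameCrossings

end CurveMap

namespace CurveMap

variable {M M' : CurveMap}

/-! ### Counting darts at crossings -/

/-- Counting the darts at crossings of `M`: those in `A`, and the images of those of `M'`. -/
theorem card_crossing_add (f : M'.Dart → M.Dart) (hi : Function.Injective f) (A : Set M.Dart)
    (h : ∀ z, M.IsCrossing z ↔ z ∈ A ∨ ∃ x, M'.IsCrossing x ∧ f x = z)
    (hd : ∀ x, M'.IsCrossing x → f x ∉ A) :
    Nat.card {x // M.IsCrossing x} = Nat.card {x // M'.IsCrossing x} + A.ncard := by
  have h1 : {x | M.IsCrossing x} = f '' {x | M'.IsCrossing x} ∪ A := by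
    ext z
    exact (h z).trans or_comm
  have h2 : Disjoint (f '' {x | M'.IsCrossing x}) A := by
    rw [Set.disjoint_left]
    rintro _ ⟨x, hx, rfl⟩
    exact hd x hx
  have h3 := Set.ncard_union_eq h2
  rw [← h1, Set.ncard_image_of_injective _ hi] at h3
  exact h3

namespace IsKnot

theorem rot_inj (M : CurveMap) {x y : M.Dart} : M.rot x = M.rot y ↔ x = y := M.rot.injective.eq_iff

/-- The four darts at a crossing are distinct. -/
theorem pow_rot_injective (hM : M.IsKnot) {t : M.Dart} (ht : M.IsCrossing t) {i j : ℕ} (hi : i < 4)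
    (hj : j < 4) (h : M.rot^[i] t = M.rot^[j] t) : i = j := by
  have h1 := hM.rot_ne t
  have h2 : M.rot (M.rot t) ≠ t := ht
  have h3 := hM.rot_rot_rot_ne t
  interval_cases i <;> interval_cases j <;>
    simp only [Function.iterate_succ, Function.iterate_zero, Function.comp, id, rot_inj] at h ⊢ <;>
    first
    | exact absurd h h1
    | exact absurd h.symm h1
    | exact absurd h h2
    | exact absurd h.symm h2
    | exact absurd h h3
    | exact absurd h.symm h3

theorem ncard_crossing (hM : M.IsKnot) {t : M.Dart} (ht : M.IsCrossing t) :
    {x | M.rot.SameCycle t x}.ncard = 4 := by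
  have : {x | M.rot.SameCycle t x} = (fun i => M.rot^[i] t) '' (Set.Iio 4) := by
    ext x
    constructor
    · intro hx
      rcases mem_four_of_sameCycle (hM.rot_four t) hx with rfl | rfl | rfl | rfl
      · exact ⟨0, by simp, rfl⟩
      · exact ⟨1, by simp, rfl⟩
      · exact ⟨2, by simp, rfl⟩
      · exact ⟨3, by simp, rfl⟩
    · rintro ⟨i, -, rfl⟩
      exact (sameCycle_iff_iterate _).2 ⟨i, rfl⟩
  have inj : Set.InjOn (fun i => M.rot^[i] t) (Set.Iio 4) :=
    fun i hi j hj h => hM.pow_rot_injective ht hi hj h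
  rw [this, inj.ncard_image, Set.ncard_eq_toFinset_card']
  simp

end IsKnot

/-! ### Kinks -/

/-- `KnotDiagram.RemoveKink` without the conditions on the unbounded regions. -/
structure KinkAt (M M' : CurveMap) (t : M.Dart) (f : M'.Dart → M.Dart) : Prop where
  crossing : M.IsCrossing t
  edge_eq_rot : M.edge t = M.rot t
  inj : Function.Injective f
  range : Set.range f = {t, M.rot t}ᶜ
  edge : ∀ x, f (M'.edge x) = M.edge (f x)
  rot_left : ∀ x, f x = M.rot (M.rot t) → f (M'.rot x) = M.rot (M.rot (M.rot t))
  rot_right : ∀ x, f x = M.rot (M.rot (M.rot t)) → f (M'.rot x) = M.rot (M.rot t)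
  rot_other : ∀ x, f x ≠ M.rot (M.rot t) → f x ≠ M.rot (M.rot (M.rot t)) →
    f (M'.rot x) = M.rot (f x)
  isOver : ∀ x, M'.IsCrossing x → M'.isOver x = M.isOver (f x)

namespace KinkAt

variable {t : M.Dart} {f : M'.Dart → M.Dart}

theorem exists_eq (h : KinkAt M M' t f) {x : M.Dart} (h1 : x ≠ t) (h2 : x ≠ M.rot t) :
    ∃ y, f y = x := by
  have : x ∈ Set.range f := by rw [h.range]; simp [h1, h2]
  exact this

theorem ne_left (h : KinkAt M M' t f) (x : M'.Dart) : f x ≠ t := by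
  have : f x ∈ Set.range f := ⟨x, rfl⟩
  rw [h.range] at this
  simp only [Set.mem_compl_iff, Set.mem_insert_iff, Set.mem_singleton_iff, not_or] at this
  exact this.1

theorem ne_right (h : KinkAt M M' t f) (x : M'.Dart) : f x ≠ M.rot t := by
  have : f x ∈ Set.range f := ⟨x, rfl⟩
  rw [h.range] at this
  simp only [Set.mem_compl_iff, Set.mem_insert_iff, Set.mem_singleton_iff, not_or] at this
  exact this.2

/-- The two remaining darts at the crossing, which become a marked point. -/
theorem exists_point (h : KinkAt M M' t f) (hM : M.IsKnot) :
    ∃ a b, f a = M.rot (M.rot t) ∧ f b = M.rot (M.rot (M.rot t)) ∧ M'.rot a = b ∧ M'.rot b = a := by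
  obtain ⟨a, ha⟩ := h.exists_eq (x := M.rot (M.rot t)) h.crossing
    (fun e => hM.rot_ne _ e)
  obtain ⟨b, hb⟩ := h.exists_eq (x := M.rot (M.rot (M.rot t))) (hM.rot_rot_rot_ne t)
    (fun e => h.crossing (M.rot.injective e))
  exact ⟨a, b, ha, hb, h.inj ((h.rot_left a ha).trans hb.symm),
    h.inj ((h.rot_right b hb).trans ha.symm)⟩

theorem isPoint_of_eq (h : KinkAt M M' t f) (hM : M.IsKnot) {x : M'.Dart}
    (hx : f x = M.rot (M.rot t) ∨ f x = M.rot (M.rot (M.rot t))) : M'.IsPoint x := by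
  obtain ⟨a, b, ha, hb, hab, hba⟩ := h.exists_point hM
  rcases hx with hx | hx
  · rw [h.inj (hx.trans ha.symm), IsPoint, hab, hba]
  · rw [h.inj (hx.trans hb.symm), IsPoint, hba, hab]

theorem rot_rot (h : KinkAt M M' t f)  {x : M'.Dart}
    (h1 : f x ≠ M.rot (M.rot t)) (h2 : f x ≠ M.rot (M.rot (M.rot t))) :
    f (M'.rot (M'.rot x)) = M.rot (M.rot (f x)) := by
  have h3 := h.rot_other x h1 h2
  rw [h.rot_other, h3]
  · rw [h3]; intro e
    exact h.ne_right x (M.rot.injective e)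
  · rw [h3]; intro e
    exact h1 (M.rot.injective e)

theorem isPoint_iff (h : KinkAt M M' t f) {x : M'.Dart}
    (h1 : f x ≠ M.rot (M.rot t)) (h2 : f x ≠ M.rot (M.rot (M.rot t))) :
    M'.IsPoint x ↔ M.IsPoint (f x) := by
  unfold IsPoint
  rw [← h.rot_rot h1 h2, h.inj.eq_iff]

theorem rot_symm (h : KinkAt M M' t f) {x : M'.Dart}
    (h1 : f x ≠ M.rot (M.rot t)) (h2 : f x ≠ M.rot (M.rot (M.rot t))) :
    f (M'.rot.symm x) = M.rot.symm (f x) := by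
  rw [Equiv.eq_symm_apply]
  obtain ⟨y, rfl⟩ := M'.rot.surjective x
  rw [Equiv.symm_apply_apply, h.rot_other]
  · intro e; exact h2 (h.rot_left y e)
  · intro e; exact h1 (h.rot_right y e)

theorem next_self (h : KinkAt M M' t f) : M.next t = t := by
  rw [next_apply, h.edge_eq_rot, Equiv.symm_apply_apply]

theorem edge_rot (h : KinkAt M M' t f) (hM : M.IsKnot) : M.edge (M.rot t) = t := by
  rw [← h.edge_eq_rot, hM.edge_edge]

theorem next_rot (h : KinkAt M M' t f) (hM : M.IsKnot) :
    M.next (M.rot t) = M.rot (M.rot (M.rot t)) := by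
  rw [next_apply, h.edge_rot hM, hM.rot_symm]

/-- The boundary walks of `M` and `M'` agree, except that the former also traverses the monogon. -/
theorem returns (h : KinkAt M M' t f) (hM : M.IsKnot) (x : M'.Dart) :
    Returns M.next (Set.range f) (f x) (f (M'.next x)) := by
  obtain ⟨a, b, ha, hb, hab, hba⟩ := h.exists_point hM
  have ha' : M'.rot.symm a = b := by rw [Equiv.symm_apply_eq, hba]
  have hb' : M'.rot.symm b = a := by rw [Equiv.symm_apply_eq, hab]
  rw [next_apply]
  by_cases h1 : f (M'.edge x) = M.rot (M.rot t)
  · rw [h.inj (h1.trans ha.symm), ha', hb]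
    refine .skip_eq (z := M.rot t) ?_ ?_ (.here_eq (h.next_rot hM) ⟨b, hb⟩)
    · rw [next_apply, ← h.edge, h1, Equiv.symm_apply_apply]
    · rintro ⟨y, hy⟩; exact h.ne_right y hy
  by_cases h2 : f (M'.edge x) = M.rot (M.rot (M.rot t))
  · rw [h.inj (h2.trans hb.symm), hb', ha]
    refine .here_eq ?_ ⟨a, ha⟩
    rw [next_apply, ← h.edge, h2, Equiv.symm_apply_apply]
  · refine .here_eq ?_ ⟨_, rfl⟩
    rw [h.rot_symm h1 h2, next_apply, h.edge]

theorem faceOf_eq_iff (h : KinkAt M M' t f) (hM : M.IsKnot) (x y : M'.Dart) :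
    M'.faceOf x = M'.faceOf y ↔ M.faceOf (f x) = M.faceOf (f y) :=
  faceOf_eq_iff_of_returns_next f h.inj (h.returns hM) x y

theorem faceOf_ne (h : KinkAt M M' t f) {x : M.Dart} (hx : x ≠ t) : M.faceOf x ≠ M.faceOf t :=
  fun e => hx ((faceOf_eq.1 e).eq_of_right h.next_self)

theorem card_face (h : KinkAt M M' t f) (hM : M.IsKnot) :
    Nat.card M'.Face + 1 = Nat.card M.Face := by
  refine card_face_add_one f t (h.faceOf_eq_iff hM) (fun x => h.faceOf_ne (h.ne_left x)) ?_
  intro z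
  by_cases h1 : z = t
  · exact Or.inl (by rw [h1])
  by_cases h2 : z = M.rot t
  · obtain ⟨a, b, ha, hb, hab, hba⟩ := h.exists_point hM
    exact Or.inr ⟨b, by rw [hb, ← h.next_rot hM, faceOf_next, h2]⟩
  obtain ⟨x, rfl⟩ := h.exists_eq h1 h2
  exact Or.inr ⟨x, rfl⟩

theorem ne_of_isCrossing (h : KinkAt M M' t f) (hM : M.IsKnot) {x : M'.Dart}
    (hx : M'.IsCrossing x) : f x ≠ M.rot (M.rot t) ∧ f x ≠ M.rot (M.rot (M.rot t)) :=
  ⟨fun e => hx (h.isPoint_of_eq hM (Or.inl e)), fun e => hx (h.isPoint_of_eq hM (Or.inr e))⟩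

theorem card_crossing (h : KinkAt M M' t f) (hM : M.IsKnot) :
    Nat.card {x // M.IsCrossing x} = Nat.card {x // M'.IsCrossing x} + 4 := by
  rw [← hM.ncard_crossing h.crossing]
  refine card_crossing_add f h.inj _ ?_ ?_
  · intro z
    by_cases hz : M.rot.SameCycle t z
    · refine iff_of_true ?_ (Or.inl hz)
      have ht := h.crossing
      rcases mem_four_of_sameCycle (hM.rot_four t) hz with rfl | rfl | rfl | rfl <;>
        simpa only [isCrossing_rot_iff] using ht
    · have h1 : z ≠ t := by rintro rfl; exact hz (.refl _ _)
      have h2 : z ≠ M.rot t := by rintro rfl; exact hz (by simp [Equiv.Perm.SameCycle.refl])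
      have h3 : z ≠ M.rot (M.rot t) := by
        rintro rfl; exact hz (by simp [Equiv.Perm.SameCycle.refl])
      have h4 : z ≠ M.rot (M.rot (M.rot t)) := by
        rintro rfl; exact hz (by simp [Equiv.Perm.SameCycle.refl])
      obtain ⟨x, rfl⟩ := h.exists_eq h1 h2
      have : M'.IsCrossing x ↔ M.IsCrossing (f x) := not_congr (h.isPoint_iff h3 h4)
      rw [← this]
      exact ⟨fun hx => Or.inr ⟨x, hx, rfl⟩, fun e => e.elim (fun e => absurd e hz)
        fun ⟨y, hy, e⟩ => h.inj e ▸ hy⟩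
  · intro x hx hxt
    obtain ⟨h1, h2⟩ := h.ne_of_isCrossing hM hx
    rcases mem_four_of_sameCycle (hM.rot_four t) hxt with e | e | e | e
    · exact h.ne_left x e
    · exact h.ne_right x e
    · exact h1 e
    · exact h2 e

theorem isPlanar_iff (h : KinkAt M M' t f) (hM : M.IsKnot) (hM' : M'.IsKnot) :
    M.IsPlanar ↔ M'.IsPlanar := by
  rw [hM.isPlanar_iff, hM'.isPlanar_iff, h.card_crossing hM, ← h.card_face hM]
  omega

theorem removeKink (h : KinkAt M M' t f) {hM : M.IsKnot} {hM' : M'.IsKnot}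
    {hp : M.IsPlanar} {hp' : M'.IsPlanar} (c : M'.Dart) :
    KnotDiagram.RemoveKink (KnotDiagram.ofMap M hM hp (M.faceOf (f c)))
      (KnotDiagram.ofMap M' hM' hp' (M'.faceOf c)) :=
  ⟨t, f, h.crossing, h.edge_eq_rot, (h.faceOf_ne (h.ne_left c)).symm, h.inj, h.range, h.edge,
    h.rot_left, h.rot_right, h.rot_other, h.isOver, c, rfl, rfl⟩

end KinkAt

end CurveMap

namespace CurveMap

variable {M M' : CurveMap}

/-! ### Triple point moves -/

theorem fin_three_add (k : Fin 3) : k + 1 + 1 + 1 = k := by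
  revert k; decide

/-- `KnotDiagram.TripleMove` without the conditions on the unbounded regions. -/
structure TripleAt (M M' : CurveMap) (t : Fin 3 → M.Dart) (π : M.Dart → M.Dart)
    (f : M.Dart ≃ M'.Dart) : Prop where
  crossing : ∀ k, M.IsCrossing (t k)
  not_sameCycle : ∀ k l, k ≠ l → ¬ M.rot.SameCycle (t k) (t l)
  edge_corner : ∀ k, M.edge (t k) = M.rot (t (k + 1))
  not_cyclic : ¬ (M.isOver (t 0) = M.isOver (t 1) ∧ M.isOver (t 1) = M.isOver (t 2))
  perm : ∀ k, π (t k) = M.rot (M.rot (M.rot (t (k + 1)))) ∧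
      π (M.rot (M.rot (M.rot (t (k + 1))))) = t k ∧
      π (M.rot (M.rot (t k))) = M.rot (t (k + 1)) ∧
      π (M.rot (t (k + 1))) = M.rot (M.rot (t k))
  perm_other : ∀ x, (∀ k, ¬ M.rot.SameCycle (t k) x) → π x = x
  edge : ∀ x, M'.edge (f (π x)) = f (π (M.edge x))
  rot : ∀ x, M'.rot (f x) = f (M.rot x)
  isOver : ∀ x, M.IsCrossing x → M'.isOver (f x) = M.isOver x

theorem sameCycle_map (f : M.Dart → M'.Dart) (hi : Function.Injective f)
    (hr : ∀ x, M'.rot (f x) = f (M.rot x)) {x y : M.Dart} :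
    M'.rot.SameCycle (f x) (f y) ↔ M.rot.SameCycle x y := by
  rw [sameCycle_iff_iterate, sameCycle_iff_iterate]
  have : Function.Semiconj f M.rot M'.rot := fun x => (hr x).symm
  refine exists_congr fun n => ?_
  rw [← (this.iterate_right n).eq, hi.eq_iff]

namespace TripleAt

variable {t : Fin 3 → M.Dart} {π : M.Dart → M.Dart} {f : M.Dart ≃ M'.Dart}

theorem corner_cases (hM : M.IsKnot) (t : Fin 3 → M.Dart) (x : M.Dart) :
    (∃ k, x = t k) ∨ (∃ k, x = M.rot (t (k + 1))) ∨ (∃ k, x = M.rot (M.rot (t k))) ∨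
      (∃ k, x = M.rot (M.rot (M.rot (t (k + 1))))) ∨ (∀ k, ¬ M.rot.SameCycle (t k) x) := by
  by_cases hx : ∃ k, M.rot.SameCycle (t k) x
  · obtain ⟨k, hk⟩ := hx
    rcases mem_four_of_sameCycle (hM.rot_four _) hk with e | e | e | e
    · exact Or.inl ⟨k, e⟩
    · exact Or.inr (Or.inl ⟨k + 1 + 1, by rw [fin_three_add, e]⟩)
    · exact Or.inr (Or.inr (Or.inl ⟨k, e⟩))
    · exact Or.inr (Or.inr (Or.inr (Or.inl ⟨k + 1 + 1, by rw [fin_three_add, e]⟩)))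
  · exact Or.inr (Or.inr (Or.inr (Or.inr (not_exists.1 hx))))

theorem perm_perm (h : TripleAt M M' t π f) (hM : M.IsKnot) (x : M.Dart) : π (π x) = x := by
  rcases corner_cases hM t x with ⟨k, rfl⟩ | ⟨k, rfl⟩ | ⟨k, rfl⟩ | ⟨k, rfl⟩ | hx
  · rw [(h.perm k).1, (h.perm k).2.1]
  · rw [(h.perm k).2.2.2, (h.perm k).2.2.1]
  · rw [(h.perm k).2.2.1, (h.perm k).2.2.2]
  · rw [(h.perm k).2.1, (h.perm k).1]
  · rw [h.perm_other x hx, h.perm_other x hx]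

theorem isPoint_iff (h : TripleAt M M' t π f) (x : M.Dart) : M'.IsPoint (f x) ↔ M.IsPoint x := by
  unfold IsPoint
  rw [h.rot, h.rot, f.injective.eq_iff]

theorem isCrossing_iff (h : TripleAt M M' t π f) (x : M.Dart) :
    M'.IsCrossing (f x) ↔ M.IsCrossing x := not_congr (h.isPoint_iff x)

theorem rot_symm (h : TripleAt M M' t π f) (x : M.Dart) :
    M'.rot.symm (f x) = f (M.rot.symm x) := by
  rw [Equiv.symm_apply_eq, h.rot, Equiv.apply_symm_apply]

theorem edge_rot (h : TripleAt M M' t π f) (hM : M.IsKnot) (k : Fin 3) :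
    M.edge (M.rot (t (k + 1))) = t k := by
  rw [← h.edge_corner, hM.edge_edge]

/-- The inverse of a triple point move is one, at the triangle spanned by the opposite darts at the
three crossings. -/
theorem symm (h : TripleAt M M' t π f) (hM : M.IsKnot) :
    TripleAt M' M (fun k => f (M.rot (M.rot (t k)))) (fun x => f (π (f.symm x))) f.symm where
  crossing k := (h.isCrossing_iff _).2 (isCrossing_rot_iff.2 (isCrossing_rot_iff.2 (h.crossing k)))
  not_sameCycle k l hkl := by
    rw [sameCycle_map f f.injective h.rot]
    simpa [Equiv.Perm.sameCycle_apply_left, Equiv.Perm.sameCycle_apply_right] using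
      h.not_sameCycle k l hkl
  edge_corner k := by
    rw [← (h.perm k).2.2.2, h.edge, h.edge_rot hM, (h.perm k).1, h.rot]
  not_cyclic := by
    have : ∀ k, M'.isOver (f (M.rot (M.rot (t k)))) = M.isOver (t k) := fun k => by
      rw [h.isOver, hM.isOver_rot, hM.isOver_rot, Bool.not_not]
      all_goals simpa only [isCrossing_rot_iff] using h.crossing k
    simpa only [this] using h.not_cyclic
  perm k := by
    simp only [h.rot, Equiv.symm_apply_apply, hM.rot_four]
    exact ⟨by rw [(h.perm k).2.2.1], by rw [(h.perm k).2.2.2], by rw [(h.perm k).1],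
      by rw [(h.perm k).2.1]⟩
  perm_other x hx := by
    obtain ⟨x, rfl⟩ := f.surjective x
    rw [Equiv.symm_apply_apply, h.perm_other]
    intro k
    have := hx k
    rw [sameCycle_map f f.injective h.rot] at this
    simpa [Equiv.Perm.sameCycle_apply_left] using this
  edge x := by
    obtain ⟨x, rfl⟩ := f.surjective x
    obtain ⟨w, rfl⟩ : ∃ w, π w = x := ⟨_, h.perm_perm hM x⟩
    simp only [Equiv.symm_apply_apply, h.edge, h.perm_perm hM]
  rot x := by
    obtain ⟨x, rfl⟩ := f.surjective x
    simp only [Equiv.symm_apply_apply, h.rot]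
  isOver x hx := by
    obtain ⟨x, rfl⟩ := f.surjective x
    rw [Equiv.symm_apply_apply, h.isOver]
    exact (h.isCrossing_iff x).1 hx

/-- Each of the three strands meets the same vertices before and after the move. -/
theorem straight_perm (h : TripleAt M M' t π f) (hM : M.IsKnot) (x : M.Dart) :
    Relation.EqvGen M'.Straight (f x) (f (π x)) := by
  have opp : ∀ y, M.IsCrossing y → Relation.EqvGen M'.Straight (f y) (f (M.rot (M.rot y))) := by
    intro y hy
    exact .rel _ _ (Or.inr (Or.inr ⟨(h.isCrossing_iff y).2 hy, by rw [h.rot, h.rot]⟩))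
  have ed : ∀ k, Relation.EqvGen M'.Straight (f (M.rot (M.rot (t k))))
      (f (M.rot (M.rot (M.rot (t (k + 1)))))) := by
    intro k
    refine .rel _ _ (Or.inl ?_)
    rw [← (h.perm k).2.2.2, h.edge, h.edge_rot hM, (h.perm k).1]
  have o1 : ∀ k, Relation.EqvGen M'.Straight (f (t k)) (f (M.rot (M.rot (t k)))) :=
    fun k => opp _ (h.crossing k)
  have o2 : ∀ k, Relation.EqvGen M'.Straight (f (M.rot (t (k + 1))))
      (f (M.rot (M.rot (M.rot (t (k + 1)))))) :=
    fun k => opp _ (isCrossing_rot_iff.2 (h.crossing _))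
  rcases corner_cases hM t x with ⟨k, rfl⟩ | ⟨k, rfl⟩ | ⟨k, rfl⟩ | ⟨k, rfl⟩ | hx
  · rw [(h.perm k).1]; exact .trans _ _ _ (o1 k) (ed k)
  · rw [(h.perm k).2.2.2]; exact .trans _ _ _ (o2 k) (.symm _ _ (ed k))
  · rw [(h.perm k).2.2.1]; exact .trans _ _ _ (ed k) (.symm _ _ (o2 k))
  · rw [(h.perm k).2.1]; exact .symm _ _ (.trans _ _ _ (o1 k) (ed k))
  · rw [h.perm_other x hx]; exact .refl _

theorem isKnot (h : TripleAt M M' t π f) (hM : M.IsKnot) : M'.IsKnot where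
  edge_edge x := by
    obtain ⟨x, rfl⟩ := f.surjective x
    rw [← h.perm_perm hM x, h.edge, h.edge, hM.edge_edge]
  edge_ne x e := by
    obtain ⟨x, rfl⟩ := f.surjective x
    rw [← h.perm_perm hM x, h.edge] at e
    have := congrArg π (f.injective e)
    rw [h.perm_perm hM, h.perm_perm hM] at this
    exact hM.edge_ne _ this
  rot_ne x e := by
    obtain ⟨x, rfl⟩ := f.surjective x
    rw [h.rot] at e
    exact hM.rot_ne _ (f.injective e)
  rot_four x := by
    obtain ⟨x, rfl⟩ := f.surjective x
    simp only [h.rot, hM.rot_four]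
  isOver_rot x hx := by
    obtain ⟨x, rfl⟩ := f.surjective x
    have hx' := (h.isCrossing_iff x).1 hx
    rw [h.rot, h.isOver _ (isCrossing_rot_iff.2 hx'), h.isOver _ hx', hM.isOver_rot _ hx']
  one_component x y := by
    obtain ⟨x, rfl⟩ := f.surjective x
    obtain ⟨y, rfl⟩ := f.surjective y
    refine eqvGen_of_kernel f ?_ (hM.one_component x y)
    rintro a b (rfl | ⟨hp, rfl⟩ | ⟨hc, rfl⟩)
    · refine .trans _ _ _ (h.straight_perm hM a) (.trans _ (f (π (M.edge a))) _ ?_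
        (.symm _ _ (h.straight_perm hM (M.edge a))))
      exact .rel _ _ (Or.inl (h.edge a).symm)
    · exact .rel _ _ (Or.inr (Or.inl ⟨(h.isPoint_iff a).2 hp, (h.rot a).symm⟩))
    · exact .rel _ _ (Or.inr (Or.inr ⟨(h.isCrossing_iff a).2 hc, by rw [h.rot, h.rot]⟩))

/-! The regions, apart from the triangle itself, are seen from the darts outside the triangle. -/

theorem next_corner (h : TripleAt M M' t π f) (k : Fin 3) : M.next (t k) = t (k + 1) := by
  rw [next_apply, h.edge_corner, Equiv.symm_apply_apply]

theorem next_rot (h : TripleAt M M' t π f) (hM : M.IsKnot) (k : Fin 3) :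
    M.next (M.rot (t (k + 1))) = M.rot (M.rot (M.rot (t k))) := by
  rw [next_apply, h.edge_rot hM, hM.rot_symm]

/-- The dart is not one of the six half-edges that form the sides of the triangle. -/
def Outside (t : Fin 3 → M.Dart) (x : M.Dart) : Prop := ∀ k, x ≠ t k ∧ x ≠ M.rot (t k)

theorem pow_rot_eq (h : TripleAt M M' t π f) (hM : M.IsKnot) {k l : Fin 3} {i j : ℕ} (hi : i < 4)
    (hj : j < 4) (e : M.rot^[i] (t k) = M.rot^[j] (t l)) : k = l ∧ i = j := by
  have hkl : k = l := by
    by_contra hkl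
    refine h.not_sameCycle k l hkl ?_
    have h1 : M.rot.SameCycle (t k) (M.rot^[i] (t k)) := (sameCycle_iff_iterate _).2 ⟨i, rfl⟩
    have h2 : M.rot.SameCycle (t l) (M.rot^[j] (t l)) := (sameCycle_iff_iterate _).2 ⟨j, rfl⟩
    exact (e ▸ h1).trans h2.symm
  subst hkl
  exact ⟨rfl, hM.pow_rot_injective (h.crossing k) hi hj e⟩

theorem outside_two (h : TripleAt M M' t π f) (hM : M.IsKnot) (k : Fin 3) :
    Outside t (M.rot (M.rot (t k))) := fun l =>
  ⟨fun e => by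
      have := (h.pow_rot_eq hM (i := 2) (j := 0) (by norm_num) (by norm_num) e).2
      omega,
    fun e => by
      have := (h.pow_rot_eq hM (i := 2) (j := 1) (by norm_num) (by norm_num) e).2
      omega⟩

theorem outside_three (h : TripleAt M M' t π f) (hM : M.IsKnot) (k : Fin 3) :
    Outside t (M.rot (M.rot (M.rot (t k)))) := fun l =>
  ⟨fun e => by
      have := (h.pow_rot_eq hM (i := 3) (j := 0) (by norm_num) (by norm_num) e).2
      omega,
    fun e => by
      have := (h.pow_rot_eq hM (i := 3) (j := 1) (by norm_num) (by norm_num) e).2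
      omega⟩

theorem outside_of_not_sameCycle {x : M.Dart}
    (hx : ∀ k, ¬ M.rot.SameCycle (t k) x) : Outside t x := fun k =>
  ⟨fun e => hx k (e ▸ .refl _ _), fun e => hx k (e ▸ by simp [Equiv.Perm.SameCycle.refl])⟩

theorem outside_edge (h : TripleAt M M' t π f) (hM : M.IsKnot) {x : M.Dart} (hx : Outside t x) :
    Outside t (M.edge x) := fun k => by
  have hk := fin_three_add k
  constructor
  · intro e
    rw [hM.edge_eq_iff, h.edge_corner] at e
    exact (hx _).2 e
  · intro e
    rw [← hk, hM.edge_eq_iff, h.edge_rot hM] at e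
    exact (hx _).1 e

theorem outside_cases (hM : M.IsKnot) {x : M.Dart} (hx : Outside t x) :
    (∃ k, x = M.rot (M.rot (t k))) ∨ (∃ k, x = M.rot (M.rot (M.rot (t (k + 1))))) ∨
      (∀ k, ¬ M.rot.SameCycle (t k) x) := by
  rcases corner_cases hM t x with ⟨k, e⟩ | ⟨k, e⟩ | hx' | hx' | hx'
  · exact absurd e (hx k).1
  · exact absurd e (hx _).2
  · exact Or.inl hx'
  · exact Or.inr (Or.inl hx')
  · exact Or.inr (Or.inr hx')

theorem perm_injective (h : TripleAt M M' t π f) (hM : M.IsKnot) : Function.Injective π :=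
  Function.LeftInverse.injective (h.perm_perm hM)

/-- `M'.next` in terms of the darts of `M`. -/
theorem next_map (h : TripleAt M M' t π f) (x : M.Dart) :
    M'.next (f (π x)) = f (M.rot.symm (π (M.edge x))) := by
  rw [next_apply, h.edge, h.rot_symm]

/-- Seen from outside the triangle, `M` and `M'` have the same boundary walks. The permutation `π`
accounts for the darts whose attachment the move changes. -/
theorem returns (h : TripleAt M M' t π f) (hM : M.IsKnot) (s : {x // Outside t x}) :
    ∃ s' : {x // Outside t x},
      Returns M.next (Set.range (Subtype.val : {x // Outside t x} → M.Dart)) s.1 s'.1 ∧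
      Returns M'.next (Set.range fun s : {x // Outside t x} => f (π s.1)) (f (π s.1))
        (f (π s'.1)) := by
  obtain ⟨x, hx⟩ := s
  rcases outside_cases hM (h.outside_edge hM hx) with ⟨k, hk⟩ | ⟨k, hk⟩ | hz
  · refine ⟨⟨_, h.outside_three hM (k + 1 + 1)⟩, ?_, ?_⟩
    · refine .skip_eq (z := M.rot (t k)) ?_ ?_ (.here_eq ?_ ⟨⟨_, h.outside_three hM _⟩, rfl⟩)
      · rw [next_apply, hk, Equiv.symm_apply_apply]
      · rintro ⟨⟨y, hy⟩, rfl⟩; exact (hy k).2 rfl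
      · have := h.next_rot hM (k + 1 + 1)
        rwa [fin_three_add] at this
    · refine .here_eq ?_ ⟨⟨_, h.outside_three hM _⟩, rfl⟩
      rw [h.next_map, hk, (h.perm k).2.2.1, Equiv.symm_apply_apply, (h.perm (k + 1)).2.1]
  · refine ⟨⟨_, h.outside_two hM (k + 1)⟩, ?_, ?_⟩
    · refine .here_eq ?_ ⟨⟨_, h.outside_two hM _⟩, rfl⟩
      rw [next_apply, hk, Equiv.symm_apply_apply]
    · have e1 : f (M.rot (M.rot (M.rot (t k)))) = f (π (t (k + 1 + 1))) := by
        rw [(h.perm (k + 1 + 1)).1, fin_three_add]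
      have e2 : π (M.rot (M.rot (t (k + 1)))) = M.rot (t (k + 1 + 1)) := (h.perm (k + 1)).2.2.1
      refine .skip_eq (z := f (M.rot (M.rot (M.rot (t k))))) ?_ ?_
        (.here_eq ?_ ⟨⟨_, h.outside_two hM _⟩, rfl⟩)
      · rw [h.next_map, hk, (h.perm k).2.1, hM.rot_symm]
      · rintro ⟨⟨y, hy⟩, e⟩
        exact (hy (k + 1 + 1)).1 (h.perm_injective hM (f.injective (e.trans e1)))
      · have e3 := (h.perm (k + 1 + 1)).2.2.2
        have e4 := h.edge_corner (k + 1 + 1)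
        rw [fin_three_add] at e4
        have e5 : π (M.rot (t k)) = M.rot (M.rot (t (k + 1 + 1))) := by
          rwa [fin_three_add] at e3
        rw [e1, h.next_map, e4, e5, Equiv.symm_apply_apply, e2]
  · have hz' : ∀ k, ¬ M.rot.SameCycle (t k) (M.rot.symm (M.edge x)) := by
      intro k hk
      refine hz k ?_
      rw [← Equiv.apply_symm_apply M.rot (M.edge x)]
      exact hk.apply_right
    refine ⟨⟨_, outside_of_not_sameCycle hz'⟩, ?_, ?_⟩
    · exact .here_eq rfl ⟨⟨_, outside_of_not_sameCycle hz'⟩, rfl⟩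
    · refine .here_eq ?_ ⟨⟨_, outside_of_not_sameCycle hz'⟩, rfl⟩
      rw [h.next_map, h.perm_other _ hz, h.perm_other _ hz']

theorem faceOf_eq_iff (h : TripleAt M M' t π f) (hM : M.IsKnot) {x y : M.Dart}
    (hx : Outside t x) (hy : Outside t y) :
    M.faceOf x = M.faceOf y ↔ M'.faceOf (f (π x)) = M'.faceOf (f (π y)) := by
  choose n h1 h2 using h.returns hM
  exact faceOf_eq_iff_of_returns Subtype.val (fun s : {x // Outside t x} => f (π s.1)) n
    Subtype.val_injective
    (fun a b e => Subtype.ext (h.perm_injective hM (f.injective e))) h1 h2 ⟨x, hx⟩ ⟨y, hy⟩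

theorem faceOf_corner (h : TripleAt M M' t π f) (k : Fin 3) : M.faceOf (t k) = M.faceOf (t 0) := by
  have h1 : M.faceOf (t 1) = M.faceOf (t 0) := by rw [← faceOf_next (t 0), h.next_corner]; rfl
  have h2 : M.faceOf (t 2) = M.faceOf (t 1) := by rw [← faceOf_next (t 1), h.next_corner]; rfl
  fin_cases k
  · rfl
  · exact h1
  · exact h2.trans h1

theorem mem_of_faceOf_eq (h : TripleAt M M' t π f) {x : M.Dart}
    (hx : M.faceOf x = M.faceOf (t 0)) : ∃ k, x = t k :=
  (faceOf_eq.1 hx.symm).mem_of_forward_closed {z | ∃ k, z = t k} ⟨0, rfl⟩ (by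
    rintro _ ⟨k, rfl⟩
    exact ⟨k + 1, h.next_corner k⟩)

theorem faceOf_ne (h : TripleAt M M' t π f) {x : M.Dart} (hx : Outside t x) :
    M.faceOf (t 0) ≠ M.faceOf x := by
  intro e
  obtain ⟨k, hk⟩ := h.mem_of_faceOf_eq e.symm
  exact (hx k).1 hk

theorem missing_face (h : TripleAt M M' t π f) (hM : M.IsKnot) (F : M.Face) :
    F ∈ ({M.faceOf (t 0)} : Set M.Face) ↔ ∀ s : {x // Outside t x}, M.faceOf s.1 ≠ F := by
  obtain ⟨z, rfl⟩ := faceOf_surj F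
  rw [Set.mem_singleton_iff]
  constructor
  · intro e s
    rw [e]
    exact (h.faceOf_ne s.2).symm
  · intro hF
    rcases corner_cases hM t z with ⟨k, rfl⟩ | ⟨k, rfl⟩ | ⟨k, rfl⟩ | ⟨k, rfl⟩ | hz
    · exact h.faceOf_corner k
    · exact absurd ((congrArg M.faceOf (h.next_rot hM k)).symm.trans (faceOf_next _))
        (hF ⟨_, h.outside_three hM k⟩)
    · exact absurd rfl (hF ⟨_, h.outside_two hM k⟩)
    · exact absurd rfl (hF ⟨_, h.outside_three hM _⟩)
    · exact absurd rfl (hF ⟨z, outside_of_not_sameCycle hz⟩)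

theorem outside_symm_iff (h : TripleAt M M' t π f) (hM : M.IsKnot) (x : M.Dart) :
    Outside (fun k => f (M.rot (M.rot (t k)))) (f (π x)) ↔ Outside t x := by
  have key : ∀ k, (f (π x) = f (M.rot (M.rot (t k))) ↔ x = M.rot (t (k + 1))) ∧
      (f (π x) = M'.rot (f (M.rot (M.rot (t (k + 1))))) ↔ x = t k) := by
    intro k
    rw [h.rot, f.injective.eq_iff, f.injective.eq_iff, ← (h.perm k).2.2.2, ← (h.perm k).1,
      (h.perm_injective hM).eq_iff, (h.perm_injective hM).eq_iff]
    exact ⟨Iff.rfl, Iff.rfl⟩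
  constructor
  · intro hx k
    refine ⟨fun e => (hx (k + 1)).2 ((key k).2.2 e), fun e => (hx (k + 1 + 1)).1 ((key _).1.2 ?_)⟩
    rw [fin_three_add, e]
  · intro hx k
    refine ⟨fun e => (hx (k + 1)).2 ((key k).1.1 e),
      fun e => (hx (k + 1 + 1)).1 ((key _).2.1 ?_)⟩
    rw [fin_three_add, e]

theorem card_face (h : TripleAt M M' t π f) (hM : M.IsKnot) :
    Nat.card M.Face = Nat.card M'.Face := by
  have := card_face_add (M := M) (N := M') (S := {x // Outside t x}) Subtype.val
    (fun s => f (π s.1)) (fun s s' => h.faceOf_eq_iff hM s.2 s'.2) {M.faceOf (t 0)}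
    {M'.faceOf (f (M.rot (M.rot (t 0))))} (h.missing_face hM) ?_
  · simpa using this
  · intro F
    rw [(h.symm hM).missing_face (h.isKnot hM)]
    constructor
    · rintro hF ⟨x, hx⟩
      exact hF ⟨_, (h.outside_symm_iff hM x).2 hx⟩
    · rintro hF ⟨y, hy⟩
      obtain ⟨x, rfl⟩ := f.surjective y
      obtain ⟨w, rfl⟩ : ∃ w, π w = x := ⟨_, h.perm_perm hM x⟩
      exact hF ⟨_, (h.outside_symm_iff hM w).1 hy⟩

theorem isPlanar_iff (h : TripleAt M M' t π f) (hM : M.IsKnot) : M.IsPlanar ↔ M'.IsPlanar := by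
  rw [hM.isPlanar_iff, (h.isKnot hM).isPlanar_iff, h.card_face hM,
    card_crossing_eq f (fun x y _ _ e => f.injective e) (fun x => (h.isCrossing_iff x).2) fun z hz => by
      obtain ⟨x, rfl⟩ := f.surjective z; exact ⟨x, (h.isCrossing_iff x).1 hz, rfl⟩]

theorem tripleMove (h : TripleAt M M' t π f) {hM : M.IsKnot} {hM' : M'.IsKnot}
    {hp : M.IsPlanar} {hp' : M'.IsPlanar} {c : M.Dart} (hc : Outside t c) :
    KnotDiagram.TripleMove (KnotDiagram.ofMap M hM hp (M.faceOf c))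
      (KnotDiagram.ofMap M' hM' hp' (M'.faceOf (f (π c)))) :=
  ⟨t, π, f, h.crossing, h.not_sameCycle, h.edge_corner, h.not_cyclic, h.faceOf_ne hc, h.perm,
    h.perm_other, h.edge, h.rot, h.isOver, c, hc, rfl, rfl⟩

end TripleAt

open Classical in
/-- A triangle whose three strands lie on different levels admits a triple point move. -/
theorem IsKnot.exists_tripleAt (hM : M.IsKnot) (t : Fin 3 → M.Dart)
    (crossing : ∀ k, M.IsCrossing (t k))
    (not_sameCycle : ∀ k l, k ≠ l → ¬ M.rot.SameCycle (t k) (t l))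
    (edge_corner : ∀ k, M.edge (t k) = M.rot (t (k + 1)))
    (not_cyclic : ¬ (M.isOver (t 0) = M.isOver (t 1) ∧ M.isOver (t 1) = M.isOver (t 2))) :
    ∃ (M' : CurveMap) (π : M.Dart → M.Dart) (f : M.Dart ≃ M'.Dart), TripleAt M M' t π f := by
  -- The dart `(k, i)` is the `i`-th one at the `k`-th corner; `σ` is `π` in these coordinates.
  let d : Fin 3 × Fin 4 → M.Dart := fun p => M.rot^[p.2.1] (t p.1)
  have hd : Function.Injective d := by
    rintro ⟨k, i⟩ ⟨l, j⟩ e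
    have e : M.rot^[i.1] (t k) = M.rot^[j.1] (t l) := e
    have hkl : k = l := by
      by_contra hkl
      refine not_sameCycle k l hkl ?_
      have h1 : M.rot.SameCycle (t k) (M.rot^[i.1] (t k)) := (sameCycle_iff_iterate _).2 ⟨i, rfl⟩
      have h2 : M.rot.SameCycle (t l) (M.rot^[j.1] (t l)) := (sameCycle_iff_iterate _).2 ⟨j, rfl⟩
      exact (e ▸ h1).trans h2.symm
    subst hkl
    rw [Fin.ext (hM.pow_rot_injective (crossing k) i.2 j.2 e)]
  let σ : Fin 3 × Fin 4 → Fin 3 × Fin 4 := fun p => match p with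
    | (k, 0) => (k + 1, 3)
    | (k, 3) => (k - 1, 0)
    | (k, 2) => (k + 1, 1)
    | (k, 1) => (k - 1, 2)
  have hσ : ∀ p, σ (σ p) = p := by decide
  let π : M.Dart → M.Dart := Function.extend d (d ∘ σ) id
  have hπ : ∀ p, π (d p) = d (σ p) := fun p => hd.extend_apply _ _ p
  have hπ' : ∀ x, (¬ ∃ p, d p = x) → π x = x := fun x hx => Function.extend_apply' _ _ _ hx
  have hππ : ∀ x, π (π x) = x := by
    intro x
    by_cases hx : ∃ p, d p = x
    · obtain ⟨p, rfl⟩ := hx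
      rw [hπ, hπ, hσ]
    · rw [hπ' x hx, hπ' x hx]
  have hee : Function.Involutive fun x => π (M.edge (π x)) := by
    intro x
    simp only [hππ, hM.edge_edge]
  let M' : CurveMap :=
    { Dart := M.Dart
      finite := M.finite
      edge := hee.toPerm
      rot := M.rot
      isOver := M.isOver }
  refine ⟨M', π, Equiv.refl _, crossing, not_sameCycle, edge_corner, not_cyclic,
    ?_, ?_, ?_, fun _ => rfl, fun _ _ => rfl⟩
  · intro k
    have e : k + 1 - 1 = k := by simp
    refine ⟨hπ (k, 0), (hπ (k + 1, 3)).trans ?_, hπ (k, 2), (hπ (k + 1, 1)).trans ?_⟩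
    · change d (k + 1 - 1, 0) = t k
      rw [e]; rfl
    · change d (k + 1 - 1, 2) = _
      rw [e]; rfl
  · intro x hx
    refine hπ' x ?_
    rintro ⟨⟨k, i⟩, rfl⟩
    exact hx k ((sameCycle_iff_iterate _).2 ⟨i, rfl⟩)
  · intro x
    change π (M.edge (π (π x))) = π (M.edge x)
    rw [hππ]

end CurveMap

/-! ### Unknotted diagrams with a point at infinity -/

theorem KnotDiagram.IsMove.symm {n : ℕ} {D D' : KnotDiagram} (h : IsMove n D D') :
    IsMove n D' D := by
  match n, h with
  | 1, h => exact Or.symm h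
  | 2, h => exact Or.symm h
  | 3, h => exact Or.symm h

theorem KnotDiagram.isUnknotted_iff_of_step {D D' : KnotDiagram}
    (h : PlanarIsotopic D D' ∨ ∃ n, IsMove n D D') : D.IsUnknotted ↔ D'.IsUnknotted := by
  have h' : PlanarIsotopic D' D ∨ ∃ n, IsMove n D' D :=
    h.imp (fun e => .symm _ _ e) fun ⟨n, hn⟩ => ⟨n, hn.symm⟩
  exact ⟨fun ⟨U, hU, hx⟩ => ⟨U, .head h' hU, hx⟩, fun ⟨U, hU, hx⟩ => ⟨U, .head h hU, hx⟩⟩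

namespace CurveMap

variable {M M' : CurveMap}

/-- `M` is a planar diagram of the unknot, the unbounded region being the one on the left of the
dart `c`. -/
def Unknot (M : CurveMap) (c : M.Dart) : Prop :=
  ∃ (hM : M.IsKnot) (hp : M.IsPlanar), (KnotDiagram.ofMap M hM hp (M.faceOf c)).IsUnknotted

theorem IsoAt.unknot_iff {f : M.Dart → M'.Dart} (h : IsoAt M M' f) (hM : M.IsKnot)
    (hM' : M'.IsKnot) (c : M.Dart) : M.Unknot c ↔ M'.Unknot (f c) := by
  constructor
  · rintro ⟨_, hp, hu⟩
    have hp' := (h.isPlanar_iff hM hM').1 hp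
    exact ⟨hM', hp', (KnotDiagram.isUnknotted_iff_of_step (Or.inl (h.planarIsotopic c))).1 hu⟩
  · rintro ⟨_, hp, hu⟩
    have hp' := (h.isPlanar_iff hM hM').2 hp
    exact ⟨hM, hp', (KnotDiagram.isUnknotted_iff_of_step (Or.inl (h.planarIsotopic c))).2 hu⟩

theorem ForgetAt.unknot_iff {p : M.Dart} {f : M'.Dart → M.Dart} (h : ForgetAt M M' p f)
    (hM : M.IsKnot) (c : M'.Dart) : M.Unknot (f c) ↔ M'.Unknot c := by
  constructor
  · rintro ⟨_, hp, hu⟩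
    have hp' := (h.isPlanar_iff hM).1 hp
    exact ⟨h.isKnot hM, hp',
      (KnotDiagram.isUnknotted_iff_of_step (Or.inl (h.planarIsotopic c))).1 hu⟩
  · rintro ⟨_, hp, hu⟩
    have hp' := (h.isPlanar_iff hM).2 hp
    exact ⟨hM, hp', (KnotDiagram.isUnknotted_iff_of_step (Or.inl (h.planarIsotopic c))).2 hu⟩

theorem KinkAt.unknot_iff {t : M.Dart} {f : M'.Dart → M.Dart} (h : KinkAt M M' t f)
    (hM : M.IsKnot) (hM' : M'.IsKnot) (c : M'.Dart) : M.Unknot (f c) ↔ M'.Unknot c := by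
  constructor
  · rintro ⟨_, hp, hu⟩
    have hp' := (h.isPlanar_iff hM hM').1 hp
    exact ⟨hM', hp', (KnotDiagram.isUnknotted_iff_of_step
      (Or.inr ⟨1, Or.inl (h.removeKink c)⟩)).1 hu⟩
  · rintro ⟨_, hp, hu⟩
    have hp' := (h.isPlanar_iff hM hM').2 hp
    exact ⟨hM, hp', (KnotDiagram.isUnknotted_iff_of_step
      (Or.inr ⟨1, Or.inl (h.removeKink c)⟩)).2 hu⟩

theorem TripleAt.unknot_iff {t : Fin 3 → M.Dart} {π : M.Dart → M.Dart} {f : M.Dart ≃ M'.Dart}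
    (h : TripleAt M M' t π f) (hM : M.IsKnot) {c : M.Dart} (hc : Outside t c) :
    M.Unknot c ↔ M'.Unknot (f (π c)) := by
  constructor
  · rintro ⟨_, hp, hu⟩
    have hp' := (h.isPlanar_iff hM).1 hp
    exact ⟨h.isKnot hM, hp', (KnotDiagram.isUnknotted_iff_of_step
      (Or.inr ⟨3, Or.inl (h.tripleMove hc)⟩)).1 hu⟩
  · rintro ⟨_, hp, hu⟩
    have hp' := (h.isPlanar_iff hM).2 hp
    exact ⟨hM, hp', (KnotDiagram.isUnknotted_iff_of_step
      (Or.inr ⟨3, Or.inl (h.tripleMove hc)⟩)).2 hu⟩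

/-! ### Decompositions into a core and tangles -/

/-- A diagram `R` without marked points, all of whose regions have at least three edges. The
values of `e` name its edges. -/
structure IsBase (R : CurveMap) {L : Type} (e : R.Dart → L) : Prop where
  isKnot : R.IsKnot
  crossing : ∀ r, R.IsCrossing r
  eq_iff : ∀ r r', e r = e r' ↔ r' = r ∨ r' = R.edge r
  no_bigon : ∀ r s, R.edge r = R.rot s → R.edge s ≠ R.rot r

/-- A way to see `F` as a diagram obtained from `R` by replacing edges by tangles. The crossings of
`R` are embedded into `F` as the core, and the other vertices of `F` are labelled by the edge of
`R` to whose tangle they belong. The labels are constant along the knot except at the core, which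
forces the strand that leaves the core along an edge of `R` to come back to it at the other end of
that edge. -/
structure Decomp (R : CurveMap) {L : Type} (e : R.Dart → L) (F : CurveMap) where
  /-- the embedding of the crossings of `R` -/
  core : R.Dart → F.Dart
  /-- the edge of `R` on whose tangle a dart lies -/
  label : F.Dart → L
  core_inj : Function.Injective core
  rot_core : ∀ r, F.rot (core r) = core (R.rot r)
  isOver_core : ∀ r, F.isOver (core r) = R.isOver r
  label_core : ∀ r, label (core r) = e r
  label_edge : ∀ x, label (F.edge x) = label x
  label_rot : ∀ x, x ∉ Set.range core → label (F.rot x) = label x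
  edge_base : ∀ r, e (R.edge r) = e r

namespace Decomp

variable {R F F' : CurveMap} {L : Type} {e : R.Dart → L} (S : Decomp R e F) (S' : Decomp R e F')

theorem rot_mem_range_iff (x : F.Dart) : F.rot x ∈ Set.range S.core ↔ x ∈ Set.range S.core := by
  constructor
  · rintro ⟨r, hr⟩
    obtain ⟨r, rfl⟩ := R.rot.surjective r
    rw [← S.rot_core] at hr
    exact ⟨r, F.rot.injective hr⟩
  · rintro ⟨r, rfl⟩
    exact ⟨_, (S.rot_core r).symm⟩

theorem isCrossing_core (hR : IsBase R e) (r : R.Dart) : F.IsCrossing (S.core r) := by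
  intro h
  refine hR.crossing r (S.core_inj ?_)
  rw [← S.rot_core, ← S.rot_core, h]

theorem not_mem_of_isPoint (hR : IsBase R e) {x : F.Dart} (hx : F.IsPoint x) :
    x ∉ Set.range S.core := by
  rintro ⟨r, rfl⟩
  exact S.isCrossing_core hR r hx

open Classical in
/-- The rotation of the closed up tangles: the two ends at the core of the tangle that replaces an
edge of `R` become the two halves of a marked point. -/
noncomputable def turn : Equiv.Perm F.Dart :=
  Equiv.ofBijective
    (fun x => if h : ∃ r, S.core r = x then S.core (R.edge h.choose) else F.rot x) <| by
    rw [← Finite.injective_iff_bijective]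
    have hcore : ∀ r (h : ∃ s, S.core s = S.core r), h.choose = r :=
      fun r h => S.core_inj h.choose_spec
    intro x y hxy
    simp only at hxy
    by_cases hx : ∃ r, S.core r = x <;> by_cases hy : ∃ r, S.core r = y
    · obtain ⟨r, rfl⟩ := hx
      obtain ⟨s, rfl⟩ := hy
      simp only [exists_apply_eq_apply, dif_pos, hcore] at hxy
      rw [R.edge.injective (S.core_inj hxy)]
    · rw [dif_pos hx, dif_neg hy] at hxy
      exact absurd ((S.rot_mem_range_iff y).1 ⟨_, hxy⟩) hy
    · rw [dif_neg hx, dif_pos hy] at hxy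
      exact absurd ((S.rot_mem_range_iff x).1 ⟨_, hxy.symm⟩) hx
    · rw [dif_neg hx, dif_neg hy] at hxy
      exact F.rot.injective hxy

theorem turn_core (r : R.Dart) : S.turn (S.core r) = S.core (R.edge r) := by
  have h : ∃ s, S.core s = S.core r := ⟨r, rfl⟩
  exact (dif_pos h).trans (by rw [S.core_inj h.choose_spec])

theorem turn_of_not_mem {x : F.Dart} (hx : x ∉ Set.range S.core) : S.turn x = F.rot x :=
  dif_neg hx

theorem turn_mem_range_iff (x : F.Dart) : S.turn x ∈ Set.range S.core ↔ x ∈ Set.range S.core := by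
  by_cases hx : x ∈ Set.range S.core
  · obtain ⟨r, rfl⟩ := hx
    rw [S.turn_core]
    exact ⟨fun _ => ⟨_, rfl⟩, fun _ => ⟨_, rfl⟩⟩
  · rw [S.turn_of_not_mem hx, rot_mem_range_iff]

theorem label_turn (x : F.Dart) : S.label (S.turn x) = S.label x := by
  by_cases hx : x ∈ Set.range S.core
  · obtain ⟨r, rfl⟩ := hx
    rw [S.turn_core, S.label_core, S.label_core, S.edge_base]
  · rw [S.turn_of_not_mem hx, S.label_rot x hx]

/-- The closure of the tangle that replaces the edge of `R` containing `r`. -/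
noncomputable def tangle (r : R.Dart) : CurveMap where
  Dart := {x : F.Dart // S.label x = e r}
  finite := inferInstance
  edge := F.edge.subtypePerm fun x => by rw [S.label_edge]
  rot := S.turn.subtypePerm fun x => by rw [S.label_turn]
  isOver := fun x => F.isOver x.1

/-- The end of the tangle at the start of `r`. -/
def tip (r : R.Dart) : (S.tangle r).Dart := ⟨S.core r, S.label_core r⟩

theorem edge_val {r : R.Dart} (x : (S.tangle r).Dart) : ((S.tangle r).edge x).1 = F.edge x.1 := rfl

theorem rot_val {r : R.Dart} (x : (S.tangle r).Dart) : ((S.tangle r).rot x).1 = S.turn x.1 := rfl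

theorem rot_val_of_not_mem {r : R.Dart} {x : (S.tangle r).Dart} (hx : x.1 ∉ Set.range S.core) :
    ((S.tangle r).rot x).1 = F.rot x.1 := S.turn_of_not_mem hx

theorem rot_rot_val_of_not_mem {r : R.Dart} {x : (S.tangle r).Dart}
    (hx : x.1 ∉ Set.range S.core) :
    ((S.tangle r).rot ((S.tangle r).rot x)).1 = F.rot (F.rot x.1) := by
  have h := S.rot_val_of_not_mem hx
  rw [S.rot_val_of_not_mem, h]
  rwa [h, rot_mem_range_iff]

theorem isPoint_iff_of_not_mem {r : R.Dart} {x : (S.tangle r).Dart}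
    (hx : x.1 ∉ Set.range S.core) : (S.tangle r).IsPoint x ↔ F.IsPoint x.1 := by
  unfold IsPoint
  rw [← S.rot_rot_val_of_not_mem hx]
  exact Subtype.ext_iff

theorem isPoint_of_mem (hR : IsBase R e) {r : R.Dart} {x : (S.tangle r).Dart}
    (hx : x.1 ∈ Set.range S.core) : (S.tangle r).IsPoint x := by
  obtain ⟨s, hs⟩ := hx
  refine Subtype.ext ?_
  rw [S.rot_val, S.rot_val, ← hs, S.turn_core, S.turn_core, hR.isKnot.edge_edge]

theorem isCrossing_iff (hR : IsBase R e) {r : R.Dart} (x : (S.tangle r).Dart) :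
    (S.tangle r).IsCrossing x ↔ x.1 ∉ Set.range S.core ∧ F.IsCrossing x.1 := by
  by_cases hx : x.1 ∈ Set.range S.core
  · exact iff_of_false (fun h => h (S.isPoint_of_mem hR hx)) fun h => h.1 hx
  · rw [IsCrossing, S.isPoint_iff_of_not_mem hx]
    exact ⟨fun h => ⟨hx, h⟩, fun h => h.2⟩

theorem isKnot_tangle (hR : IsBase R e) (hF : F.IsKnot) (r : R.Dart) : (S.tangle r).IsKnot where
  edge_edge x := Subtype.ext (hF.edge_edge x.1)
  edge_ne x h := hF.edge_ne x.1 (congrArg Subtype.val h)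
  rot_ne x h := by
    have h' := congrArg Subtype.val h
    by_cases hx : x.1 ∈ Set.range S.core
    · obtain ⟨s, hs⟩ := hx
      rw [S.rot_val, ← hs, S.turn_core] at h'
      exact hR.isKnot.edge_ne s (S.core_inj h')
    · rw [S.rot_val_of_not_mem hx] at h'
      exact hF.rot_ne _ h'
  rot_four x := by
    by_cases hx : x.1 ∈ Set.range S.core
    · have := S.isPoint_of_mem hR hx
      unfold IsPoint at this
      rw [this, this]
    · refine Subtype.ext ?_
      have h := S.rot_rot_val_of_not_mem hx
      rw [S.rot_rot_val_of_not_mem, h, hF.rot_four]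
      rwa [h, S.rot_mem_range_iff, S.rot_mem_range_iff]
  isOver_rot x hx := by
    obtain ⟨h1, h2⟩ := (S.isCrossing_iff hR x).1 hx
    change F.isOver ((S.tangle r).rot x).1 = _
    rw [S.rot_val_of_not_mem h1, hF.isOver_rot _ h2]
    rfl
  one_component := by
    have start : ∀ s r (hs : S.label (S.core s) = e r),
        Relation.EqvGen (S.tangle r).Straight (S.tip r) ⟨S.core s, hs⟩ := by
      intro s r hs
      rw [S.label_core, hR.eq_iff] at hs
      rcases hs with rfl | rfl
      · exact .refl _
      · refine .rel _ _ (Or.inr (Or.inl ⟨S.isPoint_of_mem hR ⟨_, rfl⟩, Subtype.ext ?_⟩))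
        rw [S.rot_val, tip, S.turn_core, hR.isKnot.edge_edge]
    have key : ∀ z r (hz : S.label z = e r),
        Relation.EqvGen (S.tangle r).Straight (S.tip r) ⟨z, hz⟩ := by
      refine hF.forall_of_closed _ (S.core r) (fun r' => start r r') ?_ ?_ ?_
      · intro a ih r hz
        exact .trans _ _ _ (ih r (by rwa [S.label_edge] at hz)) (.rel _ _ (Or.inl rfl))
      · intro a ha ih r hz
        have h1 := S.not_mem_of_isPoint hR ha
        refine .trans _ _ _ (ih r (by rwa [S.label_rot _ h1] at hz))
          (.rel _ _ (Or.inr (Or.inl ⟨(S.isPoint_iff_of_not_mem h1).2 ha, Subtype.ext ?_⟩)))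
        exact (S.turn_of_not_mem h1).symm
      · intro a ha ih r hz
        by_cases h1 : a ∈ Set.range S.core
        · obtain ⟨s, rfl⟩ := h1
          simp only [S.rot_core] at hz ⊢
          exact start _ r hz
        · have h2 : F.rot a ∉ Set.range S.core := by rwa [rot_mem_range_iff]
          have h3 : S.label a = e r := by rwa [S.label_rot _ h2, S.label_rot _ h1] at hz
          refine .trans _ _ _ (ih r h3)
            (.rel _ _ (Or.inr (Or.inr ⟨(S.isCrossing_iff hR _).2 ⟨h1, ha⟩, Subtype.ext ?_⟩)))
          exact (S.rot_rot_val_of_not_mem (x := ⟨a, h3⟩) h1).symm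
    intro x y
    exact .trans _ _ _ (.symm _ _ (key x.1 r x.2)) (key y.1 r y.2)

/-! ### Comparing decompositions of two diagrams -/

/-- The decompositions of `F` and `F'` correspond to each other under a map of darts. -/
structure Compat (f : F'.Dart → F.Dart) : Prop where
  inj : Function.Injective f
  core : ∀ r, f (S'.core r) = S.core r
  label : ∀ x, S.label (f x) = S'.label x

variable {S S'} {f : F'.Dart → F.Dart}

namespace Compat

theorem mem_range_iff (h : Compat S S' f) (x : F'.Dart) :
    f x ∈ Set.range S.core ↔ x ∈ Set.range S'.core := by
  constructor
  · rintro ⟨r, hr⟩; exact ⟨r, h.inj (by rw [h.core, hr])⟩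
  · rintro ⟨r, rfl⟩; exact ⟨r, (h.core r).symm⟩

theorem map_turn (h : Compat S S' f) {x : F'.Dart}
    (hr : x ∉ Set.range S'.core → f (F'.rot x) = F.rot (f x)) : f (S'.turn x) = S.turn (f x) := by
  by_cases hx : x ∈ Set.range S'.core
  · obtain ⟨r, rfl⟩ := hx
    rw [S'.turn_core, h.core, h.core, S.turn_core]
  · rw [S'.turn_of_not_mem hx, S.turn_of_not_mem (by rwa [h.mem_range_iff]), hr hx]

/-- The map induced between corresponding tangles. -/
def map (h : Compat S S' f) (r : R.Dart) (x : (S'.tangle r).Dart) : (S.tangle r).Dart :=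
  ⟨f x.1, (h.label x.1).trans x.2⟩

theorem map_tip (h : Compat S S' f) (r : R.Dart) : h.map r (S'.tip r) = S.tip r :=
  Subtype.ext (h.core r)

theorem map_injective (h : Compat S S' f) (r : R.Dart) : Function.Injective (h.map r) :=
  fun _ _ e => Subtype.ext (h.inj (congrArg Subtype.val e))

/-- A tangle that is not affected by a move does not change. -/
theorem unknot_iff_of_bij (h : Compat S S' f) (hR : IsBase R e) (hF : F.IsKnot) (hF' : F'.IsKnot)
    (r : R.Dart) (hs : ∀ y, S.label y = e r → ∃ x, f x = y)
    (he : ∀ x, S'.label x = e r → f (F'.edge x) = F.edge (f x))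
    (hr : ∀ x, S'.label x = e r → x ∉ Set.range S'.core → f (F'.rot x) = F.rot (f x))
    (ho : ∀ x, S'.label x = e r → F'.IsCrossing x → F.isOver (f x) = F'.isOver x) :
    (S'.tangle r).Unknot (S'.tip r) ↔ (S.tangle r).Unknot (S.tip r) := by
  have hi : IsoAt (S'.tangle r) (S.tangle r) (h.map r) := by
    refine ⟨⟨h.map_injective r, ?_⟩, ?_, ?_, ?_⟩
    · rintro ⟨y, hy⟩
      obtain ⟨x, rfl⟩ := hs y hy
      exact ⟨⟨x, by rw [← h.label, hy]⟩, rfl⟩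
    · exact fun x => Subtype.ext (he x.1 x.2)
    · exact fun x => Subtype.ext (h.map_turn (hr x.1 x.2))
    · exact fun x hx => ho x.1 x.2 ((S'.isCrossing_iff hR x).1 hx).2
  rw [← h.map_tip r]
  exact hi.unknot_iff (S'.isKnot_tangle hR hF' r) (S.isKnot_tangle hR hF r) _

end Compat

end Decomp

end CurveMap

namespace CurveMap

namespace Decomp

variable {R F F' : CurveMap} {L : Type} {e : R.Dart → L}

namespace Compat

variable {S : Decomp R e F} {S' : Decomp R e F'} {f : F'.Dart → F.Dart}

/-- Forgetting a marked point changes only the tangle on which it lies. -/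
theorem unknot_iff_of_forgetAt (h : Compat S S' f) {p : F.Dart} (hf : ForgetAt F F' p f)
    (hR : IsBase R e) (hF : F.IsKnot) (r : R.Dart) :
    (S'.tangle r).Unknot (S'.tip r) ↔ (S.tangle r).Unknot (S.tip r) := by
  have hF' := hf.isKnot hF
  have hp := S.not_mem_of_isPoint hR hf.point
  by_cases hpr : S.label p = e r
  · let q : (S.tangle r).Dart := ⟨p, hpr⟩
    have hq : ((S.tangle r).rot q).1 = F.rot p := S.rot_val_of_not_mem hp
    have hT : ForgetAt (S.tangle r) (S'.tangle r) q (h.map r) := by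
      refine ⟨(S.isPoint_iff_of_not_mem hp).2 hf.point, ?_, h.map_injective r, ?_, ?_, ?_, ?_, ?_,
        ?_⟩
      · intro he
        exact hf.edge_ne_rot ((congrArg Subtype.val he).trans hq)
      · ext y
        constructor
        · rintro ⟨x, rfl⟩
          rintro (hx | hx)
          · exact hf.ne_left x.1 (congrArg Subtype.val hx)
          · exact hf.ne_right x.1 ((congrArg Subtype.val hx).trans hq)
        · intro hy
          obtain ⟨x, hx⟩ := hf.exists_eq (x := y.1) (fun hy' => hy (Or.inl (Subtype.ext hy')))
            (fun hy' => hy (Or.inr (Subtype.ext (hy'.trans hq.symm))))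
          exact ⟨⟨x, by rw [← h.label, hx, y.2]⟩, Subtype.ext hx⟩
      · intro x hx
        refine Subtype.ext ((hf.edge_left x.1 (congrArg Subtype.val hx)).trans ?_)
        rw [S.edge_val, hq]
      · intro x hx
        exact Subtype.ext (hf.edge_right x.1 ((congrArg Subtype.val hx).trans hq))
      · intro x h1 h2
        refine Subtype.ext (hf.edge_other x.1 (fun hx => h1 (Subtype.ext hx))
          (fun hx => h2 (Subtype.ext (hx.trans hq.symm))))
      · exact fun x => Subtype.ext (h.map_turn fun _ => hf.rot x.1)
      · exact fun x hx => hf.isOver x.1 ((S'.isCrossing_iff hR x).1 hx).2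
    rw [← hT.unknot_iff (S.isKnot_tangle hR hF r), h.map_tip]
  · have hne : ∀ y, S.label y = e r → y ≠ p ∧ y ≠ F.rot p := fun y hy =>
      ⟨fun hyp => hpr (hyp ▸ hy), fun hyp => hpr (by rwa [hyp, S.label_rot _ hp] at hy)⟩
    refine h.unknot_iff_of_bij hR hF hF' r (fun y hy => hf.exists_eq (hne y hy).1 (hne y hy).2) ?_
      (fun x _ _ => hf.rot x) (fun x _ hx => (hf.isOver x hx).symm)
    intro x hx
    have := hne (F.edge (f x)) (by rw [S.label_edge, h.label, hx])
    exact hf.edge_other x this.1 this.2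

/-- Removing a kink changes only the tangle on which it lies. -/
theorem unknot_iff_of_kinkAt (h : Compat S S' f) {t : F.Dart} (hf : KinkAt F F' t f)
    (ht : t ∉ Set.range S.core) (hR : IsBase R e) (hF : F.IsKnot) (hF' : F'.IsKnot) (r : R.Dart) :
    (S'.tangle r).Unknot (S'.tip r) ↔ (S.tangle r).Unknot (S.tip r) := by
  have ht1 : F.rot t ∉ Set.range S.core := by rwa [S.rot_mem_range_iff]
  have ht2 : F.rot (F.rot t) ∉ Set.range S.core := by rwa [S.rot_mem_range_iff]
  have l1 : S.label (F.rot t) = S.label t := S.label_rot _ ht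
  have l2 : S.label (F.rot (F.rot t)) = S.label t := (S.label_rot _ ht1).trans l1
  have l3 : S.label (F.rot (F.rot (F.rot t))) = S.label t := (S.label_rot _ ht2).trans l2
  by_cases htr : S.label t = e r
  · let q : (S.tangle r).Dart := ⟨t, htr⟩
    have hq1 : ((S.tangle r).rot q).1 = F.rot t := S.rot_val_of_not_mem ht
    have hq2 : ((S.tangle r).rot ((S.tangle r).rot q)).1 = F.rot (F.rot t) :=
      S.rot_rot_val_of_not_mem ht
    have hq3 : ((S.tangle r).rot ((S.tangle r).rot ((S.tangle r).rot q))).1 =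
        F.rot (F.rot (F.rot t)) := by
      rw [S.rot_rot_val_of_not_mem, hq1]
      rwa [hq1]
    have hT : KinkAt (S.tangle r) (S'.tangle r) q (h.map r) := by
      refine ⟨(S.isCrossing_iff hR q).2 ⟨ht, hf.crossing⟩, Subtype.ext (hf.edge_eq_rot.trans hq1.symm),
        h.map_injective r, ?_, fun x => Subtype.ext (hf.edge x.1), ?_, ?_, ?_,
        fun x hx => hf.isOver x.1 ((S'.isCrossing_iff hR x).1 hx).2⟩
      · ext y
        constructor
        · rintro ⟨x, rfl⟩
          rintro (hx | hx)
          · exact hf.ne_left x.1 (congrArg Subtype.val hx)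
          · exact hf.ne_right x.1 ((congrArg Subtype.val hx).trans hq1)
        · intro hy
          obtain ⟨x, hx⟩ := hf.exists_eq (x := y.1) (fun hy' => hy (Or.inl (Subtype.ext hy')))
            (fun hy' => hy (Or.inr (Subtype.ext (hy'.trans hq1.symm))))
          exact ⟨⟨x, by rw [← h.label, hx, y.2]⟩, Subtype.ext hx⟩
      · intro x hx
        have hx' : f x.1 = _ := (congrArg Subtype.val hx).trans hq2
        have : x.1 ∉ Set.range S'.core := by rwa [← h.mem_range_iff, hx']
        refine Subtype.ext (Eq.trans ?_ ((hf.rot_left x.1 hx').trans hq3.symm))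
        exact congrArg f (S'.rot_val_of_not_mem this)
      · intro x hx
        have hx' : f x.1 = _ := (congrArg Subtype.val hx).trans hq3
        have : x.1 ∉ Set.range S'.core := by rwa [← h.mem_range_iff, hx', S.rot_mem_range_iff]
        refine Subtype.ext (Eq.trans ?_ ((hf.rot_right x.1 hx').trans hq2.symm))
        exact congrArg f (S'.rot_val_of_not_mem this)
      · intro x h1 h2
        exact Subtype.ext (h.map_turn fun _ => hf.rot_other x.1
          (fun hx => h1 (Subtype.ext (hx.trans hq2.symm)))
          (fun hx => h2 (Subtype.ext (hx.trans hq3.symm))))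
    rw [← hT.unknot_iff (S.isKnot_tangle hR hF r) (S'.isKnot_tangle hR hF' r), h.map_tip]
  · refine h.unknot_iff_of_bij hR hF hF' r (fun y hy => hf.exists_eq ?_ ?_) (fun x _ => hf.edge x)
      ?_ (fun x _ hx => (hf.isOver x hx).symm)
    · rintro rfl; exact htr hy
    · rintro rfl; exact htr (l1.symm.trans hy)
    · intro x hx _
      refine hf.rot_other x (fun hx' => htr ?_) (fun hx' => htr ?_)
      · rw [← l2, ← hx', h.label, hx]
      · rw [← l3, ← hx', h.label, hx]

end Compat

/-! ### Moving a decomposition along a move -/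

theorem exists_of_forgetAt (S : Decomp R e F) {p : F.Dart} {f : F'.Dart → F.Dart}
    (hf : ForgetAt F F' p f) (hR : IsBase R e) (hF : F.IsKnot) :
    ∃ S' : Decomp R e F', Compat S S' f := by
  have hp := S.not_mem_of_isPoint hR hf.point
  have : ∀ r, ∃ x, f x = S.core r := fun r => hf.exists_eq (fun h => hp ⟨r, h⟩)
    (fun h => hp ((S.rot_mem_range_iff p).1 ⟨r, h⟩))
  choose g hg using this
  have hmem : ∀ x, x ∉ Set.range g → f x ∉ Set.range S.core := by
    rintro x hx ⟨r, hr⟩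
    exact hx ⟨r, hf.inj ((hg r).trans hr)⟩
  refine ⟨⟨g, fun x => S.label (f x), ?_, ?_, ?_, ?_, ?_, ?_, S.edge_base⟩, hf.inj, hg,
    fun _ => rfl⟩
  · exact fun r s h => S.core_inj (by rw [← hg, ← hg, h])
  · exact fun r => hf.inj (by rw [hf.rot, hg, hg, S.rot_core])
  · intro r
    rw [hf.isOver, hg, S.isOver_core]
    rw [hf.isCrossing_iff, hg]
    exact S.isCrossing_core hR r
  · intro r; rw [hg, S.label_core]
  · intro x
    have hl := S.label_rot p hp
    rcases hf.edge_cases hF x with ⟨h1, h2⟩ | ⟨h1, h2⟩ | ⟨-, -, h2⟩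
    · rw [h1, h2, S.label_edge, S.label_edge, hl]
    · rw [h1, h2, S.label_edge, S.label_edge, hl]
    · rw [h2, S.label_edge]
  · intro x hx
    rw [hf.rot, S.label_rot _ (hmem x hx)]

/-- The darts of an additional marked point inherit their labels from the neighbouring darts. -/
theorem exists_of_forgetAt' (S' : Decomp R e F') {p : F.Dart} {f : F'.Dart → F.Dart}
    (hf : ForgetAt F F' p f) (hR : IsBase R e) (hF : F.IsKnot) :
    ∃ S : Decomp R e F, Compat S S' f := by
  obtain ⟨ρ, h1, h2, h3, h4⟩ := hf.exists_retraction hF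
  have hp : F.rot (F.rot p) = p := hf.point
  have hl : S'.label (ρ (F.rot p)) = S'.label (ρ p) := by rw [← h4, S'.label_edge]
  refine ⟨⟨fun r => f (S'.core r), fun x => S'.label (ρ x), ?_, ?_, ?_, ?_, ?_, ?_, S'.edge_base⟩,
    hf.inj, fun _ => rfl, fun x => by simp only [h1]⟩
  · exact hf.inj.comp S'.core_inj
  · intro r; rw [← hf.rot, S'.rot_core]
  · intro r
    rw [← hf.isOver _ (S'.isCrossing_core hR r), S'.isOver_core]
  · intro r; rw [h1, S'.label_core]
  · intro x
    by_cases e1 : x = p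
    · rw [e1, ← h2, h1]
    by_cases e2 : x = F.rot p
    · rw [e2, ← h3, h1]
    obtain ⟨x, rfl⟩ := hf.exists_eq e1 e2
    by_cases e3 : F.edge (f x) = p
    · rw [e3, h1, hf.inj (h2.trans (hF.edge_eq_iff.1 e3).symm)]
    by_cases e4 : F.edge (f x) = F.rot p
    · rw [e4, h1, hf.inj (h3.trans (hF.edge_eq_iff.1 e4).symm)]
    rw [← hf.edge_other x e3 e4, h1, h1, S'.label_edge]
  · intro x hx
    by_cases e1 : x = p
    · rw [e1, hl]
    by_cases e2 : x = F.rot p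
    · rw [e2, hp, hl]
    obtain ⟨x, rfl⟩ := hf.exists_eq e1 e2
    rw [← hf.rot, h1, h1, S'.label_rot]
    rintro ⟨r, rfl⟩
    exact hx ⟨r, rfl⟩

theorem exists_of_isoAt (S : Decomp R e F) {f : F'.Dart → F.Dart} (hf : IsoAt F' F f)
    (hR : IsBase R e) : ∃ S' : Decomp R e F', Compat S S' f := by
  have : ∀ r, ∃ x, f x = S.core r := fun r => hf.bij.2 _
  choose g hg using this
  refine ⟨⟨g, fun x => S.label (f x), ?_, ?_, ?_, ?_, ?_, ?_, S.edge_base⟩, hf.bij.1, hg,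
    fun _ => rfl⟩
  · exact fun r s h => S.core_inj (by rw [← hg, ← hg, h])
  · exact fun r => hf.bij.1 (by rw [hf.rot, hg, hg, S.rot_core])
  · intro r
    rw [← hf.isOver, hg, S.isOver_core]
    rw [hf.isCrossing_iff, hg]
    exact S.isCrossing_core hR r
  · intro r; rw [hg, S.label_core]
  · intro x; rw [hf.edge, S.label_edge]
  · intro x hx
    rw [hf.rot, S.label_rot]
    rintro ⟨r, hr⟩
    exact hx ⟨r, hf.bij.1 ((hg r).trans hr)⟩

theorem exists_of_isoAt' (S' : Decomp R e F') {f : F'.Dart → F.Dart} (hf : IsoAt F' F f)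
    (hR : IsBase R e) : ∃ S : Decomp R e F, Compat S S' f := by
  obtain ⟨ρ, h1, h2⟩ := Function.bijective_iff_has_inverse.1 hf.bij
  refine ⟨⟨fun r => f (S'.core r), fun x => S'.label (ρ x), ?_, ?_, ?_, ?_, ?_, ?_, S'.edge_base⟩,
    hf.bij.1, fun _ => rfl, fun x => by simp only [h1 x]⟩
  · exact hf.bij.1.comp S'.core_inj
  · intro r; rw [← hf.rot, S'.rot_core]
  · intro r
    rw [hf.isOver _ (S'.isCrossing_core hR r), S'.isOver_core]
  · intro r; rw [h1, S'.label_core]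
  · intro x
    obtain ⟨x, rfl⟩ := hf.bij.2 x
    rw [← hf.edge, h1, h1, S'.label_edge]
  · intro x hx
    obtain ⟨x, rfl⟩ := hf.bij.2 x
    rw [← hf.rot, h1, h1, S'.label_rot]
    rintro ⟨r, rfl⟩
    exact hx ⟨r, rfl⟩

/-- A loop at a core crossing would come from an edge of `R` bounding a region on its own. -/
theorem not_mem_of_label_rot (S : Decomp R e F) (hR : IsBase R e) {t : F.Dart}
    (hl : S.label (F.rot t) = S.label t) : t ∉ Set.range S.core := by
  rintro ⟨r, rfl⟩
  rw [S.rot_core, S.label_core, S.label_core, hR.eq_iff] at hl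
  rcases hl with h | h
  · exact hR.isKnot.rot_ne r h.symm
  · have h' : R.edge r = R.rot r := by rw [h, hR.isKnot.edge_edge, ← h]
    exact hR.no_bigon r r h' h'

theorem not_mem_of_kinkAt (S : Decomp R e F) {t : F.Dart} {f : F'.Dart → F.Dart}
    (hf : KinkAt F F' t f) (hR : IsBase R e) : t ∉ Set.range S.core :=
  S.not_mem_of_label_rot hR (by rw [← hf.edge_eq_rot, S.label_edge])

theorem exists_of_kinkAt (S : Decomp R e F) {t : F.Dart} {f : F'.Dart → F.Dart}
    (hf : KinkAt F F' t f) (hR : IsBase R e) :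
    ∃ S' : Decomp R e F', Compat S S' f := by
  have ht := S.not_mem_of_kinkAt hf hR
  have ht1 : F.rot t ∉ Set.range S.core := by rwa [S.rot_mem_range_iff]
  have ht2 : F.rot (F.rot t) ∉ Set.range S.core := by rwa [S.rot_mem_range_iff]
  have ht3 : F.rot (F.rot (F.rot t)) ∉ Set.range S.core := by rwa [S.rot_mem_range_iff]
  have : ∀ r, ∃ x, f x = S.core r := fun r => hf.exists_eq (fun h => ht ⟨r, h⟩)
    (fun h => ht1 ⟨r, h⟩)
  choose g hg using this
  have hg2 : ∀ r, f (g r) ≠ F.rot (F.rot t) := fun r h => ht2 ⟨r, by rw [← hg, h]⟩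
  have hg3 : ∀ r, f (g r) ≠ F.rot (F.rot (F.rot t)) := fun r h => ht3 ⟨r, by rw [← hg, h]⟩
  have hmem : ∀ x, x ∉ Set.range g → f x ∉ Set.range S.core := by
    rintro x hx ⟨r, hr⟩
    exact hx ⟨r, hf.inj ((hg r).trans hr)⟩
  refine ⟨⟨g, fun x => S.label (f x), ?_, ?_, ?_, ?_, ?_, ?_, S.edge_base⟩, hf.inj, hg,
    fun _ => rfl⟩
  · exact fun r s h => S.core_inj (by rw [← hg, ← hg, h])
  · exact fun r => hf.inj (by rw [hf.rot_other _ (hg2 r) (hg3 r), hg, hg, S.rot_core])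
  · intro r
    rw [hf.isOver, hg, S.isOver_core]
    rw [IsCrossing, hf.isPoint_iff (hg2 r) (hg3 r), hg]
    exact S.isCrossing_core hR r
  · intro r; rw [hg, S.label_core]
  · intro x; rw [hf.edge, S.label_edge]
  · intro x hx
    by_cases h2 : f x = F.rot (F.rot t)
    · rw [hf.rot_left x h2, h2, S.label_rot _ ht2]
    by_cases h3 : f x = F.rot (F.rot (F.rot t))
    · rw [hf.rot_right x h3, h3, S.label_rot _ ht2]
    rw [hf.rot_other x h2 h3, S.label_rot _ (hmem x hx)]

open Classical in
/-- The darts of an additional kink inherit their labels from the point at which it is created. -/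
theorem exists_of_kinkAt' (S' : Decomp R e F') {t : F.Dart} {f : F'.Dart → F.Dart}
    (hf : KinkAt F F' t f) (hR : IsBase R e) (hF : F.IsKnot) :
    ∃ S : Decomp R e F, Compat S S' f := by
  obtain ⟨a, b, ha, hb, hab, hba⟩ := hf.exists_point hF
  have hne : Nonempty F'.Dart := ⟨a⟩
  have ha' : a ∉ Set.range S'.core :=
    S'.not_mem_of_isPoint hR (hf.isPoint_of_eq hF (Or.inl ha))
  have hlb : S'.label b = S'.label a := by rw [← hab, S'.label_rot a ha']
  let ρ : F.Dart → F'.Dart := fun x => if x = t ∨ x = F.rot t then a else Function.invFun f x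
  have h1 : ∀ x, ρ (f x) = x := fun x =>
    (if_neg (by simp [hf.ne_left, hf.ne_right])).trans (Function.leftInverse_invFun hf.inj x)
  have h2 : ρ t = a := if_pos (Or.inl rfl)
  have h3 : ρ (F.rot t) = a := if_pos (Or.inr rfl)
  have hc2 : ∀ r, f (S'.core r) ≠ F.rot (F.rot t) := fun r h =>
    S'.isCrossing_core hR r (hf.isPoint_of_eq hF (Or.inl h))
  have hc3 : ∀ r, f (S'.core r) ≠ F.rot (F.rot (F.rot t)) := fun r h =>
    S'.isCrossing_core hR r (hf.isPoint_of_eq hF (Or.inr h))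
  refine ⟨⟨fun r => f (S'.core r), fun x => S'.label (ρ x), ?_, ?_, ?_, ?_, ?_, ?_, S'.edge_base⟩,
    hf.inj, fun _ => rfl, fun x => by simp only [h1]⟩
  · exact hf.inj.comp S'.core_inj
  · intro r; rw [← hf.rot_other _ (hc2 r) (hc3 r), S'.rot_core]
  · intro r
    rw [← hf.isOver _ (S'.isCrossing_core hR r), S'.isOver_core]
  · intro r; rw [h1, S'.label_core]
  · intro x
    by_cases e1 : x = t
    · rw [e1, hf.edge_eq_rot, h2, h3]
    by_cases e2 : x = F.rot t
    · rw [e2, hf.edge_rot hF, h2, h3]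
    obtain ⟨x, rfl⟩ := hf.exists_eq e1 e2
    rw [← hf.edge, h1, h1, S'.label_edge]
  · intro x hx
    by_cases e1 : x = t
    · rw [e1, h2, h3]
    by_cases e2 : x = F.rot t
    · rw [e2, ← ha, h1, h3]
    obtain ⟨x, rfl⟩ := hf.exists_eq e1 e2
    have hx' : x ∉ Set.range S'.core := by
      rintro ⟨r, rfl⟩
      exact hx ⟨r, rfl⟩
    by_cases e3 : f x = F.rot (F.rot t)
    · rw [h1, e3, ← hb, h1, hlb, hf.inj (e3.trans ha.symm)]
    by_cases e4 : f x = F.rot (F.rot (F.rot t))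
    · rw [h1, e4, hF.rot_four, h2, hf.inj (e4.trans hb.symm), hlb]
    rw [← hf.rot_other x e3 e4, h1, h1, S'.label_rot x hx']

end Decomp

end CurveMap

namespace CurveMap

namespace Decomp

variable {R F F' : CurveMap} {L : Type} {e : R.Dart → L}

theorem rot_rot_rot_val_of_not_mem (S : Decomp R e F) {r : R.Dart} {x : (S.tangle r).Dart}
    (hx : x.1 ∉ Set.range S.core) :
    ((S.tangle r).rot ((S.tangle r).rot ((S.tangle r).rot x))).1 = F.rot (F.rot (F.rot x.1)) := by
  have h := S.rot_val_of_not_mem hx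
  rw [S.rot_rot_val_of_not_mem, h]
  rwa [h, rot_mem_range_iff]

theorem sameCycle_iff_of_not_mem (S : Decomp R e F) (hF : F.IsKnot) {r : R.Dart}
    {x y : (S.tangle r).Dart} (hx : x.1 ∉ Set.range S.core) :
    (S.tangle r).rot.SameCycle x y ↔ F.rot.SameCycle x.1 y.1 := by
  constructor
  · intro h
    refine (h.mem_of_forward_closed {z | z.1 ∉ Set.range S.core ∧ F.rot.SameCycle x.1 z.1}
      ⟨hx, .refl _ _⟩ ?_).2
    rintro z ⟨h1, h2⟩
    constructor
    · rwa [S.rot_val, S.turn_mem_range_iff]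
    · rw [S.rot_val_of_not_mem h1]
      exact h2.apply_right
  · intro h
    rcases mem_four_of_sameCycle (hF.rot_four _) h with h | h | h | h
    · rw [show y = x from Subtype.ext h]
    · rw [show y = (S.tangle r).rot x from Subtype.ext (h.trans (S.rot_val_of_not_mem hx).symm)]
      simp [Equiv.Perm.SameCycle.refl]
    · rw [show y = (S.tangle r).rot ((S.tangle r).rot x) from
        Subtype.ext (h.trans (S.rot_rot_val_of_not_mem hx).symm)]
      simp [Equiv.Perm.SameCycle.refl]
    · rw [show y = (S.tangle r).rot ((S.tangle r).rot ((S.tangle r).rot x)) from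
        Subtype.ext (h.trans (S.rot_rot_rot_val_of_not_mem hx).symm)]
      simp [Equiv.Perm.SameCycle.refl]

variable {t : Fin 3 → F.Dart} {π : F.Dart → F.Dart} {f : F.Dart ≃ F'.Dart}

theorem label_rot_corner (S : Decomp R e F) (hf : TripleAt F F' t π f) (k : Fin 3) :
    S.label (F.rot (t (k + 1))) = S.label (t k) := by
  rw [← hf.edge_corner, S.label_edge]

/-- A triangle in which some corners are core crossings and some are not would come from a region
of `R` with at most two edges. -/
theorem corner_not_mem (S : Decomp R e F) (hf : TripleAt F F' t π f) (hR : IsBase R e)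
    (hno : ¬ ∀ k, t k ∈ Set.range S.core) (k : Fin 3) : t k ∉ Set.range S.core := by
  intro hk
  -- Going around the triangle, there is a change from a corner outside the core to one in the core.
  obtain ⟨l, h0, h1⟩ : ∃ l, t l ∉ Set.range S.core ∧ t (l + 1) ∈ Set.range S.core := by
    by_contra hc
    push Not at hc hno
    obtain ⟨l, hl⟩ := hno
    have : ∀ k l : Fin 3, k = l ∨ k = l + 1 ∨ k = l + 1 + 1 := by decide
    rcases this k l with rfl | rfl | rfl
    · exact hl hk
    · exact hc _ hl hk
    · exact hc _ (hc _ hl) hk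
  have e0 := S.label_rot_corner hf l
  have e1 := S.label_rot_corner hf (l + 1)
  have e2 := S.label_rot_corner hf (l + 1 + 1)
  rw [fin_three_add] at e2
  have e3 := S.label_rot _ h0
  -- If two corners are core crossings, the two edges of `R` between them bound a bigon; if only one is,
  -- both sides at this corner belong to the same edge of `R`.
  by_cases h2 : t (l + 1 + 1) ∈ Set.range S.core
  · have hne := hf.not_sameCycle (l + 1) (l + 1 + 1) (by
      have : ∀ l : Fin 3, l + 1 ≠ l + 1 + 1 := by decide
      exact this l)
    obtain ⟨a, ha⟩ := h1
    obtain ⟨b, hb⟩ := h2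
    rw [← ha, ← hb, S.rot_core, S.label_core, S.label_core, eq_comm, hR.eq_iff] at e1
    rw [← e3, e2, ← hb, ← ha, S.rot_core, S.label_core, S.label_core, eq_comm, hR.eq_iff] at e0
    have e1' : R.edge a = R.rot b := by
      refine (e1.resolve_left fun h => hne ?_).symm
      rw [← ha, ← h, ← hb, ← S.rot_core]
      exact (Equiv.Perm.SameCycle.refl _ _).apply_left
    have e0' : R.edge b = R.rot a := by
      refine (e0.resolve_left fun h => hne ?_).symm
      rw [← hb, ← h, ← ha, ← S.rot_core]
      exact (Equiv.Perm.SameCycle.refl _ _).apply_right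
    exact hR.no_bigon a b e1' e0'
  · refine S.not_mem_of_label_rot hR ?_ h1
    rw [e0, ← e3, e2, ← S.label_rot _ h2, e1]

theorem label_corner (S : Decomp R e F) (hf : TripleAt F F' t π f)
    (hk : ∀ k, t k ∉ Set.range S.core) (k : Fin 3) : S.label (t k) = S.label (t 0) := by
  have h : ∀ k, S.label (t (k + 1)) = S.label (t k) := fun k =>
    (S.label_rot _ (hk (k + 1))).symm.trans (S.label_rot_corner hf k)
  fin_cases k
  · rfl
  · exact h 0
  · exact (h 1).trans (h 0)

theorem label_of_sameCycle (S : Decomp R e F) {x y : F.Dart} (hx : x ∉ Set.range S.core)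
    (h : F.rot.SameCycle x y) : y ∉ Set.range S.core ∧ S.label y = S.label x := by
  refine h.mem_of_forward_closed {z | z ∉ Set.range S.core ∧ S.label z = S.label x}
    ⟨hx, rfl⟩ ?_
  rintro z ⟨h1, h2⟩
  exact ⟨by rwa [S.rot_mem_range_iff], (S.label_rot _ h1).trans h2⟩

/-- All darts at the three corners have the same label, so changing the attachment within these
corners respects labels. -/
theorem label_perm (S : Decomp R e F) (hf : TripleAt F F' t π f) (hF : F.IsKnot)
    (hk : ∀ k, t k ∉ Set.range S.core) (x : F.Dart) : S.label (π x) = S.label x := by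
  have h0 := S.label_corner hf hk
  have h1 : ∀ k, S.label (F.rot (t k)) = S.label (t 0) := fun k =>
    (S.label_rot _ (hk k)).trans (h0 k)
  have h2 : ∀ k, S.label (F.rot (F.rot (t k))) = S.label (t 0) := fun k =>
    (S.label_rot _ (by rw [S.rot_mem_range_iff]; exact hk k)).trans (h1 k)
  have h3 : ∀ k, S.label (F.rot (F.rot (F.rot (t k)))) = S.label (t 0) := fun k =>
    (S.label_rot _ (by rw [S.rot_mem_range_iff, S.rot_mem_range_iff]; exact hk k)).trans (h2 k)
  rcases TripleAt.corner_cases hF t x with ⟨k, rfl⟩ | ⟨k, rfl⟩ | ⟨k, rfl⟩ | ⟨k, rfl⟩ | hx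
  · rw [(hf.perm k).1, h3, h0 k]
  · rw [(hf.perm k).2.2.2, h2, h1]
  · rw [(hf.perm k).2.2.1, h1, h2]
  · rw [(hf.perm k).2.1, h0, h3]
  · rw [hf.perm_other x hx]

theorem not_sameCycle_core (S : Decomp R e F) (hk : ∀ k, t k ∉ Set.range S.core) (r : R.Dart)
    (k : Fin 3) : ¬ F.rot.SameCycle (t k) (S.core r) := fun h =>
  (S.label_of_sameCycle (hk k) h).1 ⟨r, rfl⟩

/-- If no corner of the triangle is a core crossing, the move takes place within a single tangle. -/
theorem exists_of_tripleAt (S : Decomp R e F) (hf : TripleAt F F' t π f) (hR : IsBase R e)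
    (hF : F.IsKnot) (hk : ∀ k, t k ∉ Set.range S.core) :
    ∃ S' : Decomp R e F', Compat S S' f.symm ∧ ∀ r,
      ((S.tangle r).Unknot (S.tip r) ↔ (S'.tangle r).Unknot (S'.tip r)) := by
  let S' : Decomp R e F' := by
    refine ⟨fun r => f (S.core r), fun y => S.label (f.symm y), f.injective.comp S.core_inj, ?_,
      ?_, ?_, ?_, ?_, S.edge_base⟩
    · intro r; rw [hf.rot, S.rot_core]
    · intro r; rw [hf.isOver _ (S.isCrossing_core hR r), S.isOver_core]
    · intro r; rw [Equiv.symm_apply_apply, S.label_core]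
    · intro y
      obtain ⟨x, rfl⟩ := f.surjective y
      rw [← hf.perm_perm hF x, hf.edge]
      simp only [Equiv.symm_apply_apply]
      rw [S.label_perm hf hF hk, S.label_edge, hf.perm_perm hF, S.label_perm hf hF hk]
    · intro y hy
      obtain ⟨x, rfl⟩ := f.surjective y
      rw [hf.rot]
      simp only [Equiv.symm_apply_apply]
      refine S.label_rot x ?_
      rintro ⟨r, rfl⟩
      exact hy ⟨r, rfl⟩
  have hc : Compat S S' f.symm :=
    ⟨f.symm.injective, fun r => f.symm_apply_apply _, fun _ => rfl⟩
  refine ⟨S', hc, fun r => ?_⟩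
  have hl0 := S.label_corner hf hk
  -- Either the move takes place within the tangle of `r`, or it does not affect this tangle.
  by_cases htr : S.label (t 0) = e r
  · let q : Fin 3 → (S.tangle r).Dart := fun k => ⟨t k, (hl0 k).trans htr⟩
    have r1 : ∀ k, ((S.tangle r).rot (q k)).1 = F.rot (t k) := fun k =>
      S.rot_val_of_not_mem (hk k)
    have r2 : ∀ k, ((S.tangle r).rot ((S.tangle r).rot (q k))).1 = F.rot (F.rot (t k)) :=
      fun k => S.rot_rot_val_of_not_mem (hk k)
    have r3 : ∀ k, ((S.tangle r).rot ((S.tangle r).rot ((S.tangle r).rot (q k)))).1 =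
      F.rot (F.rot (F.rot (t k))) := fun k => S.rot_rot_rot_val_of_not_mem (hk k)
    let π' : (S.tangle r).Dart → (S.tangle r).Dart := fun x =>
      ⟨π x.1, (S.label_perm hf hF hk x.1).trans x.2⟩
    let f' : (S.tangle r).Dart ≃ (S'.tangle r).Dart := f.subtypeEquiv fun x => by
      change _ ↔ S.label (f.symm (f x)) = e r
      rw [Equiv.symm_apply_apply]
    have sc : ∀ k (x : (S.tangle r).Dart),
        (S.tangle r).rot.SameCycle (q k) x ↔ F.rot.SameCycle (t k) x.1 := fun k x =>
      S.sameCycle_iff_of_not_mem hF (hk k)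
    have hT : TripleAt (S.tangle r) (S'.tangle r) q π' f' := by
      refine ⟨fun k => (S.isCrossing_iff hR _).2 ⟨hk k, hf.crossing k⟩, ?_, ?_, hf.not_cyclic,
        ?_, ?_, ?_, ?_, ?_⟩
      · intro k l hkl
        rw [sc]
        exact hf.not_sameCycle k l hkl
      · exact fun k => Subtype.ext ((hf.edge_corner k).trans (r1 _).symm)
      · intro k
        obtain ⟨p1, p2, p3, p4⟩ := hf.perm k
        exact ⟨Subtype.ext (p1.trans (r3 _).symm),
          Subtype.ext ((congrArg π (r3 (k + 1))).trans p2),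
          Subtype.ext ((congrArg π (r2 k)).trans (p3.trans (r1 _).symm)),
          Subtype.ext ((congrArg π (r1 (k + 1))).trans (p4.trans (r2 k).symm))⟩
      · intro x hx
        refine Subtype.ext (hf.perm_other x.1 fun k h => hx k ((sc k x).2 h))
      · exact fun x => Subtype.ext (hf.edge x.1)
      · intro x
        refine Subtype.ext (Eq.symm ?_)
        have := hc.map_turn (x := f x.1) (fun _ => by rw [hf.rot]; simp)
        rw [Equiv.symm_apply_apply, Equiv.symm_apply_eq] at this
        exact this.symm
      · exact fun x hx => hf.isOver x.1 ((S.isCrossing_iff hR x).1 hx).2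
    have hns := S.not_sameCycle_core hk r
    rw [hT.unknot_iff (S.isKnot_tangle hR hF r) (c := S.tip r) ?_]
    · have : f' (π' (S.tip r)) = S'.tip r := Subtype.ext (congrArg f (hf.perm_other _ hns))
      rw [this]
    · exact TripleAt.outside_of_not_sameCycle fun k h => hns k ((sc k _).1 h)
  · have hF' := hf.isKnot hF
    have hns : ∀ x, S.label x = e r → ∀ k, ¬ F.rot.SameCycle (t k) x := fun x hx k h =>
      htr (by rw [← hl0 k, ← (S.label_of_sameCycle (hk k) h).2, hx])
    refine (hc.unknot_iff_of_bij hR hF hF' r (fun y _ => ⟨f y, f.symm_apply_apply y⟩) ?_ ?_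
      ?_).symm
    · intro y hy
      obtain ⟨x, rfl⟩ := f.surjective y
      have hx : S.label x = e r := by rw [← hy, ← hc.label, Equiv.symm_apply_apply]
      have h1 := hf.edge x
      rw [hf.perm_other x (hns x hx),
        hf.perm_other _ (hns _ (by rw [S.label_edge, hx]))] at h1
      rw [h1]; simp
    · intro y _ _
      obtain ⟨x, rfl⟩ := f.surjective y
      rw [hf.rot]; simp
    · intro y _ hy
      obtain ⟨x, rfl⟩ := f.surjective y
      rw [Equiv.symm_apply_apply, hf.isOver]
      exact (hf.isCrossing_iff x).1 hy

end Decomp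

end CurveMap

/-! ### The invariant -/

namespace KnotDiagram

open CurveMap

variable {R : CurveMap} {L : Type} {e : R.Dart → L} {o : R.Face}

/-- The diagram `F` arises from `R`, with unbounded region `o`, by replacing every edge by an
unknotted tangle. -/
def Tangled (R : CurveMap) {L : Type} (e : R.Dart → L) (o : R.Face) (F : KnotDiagram) : Prop :=
  ∃ S : Decomp R e F.toCurveMap, (∃ r, R.faceOf r = o ∧ F.faceOf (S.core r) = F.outer) ∧
    ∀ r, (S.tangle r).Unknot (S.tip r)

theorem Tangled.of_iso (hR : IsBase R e) {F F' : KnotDiagram} (h : Iso F' F) :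
    Tangled R e o F ↔ Tangled R e o F' := by
  obtain ⟨f, h1, h2, h3, x, h4, h5⟩ := h
  have hf : IsoAt F'.toCurveMap F.toCurveMap f := ⟨f.bijective, h1, h2, h3⟩
  have houter : ∀ y, F.faceOf (f y) = F.outer ↔ F'.faceOf y = F'.outer := fun y => by
    rw [← h4, ← h5, hf.faceOf_eq_iff]
  have key : ∀ {S : Decomp R e F.toCurveMap} {S' : Decomp R e F'.toCurveMap},
      Decomp.Compat S S' f → ∀ r, (S'.tangle r).Unknot (S'.tip r) ↔
        (S.tangle r).Unknot (S.tip r) := fun hc r =>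
    hc.unknot_iff_of_bij hR F.isKnot F'.isKnot r (fun y _ => f.surjective y) (fun x _ => h1 x)
      (fun x _ _ => h2 x) (fun x _ hx => h3 x hx)
  constructor
  · rintro ⟨S, ⟨r, ho, hr⟩, hu⟩
    obtain ⟨S', hc⟩ := S.exists_of_isoAt hf hR
    exact ⟨S', ⟨r, ho, by rw [← houter, hc.core, hr]⟩, fun r => (key hc r).2 (hu r)⟩
  · rintro ⟨S', ⟨r, ho, hr⟩, hu⟩
    obtain ⟨S, hc⟩ := S'.exists_of_isoAt' hf hR
    exact ⟨S, ⟨r, ho, by rw [← hc.core, houter, hr]⟩, fun r => (key hc r).1 (hu r)⟩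

theorem Forget.forgetAt {F F' : KnotDiagram} (h : Forget F F') :
    ∃ p f, ForgetAt F.toCurveMap F'.toCurveMap p f ∧
      ∀ y, F.faceOf (f y) = F.outer ↔ F'.faceOf y = F'.outer := by
  obtain ⟨p, f, h1, h2, h3, h4, h5, h6, h7, h8, h9, x, h10, h11⟩ := h
  have hf : ForgetAt F.toCurveMap F'.toCurveMap p f := ⟨h1, h2, h3, h4, h5, h6, h7, h8, h9⟩
  exact ⟨p, f, hf, fun y => by rw [← h10, ← h11, hf.faceOf_eq_iff F.isKnot]⟩

theorem Tangled.of_forget (hR : IsBase R e) {F F' : KnotDiagram} (h : Forget F F') :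
    Tangled R e o F ↔ Tangled R e o F' := by
  obtain ⟨p, f, hf, houter⟩ := h.forgetAt
  constructor
  · rintro ⟨S, ⟨r, ho, hr⟩, hu⟩
    obtain ⟨S', hc⟩ := S.exists_of_forgetAt hf hR F.isKnot
    exact ⟨S', ⟨r, ho, by rw [← houter, hc.core, hr]⟩,
      fun r => (hc.unknot_iff_of_forgetAt hf hR F.isKnot r).2 (hu r)⟩
  · rintro ⟨S', ⟨r, ho, hr⟩, hu⟩
    obtain ⟨S, hc⟩ := S'.exists_of_forgetAt' hf hR F.isKnot
    exact ⟨S, ⟨r, ho, by rw [← hc.core, houter, hr]⟩,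
      fun r => (hc.unknot_iff_of_forgetAt hf hR F.isKnot r).1 (hu r)⟩

theorem Tangled.of_planarIsotopic (hR : IsBase R e) {F F' : KnotDiagram}
    (h : PlanarIsotopic F F') : Tangled R e o F ↔ Tangled R e o F' := by
  induction h with
  | rel a b h => exact h.elim (fun h => (of_iso hR h).symm) (of_forget hR)
  | refl => rfl
  | symm a b _ ih => exact ih.symm
  | trans a b c _ _ ih1 ih2 => exact ih1.trans ih2

theorem Tangled.of_removeKink (hR : IsBase R e) {F F' : KnotDiagram} (h : RemoveKink F F') :
    Tangled R e o F ↔ Tangled R e o F' := by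
  obtain ⟨t, f, h1, h2, -, h3, h4, h5, h6, h7, h8, h9, x, h10, h11⟩ := h
  have hf : KinkAt F.toCurveMap F'.toCurveMap t f := ⟨h1, h2, h3, h4, h5, h6, h7, h8, h9⟩
  have houter : ∀ y, F.faceOf (f y) = F.outer ↔ F'.faceOf y = F'.outer := fun y => by
    rw [← h10, ← h11, hf.faceOf_eq_iff F.isKnot]
  constructor
  · rintro ⟨S, ⟨r, ho, hr⟩, hu⟩
    obtain ⟨S', hc⟩ := S.exists_of_kinkAt hf hR
    exact ⟨S', ⟨r, ho, by rw [← houter, hc.core, hr]⟩, fun r =>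
      (hc.unknot_iff_of_kinkAt hf (S.not_mem_of_kinkAt hf hR) hR F.isKnot F'.isKnot r).2 (hu r)⟩
  · rintro ⟨S', ⟨r, ho, hr⟩, hu⟩
    obtain ⟨S, hc⟩ := S'.exists_of_kinkAt' hf hR F.isKnot
    exact ⟨S, ⟨r, ho, by rw [← hc.core, houter, hr]⟩, fun r =>
      (hc.unknot_iff_of_kinkAt hf (S.not_mem_of_kinkAt hf hR) hR F.isKnot F'.isKnot r).1 (hu r)⟩

theorem Tangled.of_tripleAt (hR : IsBase R e)
    (hno : ∀ t : Fin 3 → R.Dart, (∀ k l, k ≠ l → ¬ R.rot.SameCycle (t k) (t l)) →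
      (∀ k, R.edge (t k) = R.rot (t (k + 1))) →
      ¬ (R.isOver (t 0) = R.isOver (t 1) ∧ R.isOver (t 1) = R.isOver (t 2)) → R.faceOf (t 0) = o)
    {F F' : KnotDiagram} {t : Fin 3 → F.Dart} {π : F.Dart → F.Dart} {f : F.Dart ≃ F'.Dart}
    (hf : TripleAt F.toCurveMap F'.toCurveMap t π f) (h0 : F.faceOf (t 0) ≠ F.outer)
    (houter : ∀ y, TripleAt.Outside t y →
      (F.faceOf y = F.outer ↔ F'.faceOf (f (π y)) = F'.outer)) (h : Tangled R e o F) :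
    Tangled R e o F' := by
  obtain ⟨S, ⟨r, ho, hr⟩, hu⟩ := h
  -- If all corners are core crossings, their triangle is a region of `R`, which admits no move.
  have hmem : ¬ ∀ k, t k ∈ Set.range S.core := by
    intro hk
    choose a ha using hk
    have hne : ∀ k l, k ≠ l → ¬ R.rot.SameCycle (a k) (a l) := by
      intro k l hkl hc
      refine hf.not_sameCycle k l hkl ?_
      rw [← ha, ← ha]
      exact (sameCycle_map S.core S.core_inj S.rot_core).2 hc
    have hedge : ∀ k, R.edge (a k) = R.rot (a (k + 1)) := by
      intro k
      have hl := S.label_rot_corner hf k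
      rw [← ha, ← ha, S.rot_core, S.label_core, S.label_core, eq_comm, hR.eq_iff] at hl
      refine (hl.resolve_left fun hk => ?_).symm
      have h3 : ∀ k : Fin 3, k ≠ k + 1 := by decide
      refine hne k (k + 1) (h3 k) ?_
      rw [← hk]
      exact (Equiv.Perm.SameCycle.refl _ _).apply_left
    have hface := hno a hne hedge (by simpa only [← ha, S.isOver_core] using hf.not_cyclic)
    -- The triangle of `R` would be its unbounded region, so that of `F` would be unbounded, too.
    obtain ⟨k, rfl⟩ : ∃ k, r = a k := by
      refine (faceOf_eq.1 (hface.trans ho.symm)).mem_of_forward_closed {z | ∃ k, z = a k}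
        ⟨0, rfl⟩ ?_
      rintro _ ⟨k, rfl⟩
      exact ⟨k + 1, by rw [next_apply, hedge, Equiv.symm_apply_apply]⟩
    rw [ha, hf.faceOf_corner] at hr
    exact h0 hr
  have hk := S.corner_not_mem hf hR hmem
  obtain ⟨S', hc, hS'⟩ := S.exists_of_tripleAt hf hR F.isKnot hk
  refine ⟨S', ⟨r, ho, ?_⟩, fun r => (hS' r).1 (hu r)⟩
  have hns := S.not_sameCycle_core hk r
  rw [houter _ (TripleAt.outside_of_not_sameCycle hns), hf.perm_other _ hns, ← hc.core,
    Equiv.apply_symm_apply] at hr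
  exact hr

theorem Tangled.of_tripleMove (hR : IsBase R e)
    (hno : ∀ t : Fin 3 → R.Dart, (∀ k l, k ≠ l → ¬ R.rot.SameCycle (t k) (t l)) →
      (∀ k, R.edge (t k) = R.rot (t (k + 1))) →
      ¬ (R.isOver (t 0) = R.isOver (t 1) ∧ R.isOver (t 1) = R.isOver (t 2)) → R.faceOf (t 0) = o)
    {F F' : KnotDiagram} (h : TripleMove F F') : Tangled R e o F ↔ Tangled R e o F' := by
  obtain ⟨t, π, f, h1, h2, h3, h4, h5, h6, h7, h8, h9, h10, x, h11, h12, h13⟩ := h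
  have hf : TripleAt F.toCurveMap F'.toCurveMap t π f := ⟨h1, h2, h3, h4, h6, h7, h8, h9, h10⟩
  have hF := F.isKnot
  have houter : ∀ y, TripleAt.Outside t y →
      (F.faceOf y = F.outer ↔ F'.faceOf (f (π y)) = F'.outer) := fun y hy => by
    rw [← h12, ← h13, hf.faceOf_eq_iff hF hy h11]
  refine ⟨of_tripleAt hR hno hf h5 houter, of_tripleAt hR hno (hf.symm hF) ?_ ?_⟩
  · rw [← h13]
    exact (hf.symm hF).faceOf_ne ((hf.outside_symm_iff hF x).2 h11)
  · intro y hy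
    obtain ⟨z, rfl⟩ : ∃ z, f (π z) = y := ⟨π (f.symm y), by simp [hf.perm_perm hF]⟩
    rw [Equiv.symm_apply_apply, Equiv.symm_apply_apply, hf.perm_perm hF,
      houter z ((hf.outside_symm_iff hF z).1 hy)]

/-- No Reidemeister sequence without `Ω₂`-moves leaves the class of diagrams that arise from `R` by
replacing edges by unknotted tangles. -/
theorem Tangled.of_independent (hR : IsBase R e)
    (hno : ∀ t : Fin 3 → R.Dart, (∀ k l, k ≠ l → ¬ R.rot.SameCycle (t k) (t l)) →
      (∀ k, R.edge (t k) = R.rot (t (k + 1))) →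
      ¬ (R.isOver (t 0) = R.isOver (t 1) ∧ R.isOver (t 1) = R.isOver (t 2)) → R.faceOf (t 0) = o)
    {F F' : KnotDiagram} (h : Independent 2 F F') (hF : Tangled R e o F) : Tangled R e o F' := by
  induction h with
  | refl => exact hF
  | tail _ h ih =>
    rcases h with h | ⟨m, hm, h⟩
    · exact (of_planarIsotopic hR h).1 ih
    · match m, h with
      | 1, h =>
        exact h.elim (fun h => (of_removeKink hR h).1 ih) (fun h => (of_removeKink hR h).2 ih)
      | 2, h => exact absurd rfl hm
      | 3, h =>
        exact h.elim (fun h => (of_tripleMove hR hno h).1 ih)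
          (fun h => (of_tripleMove hR hno h).2 ih)

end KnotDiagram

namespace KnotDiagram

open CurveMap

theorem ofMap_eq (D : KnotDiagram) {o : D.Face} (h : o = D.outer) :
    ofMap D.toCurveMap D.isKnot D.isPlanar o = D := by
  subst h; rfl

/-! ### The given diagram -/

/-- A bigon or a monogon of the reduction would be a polygon of `D` with at most two edges. -/
theorem isBase_of_isReduction {D : KnotDiagram}
    (h_gon : ∀ F : D.Face, ¬ D.IsGon 0 F ∧ ¬ D.IsGon 1 F ∧ ¬ D.IsGon 2 F)
    {R : CurveMap} {ι : R.Dart → D.Dart} (hR : R.IsKnot)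
    (hι : IsReduction D.toCurveMap R ι) : IsBase R fun r => D.edgeOf (ι r) := by
  refine ⟨hR, hι.isCrossing, hι.edgeOf_eq_iff, ?_⟩
  intro r s h1 h2
  have hsub : D.edgesOn (D.faceOf (ι r)) ⊆ {D.edgeOf (ι r), D.edgeOf (ι s)} := by
    rintro _ ⟨x, hx, rfl⟩
    obtain ⟨r', h3, h4⟩ := hι.exists_same_face_edge x
    have h5 : r' = r ∨ r' = s := by
      refine (faceOf_eq.1 ((hι.faceOf_eq_iff r r').2 (h3.trans hx).symm)).mem_of_forward_closed
        {z | z = r ∨ z = s} (Or.inl rfl) ?_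
      rintro _ (rfl | rfl)
      · right; rw [next_apply, h1, Equiv.symm_apply_apply]
      · left; rw [next_apply, h2, Equiv.symm_apply_apply]
    rw [← h4]
    rcases h5 with rfl | rfl
    · exact Or.inl rfl
    · exact Or.inr rfl
  have hle : (D.edgesOn (D.faceOf (ι r))).ncard ≤ 2 :=
    (Set.ncard_le_ncard hsub (Set.toFinite _)).trans 
      ((Set.ncard_insert_le _ _).trans (by rw [Set.ncard_singleton]))
  have hpos : 0 < (D.edgesOn (D.faceOf (ι r))).ncard := by
    rw [Set.ncard_pos ((Set.toFinite _).subset hsub)]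
    exact ⟨_, ι r, rfl, rfl⟩
  have hx : ∃ x, D.IsCrossing x := ⟨ι r, hι.crossing r⟩
  obtain ⟨-, n1, n2⟩ := h_gon (D.faceOf (ι r))
  have h1' : (D.edgesOn (D.faceOf (ι r))).ncard ≠ 1 := fun h => n1 (Or.inr ⟨hx, h⟩)
  have h2' : (D.edgesOn (D.faceOf (ι r))).ncard ≠ 2 := fun h => n2 (Or.inr ⟨hx, h⟩)
  omega

/-- A diagram that does not admit a triple point move even after a planar isotopy has no suitable
triangle, except possibly for the unbounded region. -/
theorem faceOf_triangle_eq_outer {D : KnotDiagram}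
    (h_triple : ∀ D₁ D₂ : KnotDiagram, D.PlanarIsotopic D₁ → ¬ IsMove 3 D₁ D₂)
    (hc : ∀ x, D.IsCrossing x) (t : Fin 3 → D.Dart)
    (h1 : ∀ k l, k ≠ l → ¬ D.rot.SameCycle (t k) (t l))
    (h2 : ∀ k, D.edge (t k) = D.rot (t (k + 1)))
    (h3 : ¬ (D.isOver (t 0) = D.isOver (t 1) ∧ D.isOver (t 1) = D.isOver (t 2))) :
    D.faceOf (t 0) = D.outer := by
  by_contra hne
  obtain ⟨M', π, f, hf⟩ := D.isKnot.exists_tripleAt t (fun k => hc _) h1 h2 h3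
  have := (not_congr (hf.missing_face D.isKnot D.outer)).1 (fun h => hne h.symm)
  push Not at this
  obtain ⟨⟨c, hc⟩, hco⟩ := this
  have hm := hf.tripleMove (hM := D.isKnot) (hM' := hf.isKnot D.isKnot) (hp := D.isPlanar)
    (hp' := (hf.isPlanar_iff D.isKnot).1 D.isPlanar) hc
  rw [ofMap_eq D hco] at hm
  exact h_triple _ _ (.refl _) (Or.inl hm)

/-- Replacing all edges by trivial tangles. -/
theorem tangled_self {D : KnotDiagram} {L : Type} {e : D.Dart → L}
    (hD : IsBase D.toCurveMap e) : Tangled D.toCurveMap e D.outer D := by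
  let S : Decomp D.toCurveMap e D.toCurveMap :=
    { core := id
      label := e
      core_inj := Function.injective_id
      rot_core := fun _ => rfl
      isOver_core := fun _ => rfl
      label_core := fun _ => rfl
      label_edge := fun x => ((hD.eq_iff _ _).2 (Or.inr rfl)).symm
      label_rot := fun x hx => absurd ⟨x, rfl⟩ hx
      edge_base := fun x => ((hD.eq_iff _ _).2 (Or.inr rfl)).symm }
  obtain ⟨r₀, hr₀⟩ := faceOf_surj D.outer
  refine ⟨S, ⟨r₀, hr₀, hr₀⟩, fun r => ?_⟩
  have hT := S.isKnot_tangle hD D.isKnot r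
  have hcr : ∀ x, ¬ (S.tangle r).IsCrossing x := fun x hx =>
    ((S.isCrossing_iff hD x).1 hx).1 ⟨x.1, rfl⟩
  have hnext : ∀ x, (S.tangle r).next x = x := by
    intro x
    rw [next_apply, Equiv.symm_apply_eq]
    exact Subtype.ext (S.turn_core x.1).symm
  have hface : Nat.card (S.tangle r).Face = 2 := by
    have : Nat.card (S.tangle r).Dart = Nat.card (S.tangle r).Face := by
      refine Nat.card_eq_of_bijective (S.tangle r).faceOf ⟨fun x y h => ?_, faceOf_surj⟩
      exact (faceOf_eq.1 h).eq_of_left (hnext x)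
    rw [← this, Nat.card_eq_two_iff]
    refine ⟨S.tip r, (S.tangle r).edge (S.tip r), (hT.edge_ne _).symm, ?_⟩
    ext x
    simp only [Set.mem_insert_iff, Set.mem_singleton_iff, Set.mem_univ, iff_true]
    exact ((hD.eq_iff _ _).1 x.2.symm).imp (fun h => Subtype.ext h) (fun h => Subtype.ext h)
  have hp : (S.tangle r).IsPlanar := by
    have : IsEmpty {x // (S.tangle r).IsCrossing x} := ⟨fun x => hcr x.1 x.2⟩
    rw [hT.isPlanar_iff, hface, Nat.card_of_isEmpty]
  exact ⟨hT, hp, _, .refl, hcr⟩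

end KnotDiagram

/-! ### From a decomposition to tangles in the edges -/

namespace CurveMap

/-- Data for replacing the edges of `D` by the tangles of a decomposition of `F`: `R` is the
reduction of `D`, and `x` chooses an end of every edge of `D`. -/
structure Gluing (D R F : CurveMap) (ι : R.Dart → D.Dart) where
  isKnot_left : D.IsKnot
  isKnot_right : F.IsKnot
  isReduction : IsReduction D R ι
  isBase : IsBase R fun r => D.edgeOf (ι r)
  decomp : Decomp R (fun r => D.edgeOf (ι r)) F
  /-- an end of an edge -/
  x : D.Edge → R.Dart
  edgeOf_x : ∀ ε, D.edgeOf (ι (x ε)) = ε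

namespace Gluing

variable {D R F : CurveMap} {ι : R.Dart → D.Dart} (G : Gluing D R F ι)

/-- The dart of `D` at the chosen end of an edge; the tangle is inserted next to it. -/
def a (ε : D.Edge) : D.Dart := ι (G.x ε)

/-- The dart of `F` at the chosen end of an edge. -/
def c (ε : D.Edge) : F.Dart := G.decomp.core (G.x ε)

theorem edgeOf_a (ε : D.Edge) : D.edgeOf (G.a ε) = ε := G.edgeOf_x ε

theorem label_c (ε : D.Edge) : G.decomp.label (G.c ε) = ε :=
  (G.decomp.label_core _).trans (G.edgeOf_x ε)

open Classical in
/-- The pairing of half-edges after cutting every edge of `D` next to `a` and every closed tangle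
next to `c`, and joining the ends. -/
noncomputable def edgeFun : D.Dart ⊕ F.Dart → D.Dart ⊕ F.Dart
  | .inl d =>
    if d = G.a (D.edgeOf d) then .inr (F.edge (G.c (D.edgeOf d)))
    else if d = D.edge (G.a (D.edgeOf d)) then .inr (G.c (D.edgeOf d))
    else .inl (D.edge d)
  | .inr y =>
    if y = G.c (G.decomp.label y) then .inl (D.edge (G.a (G.decomp.label y)))
    else if y = F.edge (G.c (G.decomp.label y)) then .inl (G.a (G.decomp.label y))
    else .inr (F.edge y)

theorem edgeFun_a (ε : D.Edge) : G.edgeFun (.inl (G.a ε)) = .inr (F.edge (G.c ε)) := by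
  simp only [edgeFun, G.edgeOf_a, if_true]

theorem edgeFun_edge_a (ε : D.Edge) : G.edgeFun (.inl (D.edge (G.a ε))) = .inr (G.c ε) := by
  have : D.edge (G.a ε) ≠ G.a (D.edgeOf (D.edge (G.a ε))) := by
    rw [edgeOf_edge, edgeOf_a]; exact G.isKnot_left.edge_ne _
  simp only [edgeFun, if_neg this]
  simp only [edgeOf_edge, G.edgeOf_a, if_true]

theorem edgeFun_c (ε : D.Edge) : G.edgeFun (.inr (G.c ε)) = .inl (D.edge (G.a ε)) := by
  simp only [edgeFun, G.label_c, if_true]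

theorem edgeFun_edge_c (ε : D.Edge) : G.edgeFun (.inr (F.edge (G.c ε))) = .inl (G.a ε) := by
  have : F.edge (G.c ε) ≠ G.c (G.decomp.label (F.edge (G.c ε))) := by
    rw [G.decomp.label_edge, label_c]; exact G.isKnot_right.edge_ne _
  simp only [edgeFun, if_neg this]
  simp only [G.decomp.label_edge, G.label_c, if_true]

theorem edgeFun_inl {d : D.Dart} (h1 : ∀ ε, d ≠ G.a ε) (h2 : ∀ ε, d ≠ D.edge (G.a ε)) :
    G.edgeFun (.inl d) = .inl (D.edge d) := by
  simp only [edgeFun, if_neg (h1 _), if_neg (h2 _)]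

theorem edgeFun_inr {y : F.Dart} (h1 : ∀ ε, y ≠ G.c ε) (h2 : ∀ ε, y ≠ F.edge (G.c ε)) :
    G.edgeFun (.inr y) = .inr (F.edge y) := by
  simp only [edgeFun, if_neg (h1 _), if_neg (h2 _)]

theorem cases_inl (d : D.Dart) : (∃ ε, d = G.a ε) ∨ (∃ ε, d = D.edge (G.a ε)) ∨
    ((∀ ε, d ≠ G.a ε) ∧ ∀ ε, d ≠ D.edge (G.a ε)) := by
  by_cases h1 : ∃ ε, d = G.a ε
  · exact Or.inl h1
  by_cases h2 : ∃ ε, d = D.edge (G.a ε)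
  · exact Or.inr (Or.inl h2)
  exact Or.inr (Or.inr ⟨not_exists.1 h1, not_exists.1 h2⟩)

theorem cases_inr (y : F.Dart) : (∃ ε, y = G.c ε) ∨ (∃ ε, y = F.edge (G.c ε)) ∨
    ((∀ ε, y ≠ G.c ε) ∧ ∀ ε, y ≠ F.edge (G.c ε)) := by
  by_cases h1 : ∃ ε, y = G.c ε
  · exact Or.inl h1
  by_cases h2 : ∃ ε, y = F.edge (G.c ε)
  · exact Or.inr (Or.inl h2)
  exact Or.inr (Or.inr ⟨not_exists.1 h1, not_exists.1 h2⟩)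

theorem edgeFun_involutive : Function.Involutive G.edgeFun := by
  have hD := G.isKnot_left
  have hF := G.isKnot_right
  rintro (d | y)
  · rcases G.cases_inl d with ⟨ε, rfl⟩ | ⟨ε, rfl⟩ | ⟨h1, h2⟩
    · rw [edgeFun_a, edgeFun_edge_c]
    · rw [edgeFun_edge_a, edgeFun_c]
    · rw [G.edgeFun_inl h1 h2, edgeFun_inl, hD.edge_edge]
      · exact fun ε h => h2 ε (hD.edge_eq_iff.1 h)
      · exact fun ε h => h1 ε (D.edge.injective h)
  · rcases G.cases_inr y with ⟨ε, rfl⟩ | ⟨ε, rfl⟩ | ⟨h1, h2⟩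
    · rw [edgeFun_c, edgeFun_edge_a]
    · rw [edgeFun_edge_c, edgeFun_a]
    · rw [G.edgeFun_inr h1 h2, edgeFun_inr, hF.edge_edge]
      · exact fun ε h => h2 ε (hF.edge_eq_iff.1 h)
      · exact fun ε h => h1 ε (F.edge.injective h)

theorem edgeFun_ne (z : D.Dart ⊕ F.Dart) : G.edgeFun z ≠ z := by
  rcases z with d | y
  · rcases G.cases_inl d with ⟨ε, rfl⟩ | ⟨ε, rfl⟩ | ⟨h1, h2⟩
    · rw [edgeFun_a]; simp
    · rw [edgeFun_edge_a]; simp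
    · rw [G.edgeFun_inl h1 h2]
      exact fun h => G.isKnot_left.edge_ne _ (Sum.inl_injective h)
  · rcases G.cases_inr y with ⟨ε, rfl⟩ | ⟨ε, rfl⟩ | ⟨h1, h2⟩
    · rw [edgeFun_c]; simp
    · rw [edgeFun_edge_c]; simp
    · rw [G.edgeFun_inr h1 h2]
      exact fun h => G.isKnot_right.edge_ne _ (Sum.inr_injective h)

/-- The diagram obtained from `D` by replacing its edges by the tangles. -/
noncomputable def map : CurveMap where
  Dart := D.Dart ⊕ F.Dart
  finite := inferInstance
  edge := G.edgeFun_involutive.toPerm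
  rot := Equiv.sumCongr D.rot G.decomp.turn
  isOver := Sum.elim D.isOver F.isOver

theorem isPoint_inl (d : D.Dart) : G.map.IsPoint (.inl d) ↔ D.IsPoint d := Sum.inl_injective.eq_iff

theorem turn_turn_eq_iff (y : F.Dart) : G.decomp.turn (G.decomp.turn y) = y ↔
    (y ∈ Set.range G.decomp.core ∨ F.IsPoint y) := by
  by_cases hy : y ∈ Set.range G.decomp.core
  · obtain ⟨r, rfl⟩ := hy
    refine iff_of_true ?_ (Or.inl ⟨r, rfl⟩)
    rw [G.decomp.turn_core, G.decomp.turn_core, G.isBase.isKnot.edge_edge]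
  · have : F.rot y ∉ Set.range G.decomp.core := by rwa [G.decomp.rot_mem_range_iff]
    rw [G.decomp.turn_of_not_mem hy, G.decomp.turn_of_not_mem this]
    exact ⟨Or.inr, fun h => h.resolve_left hy⟩

theorem isPoint_inr (y : F.Dart) :
    G.map.IsPoint (.inr y) ↔ (y ∈ Set.range G.decomp.core ∨ F.IsPoint y) :=
  Sum.inr_injective.eq_iff.trans (G.turn_turn_eq_iff y)

open Classical in
/-- The diagram `F` sits inside the glued diagram, its core becoming `D`. -/
noncomputable def embed (y : F.Dart) : D.Dart ⊕ F.Dart :=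
  if h : ∃ r, G.decomp.core r = y then .inl (ι h.choose) else .inr y

theorem embed_core (r : R.Dart) : G.embed (G.decomp.core r) = .inl (ι r) := by
  have h : ∃ s, G.decomp.core s = G.decomp.core r := ⟨r, rfl⟩
  exact (dif_pos h).trans (by rw [G.decomp.core_inj h.choose_spec])

theorem embed_of_not_mem {y : F.Dart} (hy : y ∉ Set.range G.decomp.core) : G.embed y = .inr y :=
  dif_neg hy

/-- What is left of an edge of `D` when it is cut next to `a` still hangs together. -/
theorem edgeOf_inl {d : D.Dart} (hd : d ≠ G.a (D.edgeOf d)) :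
    G.map.edgeOf (.inl d) = G.map.edgeOf (.inl (D.edge (G.a (D.edgeOf d)))) := by
  have hD := G.isKnot_left
  set ε := D.edgeOf d with hε
  have hca : D.IsCrossing (G.a ε) := G.isReduction.crossing _
  -- Walking along the edge from `a`, the cut is passed only at the first step.
  let Q : D.Dart → Prop := fun z => z = G.a ε ∨ (D.edgeOf z = ε ∧
    G.map.edgeOf (.inl z) = G.map.edgeOf (.inl (D.edge (G.a ε))))
  have hQe : ∀ z, Q z → Q (D.edge z) := by
    rintro z (rfl | ⟨h1, h2⟩)
    · exact Or.inr ⟨by rw [edgeOf_edge, edgeOf_a], rfl⟩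
    · by_cases h3 : z = D.edge (G.a ε)
      · exact Or.inl (by rw [h3, hD.edge_edge])
      by_cases h4 : z = G.a ε
      · exact Or.inr ⟨by rw [edgeOf_edge, h1], by rw [h4]⟩
      refine Or.inr ⟨by rw [edgeOf_edge, h1], ?_⟩
      rw [← h2, ← edgeOf_edge (M := G.map) (.inl z)]
      refine congrArg _ (G.edgeFun_inl (fun ε' h => h4 ?_) (fun ε' h => h3 ?_)).symm
      · rw [h, ← h1, h, G.edgeOf_a]
      · rw [h, ← h1, h, edgeOf_edge, G.edgeOf_a]
  have hQr : ∀ z, D.IsPoint z → Q z → Q (D.rot z) := by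
    rintro z hz (rfl | ⟨h1, h2⟩)
    · exact absurd hz hca
    · refine Or.inr ⟨by rw [edgeOf_rot hz, h1], ?_⟩
      rw [← h2]
      exact edgeOf_rot (M := G.map) ((G.isPoint_inl z).2 hz)
  have hQ : Q d := by
    have h := eq_of_edgeOf_eq (M := D) Q
      (fun z => propext ⟨fun h => hD.edge_edge z ▸ hQe _ h, hQe z⟩)
      (fun z hz => propext ⟨fun h => by
        have h' := hQr _ hz.rot h
        rwa [show D.rot (D.rot z) = z from hz] at h', hQr z hz⟩)
      (x := G.a ε) (y := d) (by rw [edgeOf_a])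
    rw [← h]
    exact Or.inl rfl
  exact (hQ.resolve_left hd).2

/-- At the far end of an edge of `D`, the core dart of `F` and the dart of `D` that stands for it lie
on the same edge of the glued diagram. -/
theorem edgeOf_embed_other (r : R.Dart) (hr : r ≠ G.x (D.edgeOf (ι r))) :
    G.map.edgeOf (.inl (ι r)) = G.map.edgeOf (.inr (G.decomp.core r)) := by
  set ε := D.edgeOf (ι r) with hε
  have h1 : ι r ≠ G.a (D.edgeOf (ι r)) := fun h => hr (G.isReduction.inj h)
  have h2 : r = R.edge (G.x ε) := by
    have : D.edgeOf (ι (G.x ε)) = D.edgeOf (ι r) := by rw [G.edgeOf_x]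
    exact ((G.isReduction.edgeOf_eq_iff _ _).1 this).resolve_left hr
  have h3 : G.map.edge (.inl (D.edge (G.a ε))) = .inr (G.c ε) := G.edgeFun_edge_a ε
  have h4 : G.map.rot (.inr (G.c ε)) = .inr (G.decomp.core r) := by
    rw [h2]; exact congrArg Sum.inr (G.decomp.turn_core _)
  refine (G.edgeOf_inl h1).trans ((edgeOf_edge (M := G.map) _).symm.trans ?_)
  refine (congrArg G.map.edgeOf h3).trans (Eq.trans ?_ (congrArg G.map.edgeOf h4))
  exact (edgeOf_rot ((G.isPoint_inr _).2 (Or.inl ⟨_, rfl⟩))).symm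

/-- The embedding of `F` maps edges into edges, although it does not respect segments at the places
where tangles and edges of `D` have been joined. -/
theorem edgeOf_embed_edge (y : F.Dart) :
    G.map.edgeOf (G.embed (F.edge y)) = G.map.edgeOf (G.embed y) := by
  have hF := G.isKnot_right
  -- It suffices to consider an end of a tangle and the half-edge attached to it.
  have key : ∀ r, G.map.edgeOf (G.embed (F.edge (G.decomp.core r))) =
      G.map.edgeOf (.inl (ι r)) := by
    intro r
    set ε := D.edgeOf (ι r) with hε
    have tail : ∀ r, r ≠ G.x (D.edgeOf (ι r)) → F.edge (G.decomp.core r) ∉ Set.range G.decomp.core →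
        G.map.edgeOf (.inr (F.edge (G.decomp.core r))) = G.map.edgeOf (.inl (ι r)) := by
      intro r hr hy
      rw [G.edgeOf_embed_other r hr, ← edgeOf_edge (M := G.map) (.inr (G.decomp.core r))]
      refine congrArg _ (G.edgeFun_inr (fun ε' h => hr ?_) fun ε' h => hy ?_).symm
      · have h' := G.decomp.core_inj h
        rw [h', G.edgeOf_x]
      · rw [h, hF.edge_edge]; exact ⟨_, rfl⟩
    by_cases hr : r = G.x ε
    · have h1 : G.map.edge (.inl (ι r)) = .inr (F.edge (G.decomp.core r)) := by
        rw [hr]; exact G.edgeFun_a ε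
      rw [← edgeOf_edge (M := G.map) (.inl (ι r)), h1]
      by_cases hy : F.edge (G.decomp.core r) ∈ Set.range G.decomp.core
      · obtain ⟨s, hs⟩ := hy
        have hl : D.edgeOf (ι s) = ε := by
          have := G.decomp.label_edge (G.decomp.core r)
          rwa [← hs, G.decomp.label_core, G.decomp.label_core] at this
        rw [← hs, G.embed_core, G.edgeOf_embed_other]
        rw [hl, ← hr]
        rintro rfl
        exact hF.edge_ne _ hs.symm
      · rw [G.embed_of_not_mem hy]
    · by_cases hy : F.edge (G.decomp.core r) ∈ Set.range G.decomp.core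
      · obtain ⟨s, hs⟩ := hy
        have hl : D.edgeOf (ι s) = ε := by
          have := G.decomp.label_edge (G.decomp.core r)
          rwa [← hs, G.decomp.label_core, G.decomp.label_core] at this
        have hsx : s = G.x ε := by
          have h1 : s ≠ r := by rintro rfl; exact hF.edge_ne _ hs.symm
          have h2 := (G.isReduction.edgeOf_eq_iff r s).1 hl.symm
          have h3 := (G.isReduction.edgeOf_eq_iff r (G.x ε)).1 (by rw [G.edgeOf_x])
          rw [h2.resolve_left h1, h3.resolve_left (Ne.symm hr)]
        have h1 : G.map.edge (.inl (ι s)) = .inr (G.decomp.core r) := by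
          rw [hsx]
          refine (G.edgeFun_a ε).trans (congrArg Sum.inr ?_)
          rw [c, ← hsx, hs, hF.edge_edge]
        rw [← hs, G.embed_core, G.edgeOf_embed_other r hr, ← h1]
        exact (edgeOf_edge (M := G.map) _).symm
      · rw [G.embed_of_not_mem hy, tail r hr hy]
  by_cases hy : y ∈ Set.range G.decomp.core
  · obtain ⟨r, rfl⟩ := hy
    rw [key, G.embed_core]
  by_cases hy' : F.edge y ∈ Set.range G.decomp.core
  · obtain ⟨r, hr⟩ := hy'
    have := key r
    rw [hr, hF.edge_edge] at this
    rw [this, ← hr, G.embed_core]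
  · rw [G.embed_of_not_mem hy, G.embed_of_not_mem hy', ← edgeOf_edge (M := G.map) (.inr y)]
    refine congrArg _ (G.edgeFun_inr (fun ε' h => hy ?_) fun ε' h => hy' ?_).symm
    · exact h ▸ ⟨_, rfl⟩
    · rw [h, hF.edge_edge]; exact ⟨_, rfl⟩

theorem embed_rot (y : F.Dart) : G.embed (F.rot y) = G.map.rot (G.embed y) := by
  by_cases hy : y ∈ Set.range G.decomp.core
  · obtain ⟨r, rfl⟩ := hy
    rw [G.decomp.rot_core, G.embed_core, G.embed_core, G.isReduction.rot]
    rfl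
  · rw [G.embed_of_not_mem hy, G.embed_of_not_mem (by rwa [G.decomp.rot_mem_range_iff])]
    exact congrArg Sum.inr (G.decomp.turn_of_not_mem hy).symm

theorem embed_injective : Function.Injective G.embed := by
  intro y z h
  by_cases hy : y ∈ Set.range G.decomp.core <;> by_cases hz : z ∈ Set.range G.decomp.core
  · obtain ⟨r, rfl⟩ := hy
    obtain ⟨s, rfl⟩ := hz
    rw [G.embed_core, G.embed_core] at h
    rw [G.isReduction.inj (Sum.inl_injective h)]
  · obtain ⟨r, rfl⟩ := hy
    rw [G.embed_core, G.embed_of_not_mem hz] at h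
    exact absurd h (by simp)
  · obtain ⟨r, rfl⟩ := hz
    rw [G.embed_core, G.embed_of_not_mem hy] at h
    exact absurd h (by simp)
  · rw [G.embed_of_not_mem hy, G.embed_of_not_mem hz] at h
    exact Sum.inr_injective h

theorem isPoint_embed (y : F.Dart) : G.map.IsPoint (G.embed y) ↔ F.IsPoint y := by
  unfold IsPoint
  rw [← G.embed_rot, ← G.embed_rot]
  exact G.embed_injective.eq_iff

/-- Every edge of the glued diagram contains darts of `F`, because the remaining darts lie at marked
points. -/
theorem exists_embed_edgeOf (z : D.Dart ⊕ F.Dart) :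
    ∃ y, G.map.edgeOf (G.embed y) = G.map.edgeOf z := by
  have core : ∀ r, ∃ y, G.map.edgeOf (G.embed y) = G.map.edgeOf (.inr (G.decomp.core r)) := by
    have other : ∀ r, r ≠ G.x (D.edgeOf (ι r)) →
        ∃ y, G.map.edgeOf (G.embed y) = G.map.edgeOf (.inr (G.decomp.core r)) := fun r hr =>
      ⟨G.decomp.core r, by rw [G.embed_core, G.edgeOf_embed_other r hr]⟩
    intro r
    by_cases hr : r = G.x (D.edgeOf (ι r))
    · have h1 : G.map.rot (.inr (G.decomp.core r)) = .inr (G.decomp.core (R.edge r)) :=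
        congrArg Sum.inr (G.decomp.turn_core _)
      obtain ⟨y, hy⟩ := other (R.edge r) (by
        rw [G.isReduction.edgeOf_edge, ← hr]; exact G.isBase.isKnot.edge_ne r)
      refine ⟨y, ?_⟩
      rw [hy, ← h1, edgeOf_rot ((G.isPoint_inr _).2 (Or.inl ⟨_, rfl⟩))]
    · exact other r hr
  rcases z with d | y
  · set ε := D.edgeOf d with hε
    by_cases hd : d = G.a ε
    · exact ⟨G.c ε, by rw [hd]; exact congrArg _ (G.embed_core _)⟩
    · obtain ⟨y, hy⟩ := core (G.x ε)
      refine ⟨y, hy.trans ?_⟩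
      rw [G.edgeOf_inl hd, ← hε, ← edgeOf_edge (M := G.map) (.inl (D.edge (G.a ε)))]
      exact congrArg _ (G.edgeFun_edge_a ε).symm
  · by_cases hy : y ∈ Set.range G.decomp.core
    · obtain ⟨r, rfl⟩ := hy
      exact core r
    · exact ⟨y, by rw [G.embed_of_not_mem hy]⟩

theorem eqvGen_straight_of_edgeOf {M : CurveMap} {x y : M.Dart} (h : M.edgeOf x = M.edgeOf y) :
    Relation.EqvGen M.Straight x y := by
  refine (edgeOf_eq.1 h).mono ?_
  rintro a b (h | h)
  · exact Or.inl h
  · exact Or.inr (Or.inl h)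

theorem isKnot : G.map.IsKnot where
  edge_edge := G.edgeFun_involutive
  edge_ne := G.edgeFun_ne
  rot_ne := by
    rintro (d | y) h
    · exact G.isKnot_left.rot_ne d (Sum.inl_injective h)
    · have h : G.decomp.turn y = y := Sum.inr_injective h
      by_cases hy : y ∈ Set.range G.decomp.core
      · obtain ⟨r, rfl⟩ := hy
        rw [G.decomp.turn_core] at h
        exact G.isBase.isKnot.edge_ne r (G.decomp.core_inj h)
      · rw [G.decomp.turn_of_not_mem hy] at h
        exact G.isKnot_right.rot_ne y h
  rot_four := by
    rintro (d | y)
    · exact congrArg Sum.inl (G.isKnot_left.rot_four d)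
    · refine congrArg Sum.inr (?_ : G.decomp.turn (G.decomp.turn (G.decomp.turn (G.decomp.turn y))) = y)
      by_cases hy : y ∈ Set.range G.decomp.core
      · rw [(G.turn_turn_eq_iff y).2 (Or.inl hy), (G.turn_turn_eq_iff y).2 (Or.inl hy)]
      · have hy1 := mt (G.decomp.rot_mem_range_iff _).1 hy
        have hy2 := mt (G.decomp.rot_mem_range_iff _).1 hy1
        have hy3 := mt (G.decomp.rot_mem_range_iff _).1 hy2
        rw [G.decomp.turn_of_not_mem hy, G.decomp.turn_of_not_mem hy1,
          G.decomp.turn_of_not_mem hy2, G.decomp.turn_of_not_mem hy3, G.isKnot_right.rot_four]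
  isOver_rot := by
    rintro (d | y) h
    · exact G.isKnot_left.isOver_rot d (mt (G.isPoint_inl d).2 h)
    · have h' := mt (G.isPoint_inr y).2 h
      rw [not_or] at h'
      refine Eq.trans ?_ (G.isKnot_right.isOver_rot y h'.2)
      exact congrArg F.isOver (G.decomp.turn_of_not_mem h'.1)
  one_component z z' := by
    obtain ⟨y, hy⟩ := G.exists_embed_edgeOf z
    obtain ⟨y', hy'⟩ := G.exists_embed_edgeOf z'
    refine .trans _ _ _ (eqvGen_straight_of_edgeOf hy.symm)
      (.trans _ _ _ ?_ (eqvGen_straight_of_edgeOf hy'))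
    refine eqvGen_of_kernel G.embed ?_ (G.isKnot_right.one_component y y')
    rintro a b (rfl | ⟨hp, rfl⟩ | ⟨hc, rfl⟩)
    · exact eqvGen_straight_of_edgeOf (G.edgeOf_embed_edge a).symm
    · exact .rel _ _ (Or.inr (Or.inl ⟨(G.isPoint_embed a).2 hp, G.embed_rot a⟩))
    · exact .rel _ _ (Or.inr (Or.inr ⟨mt (G.isPoint_embed a).1 hc,
        by rw [G.embed_rot, G.embed_rot]⟩))

theorem sameCrossings : SameCrossings F G.map G.embed where
  crossing x hx := mt (G.isPoint_embed x).1 hx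
  inj x y _ _ h := G.embed_injective h
  surj := by
    rintro (d | y) hz
    · obtain ⟨r, rfl⟩ := G.isReduction.exists_eq d (mt (G.isPoint_inl d).2 hz)
      exact ⟨_, G.decomp.isCrossing_core G.isBase r, G.embed_core r⟩
    · have h' := mt (G.isPoint_inr y).2 hz
      rw [not_or] at h'
      exact ⟨y, h'.2, G.embed_of_not_mem h'.1⟩
  rot x _ := G.embed_rot x
  isOver x _ := by
    by_cases hx : x ∈ Set.range G.decomp.core
    · obtain ⟨r, rfl⟩ := hx
      rw [G.embed_core, G.decomp.isOver_core, G.isReduction.isOver]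
      rfl
    · rw [G.embed_of_not_mem hx]; rfl
  edgeOf_eq x y _ _ h := eq_of_edgeOf_eq (fun x => G.map.edgeOf (G.embed x)) G.edgeOf_embed_edge
    (fun x hx => by rw [G.embed_rot, edgeOf_rot ((G.isPoint_embed x).2 hx)]) h

end Gluing

end CurveMap

namespace KnotDiagram

open CurveMap

/-- A diagram with a decomposition is planar isotopic to one obtained by replacing edges. -/
theorem Tangled.exists_replaceEdges {D F : KnotDiagram} {R : CurveMap} {ι : R.Dart → D.Dart}
    (hι : IsReduction D.toCurveMap R ι) (hR : IsBase R fun r => D.edgeOf (ι r)) {o : R.Face}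
    (ho : ∀ r, R.faceOf r = o → D.faceOf (ι r) = D.outer)
    (h : Tangled R (fun r => D.edgeOf (ι r)) o F) :
    ∃ (T : D.Edge → Tangle) (E : KnotDiagram),
      (∀ ε, (T ε).IsUnknotted) ∧ D.ReplaceEdges T E ∧ E.PlanarIsotopic F := by
  obtain ⟨S, ⟨r, hr, hrF⟩, hu⟩ := h
  have hx : ∀ ε : D.Edge, ∃ r, D.edgeOf (ι r) = ε := by
    intro ε
    obtain ⟨d, rfl⟩ := edgeOf_surj ε
    exact (hι.exists_same_face_edge d).imp fun _ h => h.2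
  choose x hx using hx
  choose hk hp hU using hu
  let G : Gluing D.toCurveMap R F.toCurveMap ι :=
    ⟨D.isKnot, F.isKnot, hι, hR, S, x, hx⟩
  have hcr := S.isCrossing_core hR r
  have hpl : G.map.IsPlanar :=
    (G.sameCrossings.isPlanar_iff F.isKnot G.isKnot ⟨_, hcr⟩).1 F.isPlanar
  let T : D.Edge → Tangle := fun ε =>
    { closure := ofMap (S.tangle (x ε)) (hk _) (hp _) ((S.tangle (x ε)).faceOf (S.tip (x ε)))
      cut := S.tip (x ε)
      cut_outer := rfl }
  let E : KnotDiagram :=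
    ofMap G.map G.isKnot hpl (G.map.faceOf (G.embed (S.core r)))
  refine ⟨T, E, fun ε => hU _, ?_, ?_⟩
  · refine ⟨G.a, Sum.inl, fun ε b => Sum.inr b.1, hx, ⟨?_, ?_⟩, G.edgeFun_a, G.edgeFun_edge_a,
      ?_, ?_, fun _ => rfl, fun _ _ => rfl, fun _ _ => rfl, fun _ _ _ => rfl, ι r, ho r hr,
      congrArg G.map.faceOf (G.embed_core r).symm⟩
    · rintro (d | ⟨ε, b⟩) (d' | ⟨ε', b'⟩) h
      · exact congrArg Sum.inl (Sum.inl_injective h)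
      · cases h
      · cases h
      · have h1 : b.1 = b'.1 := Sum.inr_injective h
        have h2 : ε = ε' := (b.2.trans (hx ε)).symm.trans ((congrArg S.label h1).trans (b'.2.trans (hx ε')))
        subst h2
        rw [show b = b' from Subtype.ext h1]
    · rintro (d | y)
      · exact ⟨Sum.inl d, rfl⟩
      · exact ⟨Sum.inr ⟨S.label y, ⟨y, (hx _).symm⟩⟩, rfl⟩
    · exact fun d hd => G.edgeFun_inl (fun ε => (hd ε).1) fun ε => (hd ε).2
    · intro ε b h1 h2
      have hl : S.label b.1 = ε := b.2.trans (hx ε)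
      refine G.edgeFun_inr (fun ε' h => h1 (Subtype.ext ?_)) fun ε' h => h2 (Subtype.ext ?_)
      · have : ε' = ε := by rw [← hl, h]; exact (G.label_c ε').symm
        exact h.trans (congrArg G.c this)
      · have : ε' = ε := by
          rw [← hl, h]; exact ((S.label_edge _).trans (G.label_c ε')).symm
        exact h.trans (congrArg (fun ε => F.edge (G.c ε)) this)
  · have := G.sameCrossings.planarIsotopic F.isKnot G.isKnot F.isPlanar hpl hcr
    rw [ofMap_eq F hrF] at this
    exact .symm _ _ this
end KnotDiagram

/-! ### Inserting marked points and crossings into edges -/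

namespace CurveMap

/-- Data for cutting some segments of `M` and attaching a new piece with darts `A`: the darts `a k`
of `M` at the cut segments are joined to the ends `j k` of the new piece, whose other darts are
paired by `σ`. -/
structure Insertion (M : CurveMap) where
  A : Type
  K : Type
  finite : Finite A
  a : K → M.Dart
  j : K → A
  σ : A → A
  rot : Equiv.Perm A
  isOver : A → Bool
  a_inj : Function.Injective a
  j_inj : Function.Injective j
  exists_edge_a : ∀ k, ∃ k', M.edge (a k) = a k'
  σ_σ : ∀ b, (∀ k, b ≠ j k) → σ (σ b) = b
  σ_ne : ∀ b, (∀ k, b ≠ j k) → ∀ k, σ b ≠ j k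

namespace Insertion

variable {M : CurveMap} (I : Insertion M)

open Classical in
/-- The pairing of half-edges after the insertion. -/
noncomputable def edgeFun : M.Dart ⊕ I.A → M.Dart ⊕ I.A
  | .inl d => if h : ∃ k, d = I.a k then .inr (I.j h.choose) else .inl (M.edge d)
  | .inr b => if h : ∃ k, b = I.j k then .inl (I.a h.choose) else .inr (I.σ b)

theorem edgeFun_a (k : I.K) : I.edgeFun (.inl (I.a k)) = .inr (I.j k) := by
  have h : ∃ k', I.a k = I.a k' := ⟨k, rfl⟩
  exact (dif_pos h).trans (by rw [← I.a_inj h.choose_spec])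

theorem edgeFun_j (k : I.K) : I.edgeFun (.inr (I.j k)) = .inl (I.a k) := by
  have h : ∃ k', I.j k = I.j k' := ⟨k, rfl⟩
  exact (dif_pos h).trans (by rw [← I.j_inj h.choose_spec])

theorem edgeFun_inl {d : M.Dart} (h : ∀ k, d ≠ I.a k) : I.edgeFun (.inl d) = .inl (M.edge d) :=
  dif_neg fun ⟨k, hk⟩ => h k hk

theorem edgeFun_inr {b : I.A} (h : ∀ k, b ≠ I.j k) : I.edgeFun (.inr b) = .inr (I.σ b) :=
  dif_neg fun ⟨k, hk⟩ => h k hk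

theorem edgeFun_involutive (hM : M.IsKnot) : Function.Involutive I.edgeFun := by
  rintro (d | b)
  · by_cases h : ∃ k, d = I.a k
    · obtain ⟨k, rfl⟩ := h
      rw [edgeFun_a, edgeFun_j]
    · rw [not_exists] at h
      rw [I.edgeFun_inl h, edgeFun_inl, hM.edge_edge]
      intro k hk
      obtain ⟨k', hk'⟩ := I.exists_edge_a k
      rw [← hk, hM.edge_edge] at hk'
      exact h _ hk'
  · by_cases h : ∃ k, b = I.j k
    · obtain ⟨k, rfl⟩ := h
      rw [edgeFun_j, edgeFun_a]
    · rw [not_exists] at h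
      rw [I.edgeFun_inr h, I.edgeFun_inr (I.σ_ne b h), I.σ_σ b h]

/-- The result of the insertion. -/
noncomputable def map (hM : M.IsKnot) : CurveMap where
  Dart := M.Dart ⊕ I.A
  finite := have := I.finite; inferInstance
  edge := (I.edgeFun_involutive hM).toPerm
  rot := Equiv.sumCongr M.rot I.rot
  isOver := Sum.elim M.isOver I.isOver

variable {I} {hM : M.IsKnot}

theorem isPoint_inl {d : M.Dart} : (I.map hM).IsPoint (.inl d) ↔ M.IsPoint d :=
  Sum.inl_injective.eq_iff

theorem isPoint_inr {b : I.A} : (I.map hM).IsPoint (.inr b) ↔ I.rot (I.rot b) = b :=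
  Sum.inr_injective.eq_iff

theorem next_a (k : I.K) :
    (I.map hM).next (.inl (I.a k)) = .inr (I.rot.symm (I.j k)) := by
  exact congrArg (I.map hM).rot.symm (I.edgeFun_a k)

theorem next_j (k : I.K) :
    (I.map hM).next (.inr (I.j k)) = .inl (M.rot.symm (I.a k)) := by
  exact congrArg (I.map hM).rot.symm (I.edgeFun_j k)

theorem next_inl {d : M.Dart} (h : ∀ k, d ≠ I.a k) :
    (I.map hM).next (.inl d) = .inl (M.next d) := by
  exact congrArg (I.map hM).rot.symm (I.edgeFun_inl h)

theorem next_inr {b : I.A} (h : ∀ k, b ≠ I.j k) :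
    (I.map hM).next (.inr b) = .inr (I.rot.symm (I.σ b)) := by
  exact congrArg (I.map hM).rot.symm (I.edgeFun_inr h)

/-- The insertion is a knot if the strands are still traversed one after the other. -/
theorem isKnot (h1 : ∀ b, I.σ b ≠ b) (h2 : ∀ b, I.rot b ≠ b)
    (h3 : ∀ b, I.rot (I.rot (I.rot (I.rot b))) = b)
    (h4 : ∀ b, I.rot (I.rot b) ≠ b → I.isOver (I.rot b) = !I.isOver b)
    (h5 : ∀ k, Relation.EqvGen (I.map hM).Straight (.inl (I.a k)) (.inl (M.edge (I.a k))))
    (h6 : ∀ b, ∃ d, Relation.EqvGen (I.map hM).Straight (.inl d) (.inr b)) :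
    (I.map hM).IsKnot where
  edge_edge := I.edgeFun_involutive hM
  edge_ne := by
    rintro (d | b)
    · by_cases h : ∃ k, d = I.a k
      · obtain ⟨k, rfl⟩ := h
        exact fun h => by cases (I.edgeFun_a k).symm.trans h
      · exact fun h' => hM.edge_ne d
          (Sum.inl_injective ((I.edgeFun_inl (not_exists.1 h)).symm.trans h'))
    · by_cases h : ∃ k, b = I.j k
      · obtain ⟨k, rfl⟩ := h
        exact fun h => by cases (I.edgeFun_j k).symm.trans h
      · exact fun h' => h1 b (Sum.inr_injective ((I.edgeFun_inr (not_exists.1 h)).symm.trans h'))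
  rot_ne := by
    rintro (d | b) h
    · exact hM.rot_ne d (Sum.inl_injective h)
    · exact h2 b (Sum.inr_injective h)
  rot_four := by
    rintro (d | b)
    · exact congrArg Sum.inl (hM.rot_four d)
    · exact congrArg Sum.inr (h3 b)
  isOver_rot := by
    rintro (d | b) h
    · exact hM.isOver_rot d (mt isPoint_inl.2 h)
    · exact h4 b (mt isPoint_inr.2 h)
  one_component := by
    have key : ∀ d d', Relation.EqvGen (I.map hM).Straight (.inl d) (.inl d') := by
      refine fun d d' => eqvGen_of_kernel (Sum.inl : M.Dart → M.Dart ⊕ I.A) ?_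
        (hM.one_component d d')
      rintro d _ (rfl | ⟨hp, rfl⟩ | ⟨hc, rfl⟩)
      · by_cases h : ∃ k, d = I.a k
        · obtain ⟨k, rfl⟩ := h
          exact h5 k
        · exact .rel _ _ (Or.inl (I.edgeFun_inl (not_exists.1 h)).symm)
      · exact .rel _ _ (Or.inr (Or.inl ⟨isPoint_inl.2 hp, rfl⟩))
      · exact .rel _ _ (Or.inr (Or.inr ⟨mt isPoint_inl.1 hc, rfl⟩))
    have h7 : ∀ z, ∃ d, Relation.EqvGen (I.map hM).Straight (.inl d) z := by
      rintro (d | b)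
      · exact ⟨d, .refl _⟩
      · exact h6 b
    intro z z'
    obtain ⟨d, hd⟩ := h7 z
    obtain ⟨d', hd'⟩ := h7 z'
    exact .trans _ _ _ (.symm _ _ hd) (.trans _ _ _ (key d d') hd')

end Insertion

variable {M : CurveMap}

/-- The four darts at the segments of `z false` and `z true`. -/
def segmentEnd (M : CurveMap) (z : Bool → M.Dart) (k : Bool × Bool) : M.Dart :=
  if k.2 then M.edge (z k.1) else z k.1

theorem segmentEnd_injective (hM : M.IsKnot) {z : Bool → M.Dart}
    (hz : M.edgeOf (z false) ≠ M.edgeOf (z true)) : Function.Injective (segmentEnd M z) := by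
  have h : ∀ k, M.edgeOf (segmentEnd M z k) = M.edgeOf (z k.1) := by
    rintro ⟨c, _ | _⟩
    · rfl
    · exact edgeOf_edge _
  have hc : ∀ c c', M.edgeOf (z c) = M.edgeOf (z c') → c = c' := by
    rintro (_ | _) (_ | _) e
    · rfl
    · exact absurd e hz
    · exact absurd e.symm hz
    · rfl
  rintro ⟨c, b⟩ ⟨c', b'⟩ e
  obtain rfl : c = c' := hc c c' ((h _).symm.trans ((congrArg M.edgeOf e).trans (h _)))
  rcases b with _ | _ <;> rcases b' with _ | _
  · rfl
  · exact absurd e.symm (hM.edge_ne _)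
  · exact absurd e (hM.edge_ne _)
  · rfl

theorem exists_edge_segmentEnd (hM : M.IsKnot) (z : Bool → M.Dart) (k : Bool × Bool) :
    ∃ k', M.edge (segmentEnd M z k) = segmentEnd M z k' := by
  obtain ⟨c, _ | _⟩ := k
  · exact ⟨(c, true), rfl⟩
  · exact ⟨(c, false), hM.edge_edge _⟩

/-- Inserting a marked point into each of two segments. -/
def insertPoints (hM : M.IsKnot) {z : Bool → M.Dart}
    (hz : M.edgeOf (z false) ≠ M.edgeOf (z true)) : Insertion M where
  A := Bool × Bool
  K := Bool × Bool
  finite := inferInstance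
  a := segmentEnd M z
  j := id
  σ k := (k.1, !k.2)
  rot := Equiv.prodCongr (Equiv.refl _) Equiv.boolNot
  isOver _ := false
  a_inj := segmentEnd_injective hM hz
  j_inj := Function.injective_id
  exists_edge_a := exists_edge_segmentEnd hM z
  σ_σ b _ := by simp
  σ_ne b h := absurd rfl (h b)

/-- A quarter turn around two crossings with the darts `(c, i)`, `i : Fin 4`. -/
def quarterTurn : Equiv.Perm (Bool × Fin 4) :=
  Equiv.prodCongr (Equiv.refl _) (Equiv.addRight 1)

/-- The darts at two crossings that form the ends of the strands through a bigon. -/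
def bigonEnd (k : Bool × Bool) : Bool × Fin 4 := if k.2 then (k.1, 2) else (!k.1, 3)

/-- Inserting a bigon between two segments.  Its vertices have the darts `(c, i)` with `c : Bool`,
numbered counterclockwise by `i : Fin 4`, and it lies on the left of `(c, 0)`.  The strand through
`(false, 0)` is the upper one. -/
def insertBigon (hM : M.IsKnot) {z : Bool → M.Dart}
    (hz : M.edgeOf (z false) ≠ M.edgeOf (z true)) : Insertion M where
  A := Bool × Fin 4
  K := Bool × Bool
  finite := inferInstance
  a := segmentEnd M z
  j := bigonEnd
  σ b := (!b.1, 1 - b.2)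
  rot := quarterTurn
  isOver b := b.1 ^^ (b.2 == 0 || b.2 == 2)
  a_inj := segmentEnd_injective hM hz
  j_inj := by decide
  exists_edge_a := exists_edge_segmentEnd hM z
  σ_σ b _ := by simp
  σ_ne := by decide

section

variable (hM : M.IsKnot) {z : Bool → M.Dart} (hz : M.edgeOf (z false) ≠ M.edgeOf (z true))

theorem ne_segmentEnd_of_ne {d : M.Dart} (h : ∀ c, d ≠ z c ∧ d ≠ M.edge (z c)) (k : Bool × Bool) :
    d ≠ segmentEnd M z k := by
  obtain ⟨c, _ | _⟩ := k
  · exact (h c).1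
  · exact (h c).2

theorem segmentEnd_cases (d : M.Dart) :
    (∃ c, d = z c) ∨ (∃ c, d = M.edge (z c)) ∨ ∀ k, d ≠ segmentEnd M z k := by
  by_cases h1 : ∃ c, d = z c
  · exact Or.inl h1
  by_cases h2 : ∃ c, d = M.edge (z c)
  · exact Or.inr (Or.inl h2)
  exact Or.inr (Or.inr (ne_segmentEnd_of_ne fun c => ⟨not_exists.1 h1 c, not_exists.1 h2 c⟩))

/-- The diagram `M` with two additional marked points. -/
noncomputable abbrev pointsMap : CurveMap := (insertPoints hM hz).map hM

/-- The diagram `M` after a move that creates a bigon between two segments. -/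
noncomputable abbrev bigonMap : CurveMap := (insertBigon hM hz).map hM

theorem pointsMap_edge (c : Bool) :
    (pointsMap hM hz).edge (.inl (z c)) = .inr (c, false) :=
  (insertPoints hM hz).edgeFun_a (c, false)

theorem pointsMap_edge' (c : Bool) :
    (pointsMap hM hz).edge (.inr (c, true)) = .inl (M.edge (z c)) :=
  (insertPoints hM hz).edgeFun_j (c, true)

theorem pointsMap_edgeOf_new (c b : Bool) :
    (pointsMap hM hz).edgeOf (.inr (c, b)) = (pointsMap hM hz).edgeOf (.inl (z c)) := by
  have h : (pointsMap hM hz).edgeOf (.inr (c, false)) = (pointsMap hM hz).edgeOf (.inl (z c)) :=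
    (congrArg _ (pointsMap_edge hM hz c).symm).trans (edgeOf_edge _)
  cases b
  · exact h
  · exact (edgeOf_rot (M := pointsMap hM hz) (x := .inr (c, false)) rfl).trans h

theorem pointsMap_edgeOf_edge (d : M.Dart) :
    (pointsMap hM hz).edgeOf (.inl (M.edge d)) = (pointsMap hM hz).edgeOf (.inl d) := by
  have h : ∀ c, (pointsMap hM hz).edgeOf (.inl (M.edge (z c))) =
      (pointsMap hM hz).edgeOf (.inl (z c)) := fun c =>
    ((congrArg _ (pointsMap_edge' hM hz c).symm).trans (edgeOf_edge _)).trans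
      (pointsMap_edgeOf_new hM hz c true)
  rcases segmentEnd_cases (z := z) d with ⟨c, rfl⟩ | ⟨c, rfl⟩ | hd
  · exact h c
  · rw [hM.edge_edge]; exact (h c).symm
  · exact (congrArg _ ((insertPoints hM hz).edgeFun_inl hd).symm).trans
      (edgeOf_edge (M := pointsMap hM hz) (.inl d))

theorem insertPoints_rot_rot (k : Bool × Bool) :
    (insertPoints hM hz).rot ((insertPoints hM hz).rot k) = k :=
  Prod.ext rfl (Bool.not_not k.2)

theorem isKnot_pointsMap : (pointsMap hM hz).IsKnot := by
  refine Insertion.isKnot (fun b h => ?_) (fun b h => ?_) (fun b => ?_)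
    (fun b h => absurd (insertPoints_rot_rot hM hz b) h) (fun k => ?_) ?_
  · exact Bool.not_ne_self b.2 (congrArg Prod.snd h)
  · exact Bool.not_ne_self b.2 (congrArg Prod.snd h)
  · exact (insertPoints_rot_rot hM hz _).trans (insertPoints_rot_rot hM hz b)
  · exact Gluing.eqvGen_straight_of_edgeOf (pointsMap_edgeOf_edge hM hz _).symm
  · rintro ⟨c, b⟩
    exact ⟨z c, Gluing.eqvGen_straight_of_edgeOf (pointsMap_edgeOf_new hM hz c b).symm⟩

theorem sameCrossings_pointsMap : SameCrossings M (pointsMap hM hz) Sum.inl where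
  crossing x hx := mt Insertion.isPoint_inl.1 hx
  inj x y _ _ h := Sum.inl_injective h
  surj := by
    rintro (d | b) h
    · exact ⟨d, mt Insertion.isPoint_inl.2 h, rfl⟩
    · exact absurd (Insertion.isPoint_inr.2 (insertPoints_rot_rot hM hz b)) h
  rot _ _ := rfl
  isOver _ _ := rfl
  edgeOf_eq x y _ _ h := eq_of_edgeOf_eq (fun x => (pointsMap hM hz).edgeOf (.inl x))
    (pointsMap_edgeOf_edge hM hz)
    (fun x hx => edgeOf_rot (M := pointsMap hM hz) (Insertion.isPoint_inl.2 hx)) h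

theorem pointsMap_edgeOf_ne :
    (pointsMap hM hz).edgeOf (.inl (z false)) ≠ (pointsMap hM hz).edgeOf (.inl (z true)) := by
  intro h
  refine hz (eq_of_edgeOf_eq (M := pointsMap hM hz)
    (Sum.elim M.edgeOf fun k => M.edgeOf (z k.1)) ?_ ?_ h)
  · rintro (d | ⟨c, b⟩)
    · rcases segmentEnd_cases (z := z) d with ⟨c, rfl⟩ | ⟨c, rfl⟩ | hd
      · exact congrArg (Sum.elim M.edgeOf fun k => M.edgeOf (z k.1)) (pointsMap_edge hM hz c)
      · refine (congrArg _ ((insertPoints hM hz).edgeFun_a (c, true))).trans ?_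
        exact (edgeOf_edge (z c)).symm
      · exact (congrArg _ ((insertPoints hM hz).edgeFun_inl hd)).trans (edgeOf_edge d)
    · refine (congrArg _ ((insertPoints hM hz).edgeFun_j (c, b))).trans ?_
      cases b
      · rfl
      · exact edgeOf_edge (z c)
  · rintro (d | ⟨c, b⟩) hp
    · exact edgeOf_rot (Insertion.isPoint_inl.1 hp)
    · rfl

theorem bigonMap_edge (c : Bool) : (bigonMap hM hz).edge (.inl (z c)) = .inr (!c, 3) :=
  (insertBigon hM hz).edgeFun_a (c, false)

theorem bigonMap_edge' (c : Bool) :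
    (bigonMap hM hz).edge (.inr (c, 2)) = .inl (M.edge (z c)) :=
  (insertBigon hM hz).edgeFun_j (c, true)

theorem ne_bigon_end (c : Bool) (i : Fin 4) (hi : i = 0 ∨ i = 1) (k : Bool × Bool) :
    (c, i) ≠ (insertBigon hM hz).j k := by
  obtain ⟨c', _ | _⟩ := k <;> rcases hi with rfl | rfl <;>
    simp [insertBigon, bigonEnd]

theorem bigonMap_edge_zero (c : Bool) : (bigonMap hM hz).edge (.inr (c, 0)) = .inr (!c, 1) :=
  (insertBigon hM hz).edgeFun_inr (ne_bigon_end hM hz c 0 (Or.inl rfl))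

theorem bigonMap_edge_one (c : Bool) : (bigonMap hM hz).edge (.inr (c, 1)) = .inr (!c, 0) :=
  (insertBigon hM hz).edgeFun_inr (ne_bigon_end hM hz c 1 (Or.inr rfl))

theorem isCrossing_bigonMap_new (b : Bool × Fin 4) : (bigonMap hM hz).IsCrossing (.inr b) :=
  mt Insertion.isPoint_inr.1 ((by decide : ∀ b, quarterTurn (quarterTurn b) ≠ b) b)

theorem bigonMap_straight (c : Bool) (i : Fin 4) :
    (bigonMap hM hz).Straight (.inr (c, i)) (.inr (c, i + 1 + 1)) :=
  Or.inr (Or.inr ⟨isCrossing_bigonMap_new hM hz _, rfl⟩)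

theorem isKnot_bigonMap : (bigonMap hM hz).IsKnot := by
  have r1 : ∀ c, Relation.EqvGen (bigonMap hM hz).Straight (.inl (z c)) (.inr (!c, 3)) :=
    fun c => .rel _ _ (Or.inl (bigonMap_edge hM hz c).symm)
  have r2 : ∀ c, Relation.EqvGen (bigonMap hM hz).Straight (.inl (z c)) (.inr (!c, 1)) :=
    fun c => .trans _ _ _ (r1 c) (.rel _ _ (bigonMap_straight hM hz (!c) 3))
  have r3 : ∀ c, Relation.EqvGen (bigonMap hM hz).Straight (.inl (z c)) (.inr (c, 0)) := by
    intro c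
    refine .trans _ _ _ (r2 c) (.rel _ _ (Or.inl ?_))
    exact (bigonMap_edge_one hM hz (!c)).symm ▸ by rw [Bool.not_not]
  have r4 : ∀ c, Relation.EqvGen (bigonMap hM hz).Straight (.inl (z c)) (.inr (c, 2)) :=
    fun c => .trans _ _ _ (r3 c) (.rel _ _ (bigonMap_straight hM hz c 0))
  have r5 : ∀ c, Relation.EqvGen (bigonMap hM hz).Straight (.inl (z c)) (.inl (M.edge (z c))) :=
    fun c => .trans _ _ _ (r4 c) (.rel _ _ (Or.inl (bigonMap_edge' hM hz c).symm))
  refine Insertion.isKnot (fun b h => Bool.not_ne_self b.1 (congrArg Prod.fst h))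
    (by decide : ∀ b, quarterTurn b ≠ b)
    (by decide : ∀ b, quarterTurn (quarterTurn (quarterTurn (quarterTurn b))) = b)
    (fun b _ => (by decide : ∀ b : Bool × Fin 4, ((quarterTurn b).1 ^^
      ((quarterTurn b).2 == 0 || (quarterTurn b).2 == 2)) = !(b.1 ^^ (b.2 == 0 || b.2 == 2))) b)
    ?_ ?_
  · rintro ⟨c, _ | _⟩
    · exact r5 c
    · refine .symm _ _ ?_
      have h : M.edge (segmentEnd M z (c, true)) = z c := hM.edge_edge (z c)
      exact (congrArg (fun d => Relation.EqvGen (bigonMap hM hz).Straight (.inl d)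
        (.inl (M.edge (z c)))) h).mpr (r5 c)
  · rintro ⟨c, i⟩
    fin_cases i
    · exact ⟨_, r3 c⟩
    · exact ⟨z (!c), by simpa using r2 (!c)⟩
    · exact ⟨_, r4 c⟩
    · exact ⟨z (!c), by simpa using r1 (!c)⟩

/-! The boundary walks of the new diagram. -/

theorem bigonMap_next (c : Bool) : (bigonMap hM hz).next (.inl (z c)) = .inr (!c, 2) :=
  Insertion.next_a (I := insertBigon hM hz) (c, false)

theorem bigonMap_next' (c : Bool) : (bigonMap hM hz).next (.inl (M.edge (z c))) = .inr (c, 1) :=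
  Insertion.next_a (I := insertBigon hM hz) (c, true)

theorem bigonMap_next_zero (c : Bool) : (bigonMap hM hz).next (.inr (c, 0)) = .inr (!c, 0) :=
  Insertion.next_inr (I := insertBigon hM hz) (ne_bigon_end hM hz c 0 (Or.inl rfl))

theorem bigonMap_next_one (c : Bool) : (bigonMap hM hz).next (.inr (c, 1)) = .inr (!c, 3) :=
  Insertion.next_inr (I := insertBigon hM hz) (ne_bigon_end hM hz c 1 (Or.inr rfl))

theorem bigonMap_next_two (c : Bool) :
    (bigonMap hM hz).next (.inr (c, 2)) = .inl (M.next (z c)) :=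
  Insertion.next_j (I := insertBigon hM hz) (c, true)

theorem bigonMap_next_three (c : Bool) :
    (bigonMap hM hz).next (.inr (!c, 3)) = .inl (M.rot.symm (z c)) :=
  Insertion.next_j (I := insertBigon hM hz) (c, false)

theorem range_ne (y : M.Dart) (b : Bool × Fin 4) :
    (Sum.inr b : M.Dart ⊕ Bool × Fin 4) ∉ Set.range fun d : {d // d ≠ y} => Sum.inl d.1 := by
  rintro ⟨d, hd⟩
  cases hd

theorem eq_of_bigonMap_faceOf_eq_bigon {c : Bool} {w : (bigonMap hM hz).Dart}
    (h : (bigonMap hM hz).faceOf (.inr (c, 0)) = (bigonMap hM hz).faceOf w) :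
    ∃ c, w = .inr (c, 0) := by
  refine (faceOf_eq.1 h).mem_of_forward_closed {w | ∃ c, w = .inr (c, 0)} ⟨c, rfl⟩ ?_
  rintro _ ⟨c, rfl⟩
  exact ⟨!c, bigonMap_next_zero hM hz c⟩

theorem card_crossing_bigonMap : Nat.card {x // (bigonMap hM hz).IsCrossing x} =
    Nat.card {x // M.IsCrossing x} + 8 := by
  rw [card_crossing_add (M := bigonMap hM hz) (M' := M) Sum.inl Sum.inl_injective
    (Set.range (Sum.inr : Bool × Fin 4 → M.Dart ⊕ Bool × Fin 4))]
  · have h8 : (Set.range (Sum.inr : Bool × Fin 4 → M.Dart ⊕ Bool × Fin 4)).ncard = 8 := by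
      rw [← Set.image_univ, Set.ncard_image_of_injective _ Sum.inr_injective, Set.ncard_univ]
      simp
    exact congrArg _ h8
  · rintro (d | b)
    · have : (bigonMap hM hz).IsCrossing (.inl d) ↔ M.IsCrossing d :=
        not_congr Insertion.isPoint_inl
      rw [this]
      refine ⟨fun h => Or.inr ⟨d, h, rfl⟩, ?_⟩
      rintro (⟨b, hb⟩ | ⟨x, hx, h⟩)
      · cases hb
      · exact Sum.inl_injective h ▸ hx
    · exact iff_of_true (isCrossing_bigonMap_new hM hz b) (Or.inl ⟨b, rfl⟩)
  · rintro x - ⟨b, hb⟩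
    cases hb

variable (hn : M.next (z false) = z true)

include hn

open Classical in
/-- When the two segments are consecutive on the boundary of a region, the move cuts the region
in two; away from `z true` the old boundary walks are still there. -/
theorem bigonMap_faceOf_eq_iff (d d' : {d // d ≠ z true}) :
    M.faceOf d.1 = M.faceOf d'.1 ↔
      (bigonMap hM hz).faceOf (.inl d.1) = (bigonMap hM hz).faceOf (.inl d'.1) := by
  have hxy : z false ≠ z true := fun h => hz (by rw [h])
  have h1 : M.next (z true) ≠ z true := fun h => hxy (M.next.injective (hn.trans h.symm))
  let n : {d // d ≠ z true} → {d // d ≠ z true} := fun d =>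
    if h : M.next d.1 = z true then ⟨M.next (z true), h1⟩ else ⟨M.next d.1, h⟩
  have hf : ∀ h, n ⟨z false, h⟩ = ⟨M.next (z true), h1⟩ := fun h => dif_pos hn
  have ho : ∀ d : {d // d ≠ z true}, d.1 ≠ z false → (n d).1 = M.next d.1 := by
    intro d hd
    have : ¬ M.next d.1 = z true := fun h => hd (M.next.injective (h.trans hn.symm))
    simp only [n, dif_neg this]
  refine faceOf_eq_iff_of_returns (M := M) (N := bigonMap hM hz) Subtype.val
    (fun d => Sum.inl d.1) n Subtype.val_injective
    (Sum.inl_injective.comp Subtype.val_injective) ?_ ?_ d d'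
  · rintro ⟨d, hd⟩
    by_cases h : d = z false
    · subst h
      rw [hf]
      exact .skip_eq hn (by simp) (.here_eq rfl ⟨⟨_, h1⟩, rfl⟩)
    · exact .here_eq (ho ⟨d, hd⟩ h).symm ⟨n ⟨d, hd⟩, rfl⟩
  · rintro ⟨d, hd⟩
    by_cases h : d = z false
    · subst h
      rw [hf]
      exact .skip_eq (bigonMap_next hM hz false) (range_ne _ _)
        (.here_eq (bigonMap_next_two hM hz true) ⟨⟨_, h1⟩, rfl⟩)
    · have hnd := ho ⟨d, hd⟩ h
      rcases segmentEnd_cases (z := z) d with ⟨c, rfl⟩ | ⟨c, rfl⟩ | hk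
      · cases c
        · exact absurd rfl h
        · exact absurd rfl hd
      · refine .skip_eq (bigonMap_next' hM hz c) (range_ne _ _) (.skip_eq
          (bigonMap_next_one hM hz c) (range_ne _ _) (.here_eq ?_ ⟨n ⟨_, hd⟩, rfl⟩))
        refine (bigonMap_next_three hM hz c).trans (congrArg Sum.inl ?_)
        rw [hnd, next_apply, hM.edge_edge]
      · exact .here_eq ((Insertion.next_inl hk).trans (congrArg Sum.inl hnd.symm)) ⟨n ⟨d, hd⟩, rfl⟩

/-- The part that is cut off from the old region has just two darts on its boundary. -/
theorem eq_of_bigonMap_faceOf_eq {w : (bigonMap hM hz).Dart}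
    (h : (bigonMap hM hz).faceOf (.inl (z true)) = (bigonMap hM hz).faceOf w) :
    w = .inl (z true) ∨ w = .inr (false, 2) := by
  refine (faceOf_eq.1 h).mem_of_forward_closed
    {w | w = .inl (z true) ∨ w = .inr (false, 2)} (Or.inl rfl) ?_
  rintro _ (rfl | rfl)
  · exact Or.inr (bigonMap_next hM hz true)
  · exact Or.inl ((bigonMap_next_two hM hz false).trans (congrArg Sum.inl hn))

theorem bigonMap_faceOf_cases (w : (bigonMap hM hz).Dart) :
    (bigonMap hM hz).faceOf w = (bigonMap hM hz).faceOf (.inl (z true)) ∨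
    (bigonMap hM hz).faceOf w = (bigonMap hM hz).faceOf (.inr (false, 0)) ∨
    ∃ d : {d // d ≠ z true}, (bigonMap hM hz).faceOf (.inl d.1) = (bigonMap hM hz).faceOf w := by
  have step : ∀ {a b : (bigonMap hM hz).Dart}, (bigonMap hM hz).next a = b →
      (bigonMap hM hz).faceOf b = (bigonMap hM hz).faceOf a := by
    rintro a _ rfl
    exact faceOf_next a
  have hxy : z false ≠ z true := fun h => hz (by rw [h])
  have h1 : M.next (z true) ≠ z true := fun h => hxy (M.next.injective (hn.trans h.symm))
  have h2 : ∀ c, M.edge (z c) ≠ z true := by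
    rintro (_ | _) h
    · exact hz (by rw [← h, edgeOf_edge])
    · exact hM.edge_ne _ h
  rcases w with d | ⟨c, i⟩
  · by_cases hd : d = z true
    · exact Or.inl (by rw [hd])
    · exact Or.inr (Or.inr ⟨⟨d, hd⟩, rfl⟩)
  · fin_cases i
    · cases c
      · exact Or.inr (Or.inl rfl)
      · exact Or.inr (Or.inl (step (bigonMap_next_zero hM hz false)))
    · exact Or.inr (Or.inr ⟨⟨_, h2 c⟩, (step (bigonMap_next' hM hz c)).symm⟩)
    · cases c
      · exact Or.inl (step (bigonMap_next hM hz true))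
      · exact Or.inr (Or.inr ⟨⟨_, h1⟩, step (bigonMap_next_two hM hz true)⟩)
    · refine Or.inr (Or.inr ⟨⟨_, h2 (!c)⟩, ?_⟩)
      have h3 := bigonMap_next_one hM hz (!c)
      rw [Bool.not_not] at h3
      exact (step (bigonMap_next' hM hz (!c))).symm.trans (step h3).symm

theorem card_face_bigonMap : Nat.card (bigonMap hM hz).Face = Nat.card M.Face + 2 := by
  have hxy : z false ≠ z true := fun h => hz (by rw [h])
  have := card_face_add (M := M) (N := bigonMap hM hz)
    (fun d : {d // d ≠ z true} => d.1) (fun d => Sum.inl d.1)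
    (bigonMap_faceOf_eq_iff hM hz hn) ∅
    {(bigonMap hM hz).faceOf (.inl (z true)), (bigonMap hM hz).faceOf (.inr (false, 0))} ?_ ?_
  · rw [Set.ncard_empty, Set.ncard_pair] at this
    · exact this.symm
    · intro h
      obtain ⟨c, hc⟩ := eq_of_bigonMap_faceOf_eq_bigon hM hz h.symm
      cases hc
  · intro F
    simp only [Set.mem_empty_iff_false, false_iff, not_forall, not_not]
    obtain ⟨d, rfl⟩ := faceOf_surj F
    by_cases hd : d = z true
    · exact ⟨⟨z false, hxy⟩,
        (faceOf_next (z false)).symm.trans (congrArg M.faceOf (hn.trans hd.symm))⟩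
    · exact ⟨⟨d, hd⟩, rfl⟩
  · intro F
    obtain ⟨w, rfl⟩ := faceOf_surj F
    constructor
    · rintro (h | h) ⟨d, hd⟩ h'
      · rcases eq_of_bigonMap_faceOf_eq hM hz hn (h'.trans h).symm with h | h
        · exact hd (Sum.inl_injective h)
        · cases h
      · obtain ⟨c, hc⟩ := eq_of_bigonMap_faceOf_eq_bigon hM hz (h'.trans h).symm
        cases hc
    · intro h
      rcases bigonMap_faceOf_cases hM hz hn w with h' | h' | ⟨d, h'⟩
      · exact Or.inl h'
      · exact Or.inr h'
      · exact absurd h' (h d)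

theorem isPlanar_bigonMap (hp : M.IsPlanar) : (bigonMap hM hz).IsPlanar := by
  rw [hM.isPlanar_iff] at hp
  rw [(isKnot_bigonMap hM hz).isPlanar_iff, card_face_bigonMap hM hz hn, card_crossing_bigonMap]
  omega

end

end CurveMap

namespace KnotDiagram

open CurveMap

/-- Two distinct edges that follow each other on the boundary of the unbounded region may be moved
across each other. -/
theorem exists_crossTwoEdges (D : KnotDiagram) {z : Bool → D.Dart}
    (hz : D.edgeOf (z false) ≠ D.edgeOf (z true)) (hn : D.next (z false) = z true)
    (hc : D.IsCrossing (z true)) (ho : D.faceOf (z true) = D.outer) :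
    ∃ D' : KnotDiagram, D.CrossTwoEdges D' := by
  have hM := D.isKnot
  have hs := sameCrossings_pointsMap hM hz
  have h1 := isKnot_pointsMap hM hz
  have h2 := (hs.isPlanar_iff hM h1 ⟨_, hc⟩).1 D.isPlanar
  have hpi := hs.planarIsotopic hM h1 D.isPlanar h2 hc
  rw [ofMap_eq D ho] at hpi
  let D₁ : KnotDiagram := ofMap (pointsMap hM hz) h1 h2 ((pointsMap hM hz).faceOf (.inl (z true)))
  -- The piece at `z true` is cut off, so the unbounded region is now found at `z false`.
  let D' : KnotDiagram := ofMap (bigonMap hM hz) (isKnot_bigonMap hM hz)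
    (isPlanar_bigonMap hM hz hn D.isPlanar) ((bigonMap hM hz).faceOf (.inl (z false)))
  let f : D₁.Dart → D'.Dart := Sum.map id (insertBigon hM hz).j
  have hface : D₁.faceOf (.inl (z false)) = D₁.outer := by
    have e1 : D₁.next (.inl (z false)) = .inr (false, true) :=
      Insertion.next_a (I := insertPoints hM hz) (hM := hM) (false, false)
    have e2 : D₁.next (.inr (false, true)) = .inl (D.next (z false)) :=
      Insertion.next_j (I := insertPoints hM hz) (hM := hM) (false, true)
    rw [hn] at e2
    exact (faceOf_next _).symm.trans ((congrArg _ e1).trans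
      ((faceOf_next _).symm.trans (congrArg _ e2)))
  have hfr : ∀ {x : D₁.Dart} {b : Bool × Fin 4}, f x = .inr b →
      ∃ k : Bool × Bool, x = .inr k ∧ bigonEnd k = b := by
    rintro (d | k) b h
    · cases h
    · exact ⟨k, rfl, Sum.inr_injective h⟩
  have he2 : ∀ c k, bigonEnd k = (c, 2) → k = (c, true) := by decide
  have he3 : ∀ c k, bigonEnd k = (c, 3) → k = (!c, false) := by decide
  have hcyc : ∀ (c : Bool) (i : Fin 4), D'.rot.SameCycle (.inr (c, 0)) (.inr (c, i)) := by
    intro c i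
    refine (sameCycle_iff_iterate _).2 ⟨i.1, ?_⟩
    fin_cases i <;> rfl
  refine ⟨D', D₁, D₁.edgeOf (.inl (z false)), D₁.edgeOf (.inl (z true)), hpi,
    pointsMap_edgeOf_ne hM hz, .inr (false, 0), .inr (true, 0), f,
    isCrossing_bigonMap_new hM hz _, isCrossing_bigonMap_new hM hz _, ?_,
    bigonMap_edge_zero hM hz false, bigonMap_edge_zero hM hz true, rfl, ?_, ?_, ?_, ?_, ?_, ?_, ?_,
    ?_, ?_, ?_, ⟨.inl (z false), hface, rfl⟩,
    ⟨.inr (false, true), rfl, pointsMap_edgeOf_new hM hz false true⟩,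
    ⟨.inr (true, true), rfl, pointsMap_edgeOf_new hM hz true true⟩⟩
  · intro h
    have : ∃ i, (Sum.inr (true, 0) : D.Dart ⊕ Bool × Fin 4) = .inr (false, i) := by
      refine h.mem_of_forward_closed {w : D'.Dart | ∃ i, w = .inr (false, i)} ⟨0, rfl⟩ ?_
      rintro _ ⟨i, rfl⟩
      exact ⟨i + 1, rfl⟩
    obtain ⟨i, hi⟩ := this
    cases hi
  · intro h
    obtain ⟨c, hc⟩ := eq_of_bigonMap_faceOf_eq_bigon hM hz h
    cases hc
  · exact Sum.map_injective.2 ⟨Function.injective_id, (insertBigon hM hz).j_inj⟩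
  · ext (d | b)
    · refine iff_of_true ⟨.inl d, rfl⟩ ?_
      rintro (h | h | h | h) <;> cases h
    · constructor
      · rintro ⟨x, hx⟩
        obtain ⟨k, -, rfl⟩ := hfr hx
        have h0 : ∀ c, bigonEnd k ≠ (c, 0) := fun c => ne_bigon_end hM hz c 0 (Or.inl rfl) k |>.symm
        have h1 : ∀ c, bigonEnd k ≠ (c, 1) := fun c => ne_bigon_end hM hz c 1 (Or.inr rfl) k |>.symm
        rintro (h | h | h | h)
        · exact h0 _ (Sum.inr_injective h)
        · exact h1 _ (Sum.inr_injective h)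
        · exact h0 _ (Sum.inr_injective h)
        · exact h1 _ (Sum.inr_injective h)
      · intro h
        obtain ⟨c, i⟩ := b
        fin_cases i
        · cases c
          · exact absurd (Or.inl rfl) h
          · exact absurd (Or.inr (Or.inr (Or.inl rfl))) h
        · cases c
          · exact absurd (Or.inr (Or.inl rfl)) h
          · exact absurd (Or.inr (Or.inr (Or.inr rfl))) h
        · exact ⟨.inr (c, true), rfl⟩
        · exact ⟨.inr (!c, false), congrArg (fun c => Sum.inr (c, 3)) (Bool.not_not c)⟩
  · rintro (d | k)
    · by_cases h : ∃ k, d = segmentEnd D.toCurveMap z k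
      · obtain ⟨k, rfl⟩ := h
        exact (congrArg f ((insertPoints hM hz).edgeFun_a k)).trans
          ((insertBigon hM hz).edgeFun_a k).symm
      · exact (congrArg f ((insertPoints hM hz).edgeFun_inl (not_exists.1 h))).trans
          ((insertBigon hM hz).edgeFun_inl (not_exists.1 h)).symm
    · exact (congrArg f ((insertPoints hM hz).edgeFun_j k)).trans
        ((insertBigon hM hz).edgeFun_j k).symm
  · intro x hx
    obtain ⟨k, rfl, hk⟩ := hfr hx
    obtain rfl := he2 false k hk
    rfl
  · intro x hx
    obtain ⟨k, rfl, hk⟩ := hfr hx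
    obtain rfl := he3 true k hk
    rfl
  · intro x hx
    obtain ⟨k, rfl, hk⟩ := hfr hx
    obtain rfl := he2 true k hk
    rfl
  · intro x hx
    obtain ⟨k, rfl, hk⟩ := hfr hx
    obtain rfl := he3 false k hk
    rfl
  · rintro (d | ⟨c, b⟩) h1 h2
    · rfl
    · cases c <;> cases b
      · exact absurd (hcyc true 3) h2
      · exact absurd (hcyc false 2) h1
      · exact absurd (hcyc false 3) h1
      · exact absurd (hcyc true 2) h2
  · rintro (d | k) h
    · rfl
    · exact absurd (Insertion.isPoint_inr.2 (insertPoints_rot_rot hM hz k) :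
        (pointsMap hM hz).IsPoint (.inr k)) h

end KnotDiagram

/-! ### Loops -/

/-- A permutation without fixed points and with half as many cycles as elements is an involution. -/
theorem Equiv.Perm.apply_apply_of_card_le {X : Type*} [Finite X] (p : Equiv.Perm X)
    (h : ∀ x, p x ≠ x) (hc : Nat.card X ≤ 2 * Nat.card (Quotient (Equiv.Perm.SameCycle.setoid p)))
    (x : X) : p (p x) = x := by
  classical
  have : Fintype X := Fintype.ofFinite X
  have : Fintype (Quotient (Equiv.Perm.SameCycle.setoid p)) := Fintype.ofFinite _
  rw [Nat.card_eq_fintype_card, Nat.card_eq_fintype_card] at hc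
  let π : X → Quotient (Equiv.Perm.SameCycle.setoid p) := Quotient.mk _
  have hπ : ∀ x, π (p x) = π x := fun x =>
    Quotient.sound (s := Equiv.Perm.SameCycle.setoid p) (Equiv.Perm.SameCycle.refl p x).apply_left
  have hsum := Finset.card_eq_sum_card_fiberwise (f := π) (s := Finset.univ) (t := Finset.univ)
    (fun _ _ => Finset.mem_coe.2 (Finset.mem_univ _))
  have h2 : ∀ q ∈ (Finset.univ : Finset (Quotient (Equiv.Perm.SameCycle.setoid p))),
      2 ≤ (Finset.univ.filter fun y => π y = q).card := by
    intro q _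
    obtain ⟨y, rfl⟩ := Quotient.exists_rep q
    rw [← Finset.card_pair (h y)]
    refine Finset.card_le_card ?_
    intro w hw
    rw [Finset.mem_insert, Finset.mem_singleton] at hw
    rw [Finset.mem_filter]
    refine ⟨Finset.mem_univ _, ?_⟩
    rcases hw with rfl | rfl
    · exact hπ y
    · rfl
  have heq := (Finset.sum_eq_sum_iff_of_le h2).1 (by
    refine le_antisymm (Finset.sum_le_sum h2) ?_
    rw [← hsum, Finset.sum_const, Finset.card_univ, Finset.card_univ, smul_eq_mul]
    omega) (π x) (Finset.mem_univ _)
  by_contra hx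
  have h3 : ({x, p x, p (p x)} : Finset X) ⊆ Finset.univ.filter fun y => π y = π x := by
    intro w hw
    simp only [Finset.mem_insert, Finset.mem_singleton] at hw
    rw [Finset.mem_filter]
    refine ⟨Finset.mem_univ _, ?_⟩
    rcases hw with rfl | rfl | rfl
    · rfl
    · exact hπ x
    · rw [hπ, hπ]
  have h4 := Finset.card_le_card h3
  rw [← heq, Finset.card_eq_three.2 ⟨x, p x, p (p x), (h x).symm, fun h => hx h.symm,
    (h (p x)).symm, rfl⟩] at h4
  omega

namespace CurveMap

variable {M N K : CurveMap}

/-- Some edge of the diagram joins a crossing to itself and leaves it by two adjacent darts. -/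
def HasLoop (M : CurveMap) : Prop := ∃ c, M.IsCrossing c ∧ M.edgeOf c = M.edgeOf (M.rot c)

theorem HasLoop.of_isoAt {f : M.Dart → N.Dart} (h : IsoAt M N f) (hM : M.HasLoop) :
    N.HasLoop := by
  obtain ⟨c, h1, h2⟩ := hM
  refine ⟨f c, (h.isCrossing_iff c).1 h1, ?_⟩
  rw [← h.rot]
  exact eq_of_edgeOf_eq (fun x => N.edgeOf (f x)) (fun x => by rw [h.edge, edgeOf_edge])
    (fun x hx => by rw [h.rot, edgeOf_rot ((h.isPoint_iff x).1 hx)]) h2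

theorem IsoAt.symm {f : M.Dart → N.Dart} (h : IsoAt M N f) :
    ∃ g, IsoAt N M g := by
  let e := Equiv.ofBijective f h.bij
  have he : ∀ x, e x = f x := fun _ => rfl
  refine ⟨e.symm, e.symm.bijective, fun x => ?_, fun x => ?_, fun x hx => ?_⟩
  · rw [Equiv.symm_apply_eq, he, h.edge, ← he, Equiv.apply_symm_apply]
  · rw [Equiv.symm_apply_eq, he, h.rot, ← he, Equiv.apply_symm_apply]
  · obtain ⟨y, rfl⟩ := e.surjective x
    rw [Equiv.symm_apply_apply, he, h.isOver y ((h.isCrossing_iff y).2 hx)]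

theorem IsoAt.hasLoop_iff {f : M.Dart → N.Dart} (h : IsoAt M N f) : M.HasLoop ↔ N.HasLoop := by
  obtain ⟨g, hg⟩ := h.symm
  exact ⟨HasLoop.of_isoAt h, HasLoop.of_isoAt hg⟩

theorem ForgetAt.hasLoop_iff {p : M.Dart} {f : N.Dart → M.Dart} (h : ForgetAt M N p f)
    (hM : M.IsKnot) : M.HasLoop ↔ N.HasLoop := by
  constructor
  · rintro ⟨c, h1, h2⟩
    obtain ⟨y, rfl⟩ := h.exists_eq (x := c) (fun e => h1 (e ▸ h.point))
      (fun e => h1 (e ▸ h.point.rot))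
    rw [← h.rot, ← h.edgeOf_eq_iff hM] at h2
    exact ⟨y, (h.isCrossing_iff y).2 h1, h2⟩
  · rintro ⟨y, h1, h2⟩
    rw [h.edgeOf_eq_iff hM, h.rot] at h2
    exact ⟨f y, (h.isCrossing_iff y).1 h1, h2⟩

theorem IsoAt.card_crossing {f : M.Dart → N.Dart} (h : IsoAt M N f) :
    Nat.card {x // M.IsCrossing x} = Nat.card {x // N.IsCrossing x} :=
  card_crossing_eq f (fun x y _ _ e => h.bij.1 e) (fun x => (h.isCrossing_iff x).1) fun z hz => by
    obtain ⟨x, rfl⟩ := h.bij.2 z; exact ⟨x, (h.isCrossing_iff x).2 hz, rfl⟩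

end CurveMap

open CurveMap in
theorem KnotDiagram.PlanarIsotopic.hasLoop_iff_and_card_crossing {D D' : KnotDiagram} (h : D.PlanarIsotopic D') :
    (D.HasLoop ↔ D'.HasLoop) ∧
      Nat.card {x // D.IsCrossing x} = Nat.card {x // D'.IsCrossing x} := by
  induction h with
  | rel a b h =>
    rcases h with ⟨f, h1, h2, h3, -⟩ | h
    · have hf : IsoAt a.toCurveMap b.toCurveMap f := ⟨f.bijective, h1, h2, h3⟩
      exact ⟨hf.hasLoop_iff, hf.card_crossing⟩
    · obtain ⟨p, f, hf, -⟩ := Forget.forgetAt h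
      exact ⟨hf.hasLoop_iff a.isKnot, hf.card_crossing.symm⟩
  | refl => exact ⟨Iff.rfl, rfl⟩
  | symm a b _ ih => exact ⟨ih.1.symm, ih.2.symm⟩
  | trans a b c _ _ ih1 ih2 => exact ⟨ih1.1.trans ih2.1, ih1.2.trans ih2.2⟩

namespace CurveMap

variable {K : CurveMap}

/-- In a planar knot diagram with one or two crossings, there is a loop besides any given edge. -/
theorem IsKnot.exists_loop (hK : K.IsKnot) (hc : ∀ x, K.IsCrossing x) (hp : K.IsPlanar)
    (hcard : Nat.card K.Dart ≤ 8) (z : K.Dart) :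
    ∃ c, c ≠ z ∧ c ≠ K.edge z ∧ K.edge c = K.rot c := by
  -- An edge joining a crossing to itself leaves it by adjacent darts, as there is a single strand.
  have hopp : ∀ c, K.edge c ≠ K.rot (K.rot c) := by
    intro c h
    have h1 : K.rot c = c ∨ K.rot c = K.rot (K.rot c) := by
      refine hK.forall_of_closed (fun x => x = c ∨ x = K.rot (K.rot c)) c (Or.inl rfl) ?_
        (fun a ha => absurd ha (hc a)) ?_ (K.rot c)
      · rintro _ (rfl | rfl)
        · exact Or.inr h
        · exact Or.inl (by rw [← h, hK.edge_edge])
      · rintro _ - (rfl | rfl)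
        · exact Or.inr rfl
        · exact Or.inl (hK.rot_four c)
    rcases h1 with h1 | h1
    · exact hK.rot_ne c h1
    · exact hK.rot_ne c (K.rot.injective h1.symm)
  by_contra hno
  push Not at hno
  -- Only the edge of `z` may join a crossing to itself.
  have hin : ∀ c, K.rot.SameCycle c (K.edge c) → c = z ∨ c = K.edge z := by
    intro c h
    by_contra hcz
    rw [not_or] at hcz
    rcases mem_four_of_sameCycle (hK.rot_four c) h with h | h | h | h
    · exact hK.edge_ne c h
    · exact hno c hcz.1 hcz.2 h
    · exact hopp c h
    · refine hno (K.edge c) (fun e => hcz.2 (hK.edge_eq_iff.1 e))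
        (fun e => hcz.1 (K.edge.injective e)) ?_
      rw [hK.edge_edge, h, hK.rot_four]
  -- There are at most two crossings.
  have hcompl : ∀ x y, ¬ K.rot.SameCycle x y → Nat.card K.Dart = 8 ∧
      ∀ w, K.rot.SameCycle x w ∨ K.rot.SameCycle y w := by
    intro x y hxy
    have hd : Disjoint {w | K.rot.SameCycle x w} {w | K.rot.SameCycle y w} := by
      rw [Set.disjoint_left]
      exact fun w h1 h2 => hxy (h1.trans h2.symm)
    have h1 := Set.ncard_union_eq hd
    rw [hK.ncard_crossing (hc x), hK.ncard_crossing (hc y)] at h1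
    have h2 := Set.ncard_add_ncard_compl ({w | K.rot.SameCycle x w} ∪ {w | K.rot.SameCycle y w})
    refine ⟨by omega, fun w => ?_⟩
    have h3 : ({w | K.rot.SameCycle x w} ∪ {w | K.rot.SameCycle y w})ᶜ.ncard = 0 := by omega
    rw [Set.ncard_eq_zero] at h3
    by_contra hw
    exact (h3.subset (show w ∈ _ᶜ from hw)).elim
  by_cases hz : K.rot.SameCycle z (K.edge z)
  · by_cases hall : ∀ w, K.rot.SameCycle z w
    · have h1 := hin (K.rot z) ((hall _).symm.trans (hall _))
      have h2 := hin (K.rot (K.rot z)) ((hall _).symm.trans (hall _))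
      have h3 := h1.resolve_left (hK.rot_ne z)
      have h4 := h2.resolve_left (hc z)
      exact hK.rot_ne _ (h4.trans h3.symm)
    -- The four edges at the other crossing would have to end at only two darts.
    · push Not at hall
      obtain ⟨y, hy⟩ := hall
      have hsub : K.edge '' {w | K.rot.SameCycle y w} ⊆
          {w | K.rot.SameCycle z w} \ {z, K.edge z} := by
        rintro _ ⟨c, hcy, rfl⟩
        have h1 : c ≠ z := fun e => hy (e ▸ hcy.symm)
        have h2 : c ≠ K.edge z := fun e => hy (hz.trans (e ▸ hcy.symm))
        constructor
        · refine ((hcompl z y hy).2 _).resolve_right fun h => ?_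
          exact (hin c (hcy.symm.trans h)).elim h1 h2
        · rintro (h | h)
          · exact h2 (hK.edge_eq_iff.1 h)
          · exact h1 (K.edge.injective h)
      have h1 := Set.ncard_le_ncard hsub (Set.toFinite _)
      rw [Set.ncard_image_of_injective _ K.edge.injective, hK.ncard_crossing (hc y),
        Set.ncard_sdiff, hK.ncard_crossing (hc z), Set.ncard_pair (hK.edge_ne z).symm] at h1
      · omega
      · rintro w (rfl | rfl)
        · exact .refl _ _
        · exact hz
  -- All regions would be bigons, so that there would be two strands.
  · have hout : ∀ c, ¬ K.rot.SameCycle c (K.edge c) := by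
      intro c h
      rcases hin c h with rfl | rfl
      · exact hz h
      · rw [hK.edge_edge] at h; exact hz h.symm
    have h8 := (hcompl z _ hz).1
    have hn : ∀ c, K.next c ≠ c := by
      intro c h
      rw [next_apply, Equiv.symm_apply_eq] at h
      exact hout c (h ▸ (Equiv.Perm.SameCycle.refl _ _).apply_right)
    have hF : 4 * Nat.card K.Face = 8 + 8 := by
      have h := (hK.isPlanar_iff).1 hp
      have : Nat.card {x // K.IsCrossing x} = Nat.card K.Dart :=
        Nat.card_eq_of_bijective Subtype.val ⟨Subtype.val_injective, fun x => ⟨⟨x, hc x⟩, rfl⟩⟩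
      rwa [this, h8] at h
    have hnn := K.next.apply_apply_of_card_le hn (by
      change Nat.card K.Dart ≤ 2 * Nat.card K.Face
      omega)
    have hrot : ∀ x, K.edge (K.rot x) = K.rot.symm (K.edge x) := by
      intro x
      have h1 := hnn x
      rw [next_apply, next_apply, Equiv.symm_apply_eq] at h1
      rw [← h1, hK.edge_edge]
    have hrr : ∀ x, K.edge (K.rot (K.rot x)) = K.rot (K.rot (K.edge x)) := by
      intro x
      rw [hrot, hrot, hK.rot_symm, hK.rot_symm, hK.rot_four]
    have h1 : K.rot z = z ∨ K.rot z = K.edge z ∨ K.rot z = K.rot (K.rot z) ∨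
        K.rot z = K.rot (K.rot (K.edge z)) := by
      refine hK.forall_of_closed (fun x => x = z ∨ x = K.edge z ∨ x = K.rot (K.rot z) ∨
        x = K.rot (K.rot (K.edge z))) z (Or.inl rfl) ?_ (fun a ha => absurd ha (hc a)) ?_ _
      · rintro _ (rfl | rfl | rfl | rfl)
        · exact Or.inr (Or.inl rfl)
        · exact Or.inl (hK.edge_edge z)
        · exact Or.inr (Or.inr (Or.inr (hrr z)))
        · exact Or.inr (Or.inr (Or.inl (by rw [hrr, hK.edge_edge])))
      · rintro _ - (rfl | rfl | rfl | rfl)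
        · exact Or.inr (Or.inr (Or.inl rfl))
        · exact Or.inr (Or.inr (Or.inr rfl))
        · exact Or.inl (hK.rot_four z)
        · exact Or.inr (Or.inl (hK.rot_four _))
    rcases h1 with h1 | h1 | h1 | h1
    · exact hK.rot_ne z h1
    · exact hz (h1 ▸ (Equiv.Perm.SameCycle.refl _ _).apply_right)
    · exact hK.rot_ne z (K.rot.injective h1.symm)
    · have h2 : K.rot.SameCycle (K.rot z) z := (Equiv.Perm.SameCycle.refl _ _).apply_left
      have h3 : K.rot.SameCycle (K.rot z) (K.edge z) := by
        rw [h1]; exact (Equiv.Perm.SameCycle.refl _ _).apply_left.apply_left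
      exact hz (h2.symm.trans h3)

end CurveMap

/-! ### Dependence -/

namespace CurveMap

variable {R F : CurveMap} {L : Type} {e : R.Dart → L}

namespace Decomp

/-- An edge of a tangle that avoids the point at infinity is an edge of the diagram. -/
theorem edgeOf_val_eq (S : Decomp R e F) (hR : IsBase R e) {r : R.Dart} {x y : (S.tangle r).Dart}
    (h : (S.tangle r).edgeOf x = (S.tangle r).edgeOf y)
    (hx : (S.tangle r).edgeOf x ≠ (S.tangle r).edgeOf (S.tip r)) :
    F.edgeOf x.1 = F.edgeOf y.1 := by
  classical
  let κ : (S.tangle r).Dart → Option F.Edge := fun x =>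
    if (S.tangle r).edgeOf x = (S.tangle r).edgeOf (S.tip r) then none else some (F.edgeOf x.1)
  have hκ : κ x = κ y := by
    refine eq_of_edgeOf_eq κ (fun w => ?_) (fun w hw => ?_) h
    · simp only [κ, edgeOf_edge]
      rw [show F.edgeOf ((S.tangle r).edge w).1 = F.edgeOf w.1 from edgeOf_edge w.1]
    · simp only [κ, edgeOf_rot hw]
      split_ifs with hwt
      · rfl
      · by_cases hwc : w.1 ∈ Set.range S.core
        · refine absurd ?_ hwt
          obtain ⟨s, hs⟩ := hwc
          have hl : e r = e s := by rw [← S.label_core s, hs, w.2]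
          rcases (hR.eq_iff _ _).1 hl with rfl | rfl
          · exact congrArg _ (Subtype.ext hs.symm)
          · rw [← edgeOf_rot (x := S.tip r) (S.isPoint_of_mem hR ⟨r, rfl⟩)]
            refine congrArg _ (Subtype.ext ?_)
            rw [← hs, S.rot_val, tip, S.turn_core]
        · rw [S.rot_val_of_not_mem hwc, edgeOf_rot ((S.isPoint_iff_of_not_mem hwc).1 hw)]
  simp only [κ, if_neg hx, if_neg (h ▸ hx)] at hκ
  exact Option.some_injective _ hκ

/-- If `F` has two crossings more than `R`, they lie in tangles, and a tangle with one or two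
crossings has a loop. -/
theorem hasLoop_of_card (S : Decomp R e F) (hR : IsBase R e) (hF : F.IsKnot)
    (he : ∀ l, ∃ r, e r = l) (hp : ∀ r, (S.tangle r).IsPlanar)
    (hcard : Nat.card {x // F.IsCrossing x} = Nat.card R.Dart + 8) : F.HasLoop := by
  -- The eight darts at the two crossings outside the core.
  let A : Set F.Dart := {x | F.IsCrossing x ∧ x ∉ Set.range S.core}
  have hA : A.ncard = 8 := by
    have := card_crossing_add (M := F) (M' := R) S.core S.core_inj A (fun z => ?_)
      (fun x _ h => h.2 ⟨x, rfl⟩)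
    · have h1 : Nat.card {x // R.IsCrossing x} = Nat.card R.Dart :=
        Nat.card_eq_of_bijective Subtype.val
          ⟨Subtype.val_injective, fun x => ⟨⟨x, hR.crossing x⟩, rfl⟩⟩
      omega
    · by_cases hz : z ∈ Set.range S.core
      · obtain ⟨r, rfl⟩ := hz
        exact iff_of_true (S.isCrossing_core hR r) (Or.inr ⟨r, hR.crossing r, rfl⟩)
      · exact ⟨fun h => Or.inl ⟨h, hz⟩,
          fun h => h.elim And.left fun ⟨r, _, hr⟩ => absurd ⟨r, hr⟩ hz⟩
  obtain ⟨x, hx⟩ : A.Nonempty := by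
    rw [← Set.ncard_pos (Set.toFinite _)]
    omega
  obtain ⟨r, hr⟩ := he (S.label x)
  have hT := S.isKnot_tangle hR hF r
  -- `K` is the tangle without its marked points, so all its darts come from `A`.
  obtain ⟨K, κ, hK, hκ, -⟩ := hT.exists_reduction
    ⟨⟨x, hr.symm⟩, (S.isCrossing_iff hR _).2 ⟨hx.2, hx.1⟩⟩
  have hK8 : Nat.card K.Dart ≤ 8 := by
    rw [← hA, ← Nat.card_coe_set_eq]
    refine Nat.card_le_card_of_injective (fun c => (⟨(κ c).1, ?_⟩ : A)) fun c c' h => ?_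
    · exact ((S.isCrossing_iff hR _).1 (hκ.crossing c)).symm
    · exact hκ.inj (Subtype.ext (congrArg (fun a : A => a.1) h))
  obtain ⟨z, -, hz⟩ := hκ.exists_same_face_edge (S.tip r)
  obtain ⟨c, h1, h2, h3⟩ := hK.exists_loop hκ.isCrossing ((hκ.isPlanar_iff hT hK).1 (hp r)) hK8 z
  have hc := (S.isCrossing_iff hR _).1 (hκ.crossing c)
  refine ⟨(κ c).1, hc.2, ?_⟩
  rw [← S.rot_val_of_not_mem hc.1, ← hκ.rot, ← h3]
  refine S.edgeOf_val_eq hR (hκ.edgeOf_edge c).symm ?_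
  rw [← hz]
  intro h
  rcases (hκ.edgeOf_eq_iff c z).1 h with h | h
  · exact h1 h.symm
  · exact h2 (hK.edge_eq_iff.1 h.symm)

end Decomp

end CurveMap

namespace KnotDiagram

open CurveMap

/-- An `Ω₂`-move between distinct edges creates two crossings and no loop. -/
theorem RemoveBigonAt.hasLoop_and_card_crossing {D D₁ : KnotDiagram} {ε₁ ε₂ : D₁.Edge}
    (h : RemoveBigonAt D D₁ ε₁ ε₂) (hne : ε₁ ≠ ε₂) :
    (D.HasLoop → D₁.HasLoop) ∧
      Nat.card {x // D.IsCrossing x} = Nat.card {x // D₁.IsCrossing x} + 8 := by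
  obtain ⟨t, u, f, ht, hu, htu, het, heu, -, -, hi, hrange, hfe, hr1, hr2, hr3, hr4, hro, -, -,
    ⟨x₁, hx₁, hε₁⟩, ⟨x₂, hx₂, hε₂⟩⟩ := h
  have hD := D.isKnot
  have hf : ∀ y, y ≠ t → y ≠ D.rot t → y ≠ u → y ≠ D.rot u → ∃ x, f x = y := by
    intro y h1 h2 h3 h4
    have : y ∈ Set.range f := by rw [hrange]; simp [h1, h2, h3, h4]
    exact this
  have hf' : ∀ x, f x ≠ t ∧ f x ≠ D.rot t ∧ f x ≠ u ∧ f x ≠ D.rot u := by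
    intro x
    have : f x ∈ Set.range f := ⟨x, rfl⟩
    rw [hrange] at this
    simpa using this
  have hpoint : ∀ x, D.rot.SameCycle t (f x) ∨ D.rot.SameCycle u (f x) → D₁.IsPoint x := by
    intro x hx
    apply hi
    rcases hx with hx | hx
    · rcases mem_four_of_sameCycle (hD.rot_four t) hx with h | h | h | h
      · exact absurd h (hf' x).1
      · exact absurd h (hf' x).2.1
      · rw [hr2 _ (hr1 x h), h]
      · rw [hr3 _ (hr4 x h), h]
    · rcases mem_four_of_sameCycle (hD.rot_four u) hx with h | h | h | h
      · exact absurd h (hf' x).2.2.1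
      · exact absurd h (hf' x).2.2.2
      · rw [hr4 _ (hr3 x h), h]
      · rw [hr1 _ (hr2 x h), h]
  have hiff : ∀ x, ¬ D.rot.SameCycle t (f x) → ¬ D.rot.SameCycle u (f x) →
      (D₁.IsPoint x ↔ D.IsPoint (f x)) := by
    intro x h1 h2
    have h3 := hro x h1 h2
    have h4 : f (D₁.rot (D₁.rot x)) = D.rot (f (D₁.rot x)) :=
      hro _ (by rwa [h3, Equiv.Perm.sameCycle_apply_right])
        (by rwa [h3, Equiv.Perm.sameCycle_apply_right])
    unfold IsPoint
    rw [← hi.eq_iff, h4, h3]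
  have hcross : ∀ {s y}, D.IsCrossing s → D.rot.SameCycle s y → D.IsCrossing y := by
    intro s y hs hy
    refine hy.mem_of_forward_closed {y | D.IsCrossing y} hs fun y hy => ?_
    exact isCrossing_rot_iff.2 hy
  constructor
  -- Label the darts on each of the two strands by the edge of `D₁` to which the strand belongs.
  · obtain ⟨κ, hκf, hκt, hκt', hκu, hκu'⟩ : ∃ κ : D.Dart → D₁.Edge, (∀ x, κ (f x) = D₁.edgeOf x) ∧
        κ t = ε₁ ∧ κ (D.rot t) = ε₂ ∧ κ u = ε₂ ∧ κ (D.rot u) = ε₁ := by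
      classical
      have n1 : D.rot t ≠ t := hD.rot_ne t
      have n2 : u ≠ t := fun h => htu (h ▸ .refl _ _)
      have n3 : D.rot u ≠ t := fun h => htu (h ▸ (Equiv.Perm.SameCycle.refl _ _).apply_left)
      have n4 : u ≠ D.rot t := fun h => htu (h ▸ (Equiv.Perm.SameCycle.refl _ _).apply_right)
      have n5 : D.rot u ≠ D.rot t := fun h => n2 (D.rot.injective h)
      have n6 : D.rot u ≠ u := hD.rot_ne u
      refine ⟨fun y => if y = t ∨ y = D.rot u then ε₁ else if h : ∃ x, f x = y then
        D₁.edgeOf h.choose else ε₂, fun x => ?_, ?_, ?_, ?_, ?_⟩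
      · have h : ∃ x', f x' = f x := ⟨x, rfl⟩
        have h' : ¬ (f x = t ∨ f x = D.rot u) := by
          rw [not_or]; exact ⟨(hf' x).1, (hf' x).2.2.2⟩
        simp only [if_neg h', dif_pos h]
        exact congrArg _ (hi h.choose_spec)
      · simp
      · exact (if_neg (by rw [not_or]; exact ⟨n1, n5.symm⟩)).trans
          (dif_neg fun ⟨x, hx⟩ => (hf' x).2.1 hx)
      · exact (if_neg (by rw [not_or]; exact ⟨n2, n6.symm⟩)).trans
          (dif_neg fun ⟨x, hx⟩ => (hf' x).2.2.1 hx)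
      · simp
    have hκe : ∀ y, κ (D.edge y) = κ y := by
      intro y
      by_cases h1 : y = t
      · rw [h1, het, hκt, hκu']
      by_cases h2 : y = D.rot t
      · rw [h2, ← heu, hD.edge_edge, heu, hκt', hκu]
      by_cases h3 : y = u
      · rw [h3, heu, hκt', hκu]
      by_cases h4 : y = D.rot u
      · rw [h4, ← het, hD.edge_edge, het, hκt, hκu']
      obtain ⟨x, rfl⟩ := hf y h1 h2 h3 h4
      rw [← hfe, hκf, hκf, edgeOf_edge]
    have hκr : ∀ y, D.IsPoint y → κ (D.rot y) = κ y := by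
      intro y hy
      have h1 : ¬ D.rot.SameCycle t y := fun h => hcross ht h hy
      have h2 : ¬ D.rot.SameCycle u y := fun h => hcross hu h hy
      obtain ⟨x, rfl⟩ := hf y (fun h => h1 (h ▸ .refl _ _))
        (fun h => h1 (h ▸ (Equiv.Perm.SameCycle.refl _ _).apply_right))
        (fun h => h2 (h ▸ .refl _ _))
        (fun h => h2 (h ▸ (Equiv.Perm.SameCycle.refl _ _).apply_right))
      rw [← hro x h1 h2, hκf, hκf, edgeOf_rot ((hiff x h1 h2).2 hy)]
    have hp₁ : D₁.IsPoint x₁ := hpoint x₁ (Or.inl (by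
      rw [hx₁]; exact (Equiv.Perm.SameCycle.refl _ _).apply_right.apply_right))
    have hp₂ : D₁.IsPoint x₂ := hpoint x₂ (Or.inr (by
      rw [hx₂]; exact (Equiv.Perm.SameCycle.refl _ _).apply_right.apply_right))
    have ht2 : κ (D.rot (D.rot t)) = ε₁ := by rw [← hx₁, hκf, hε₁]
    have hu2 : κ (D.rot (D.rot u)) = ε₂ := by rw [← hx₂, hκf, hε₂]
    have ht3 : κ (D.rot (D.rot (D.rot t))) = ε₂ := by
      rw [← hr3 x₂ hx₂, hκf, edgeOf_rot hp₂, hε₂]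
    have hu3 : κ (D.rot (D.rot (D.rot u))) = ε₁ := by
      rw [← hr1 x₁ hx₁, hκf, edgeOf_rot hp₁, hε₁]
    rintro ⟨y, hy, hl⟩
    have hl' := eq_of_edgeOf_eq κ hκe hκr hl
    by_cases h1 : D.rot.SameCycle t y
    · exfalso
      rcases mem_four_of_sameCycle (hD.rot_four t) h1 with rfl | rfl | rfl | rfl
      · rw [hκt, hκt'] at hl'; exact hne hl'
      · rw [hκt', ht2] at hl'; exact hne hl'.symm
      · rw [ht2, ht3] at hl'; exact hne hl'
      · rw [ht3, hD.rot_four, hκt] at hl'; exact hne hl'.symm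
    by_cases h2 : D.rot.SameCycle u y
    · exfalso
      rcases mem_four_of_sameCycle (hD.rot_four u) h2 with rfl | rfl | rfl | rfl
      · rw [hκu, hκu'] at hl'; exact hne hl'.symm
      · rw [hκu', hu2] at hl'; exact hne hl'
      · rw [hu2, hu3] at hl'; exact hne hl'.symm
      · rw [hu3, hD.rot_four, hκu] at hl'; exact hne hl'
    obtain ⟨x, rfl⟩ := hf y (fun h => h1 (h ▸ .refl _ _))
      (fun h => h1 (h ▸ (Equiv.Perm.SameCycle.refl _ _).apply_right))
      (fun h => h2 (h ▸ .refl _ _))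
      (fun h => h2 (h ▸ (Equiv.Perm.SameCycle.refl _ _).apply_right))
    rw [← hro x h1 h2, hκf, hκf] at hl'
    exact ⟨x, mt (hiff x h1 h2).1 hy, hl'⟩
  · have hd : Disjoint {w | D.rot.SameCycle t w} {w | D.rot.SameCycle u w} := by
      rw [Set.disjoint_left]
      exact fun w h1 h2 => htu (h1.trans h2.symm)
    have h8 := Set.ncard_union_eq hd
    rw [hD.ncard_crossing ht, hD.ncard_crossing hu] at h8
    rw [card_crossing_add f hi _ ?_ ?_, h8]
    · intro z
      by_cases hz : z ∈ {w | D.rot.SameCycle t w} ∪ {w | D.rot.SameCycle u w}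
      · exact iff_of_true (hz.elim (hcross ht) (hcross hu)) (Or.inl hz)
      · have h1 : ¬ D.rot.SameCycle t z := fun h => hz (Or.inl h)
        have h2 : ¬ D.rot.SameCycle u z := fun h => hz (Or.inr h)
        obtain ⟨x, rfl⟩ := hf z (fun h => h1 (h ▸ .refl _ _))
          (fun h => h1 (h ▸ (Equiv.Perm.SameCycle.refl _ _).apply_right))
          (fun h => h2 (h ▸ .refl _ _))
          (fun h => h2 (h ▸ (Equiv.Perm.SameCycle.refl _ _).apply_right))
        have h3 := not_congr (hiff x h1 h2)
        refine ⟨fun h => Or.inr ⟨x, h3.2 h, rfl⟩, ?_⟩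
        rintro (h | ⟨x', hx', h⟩)
        · exact absurd h hz
        · rw [← hi h] at h3
          exact hi h ▸ h3.1 hx'
    · exact fun x hx h => hx (hpoint x h)

end KnotDiagram

open KnotDiagram CurveMap in
theorem theorem1 (D : KnotDiagram)
    (h_gon : ∀ F : D.Face, ¬ D.IsGon 0 F ∧ ¬ D.IsGon 1 F ∧ ¬ D.IsGon 2 F)
    (h_triple : ∀ D₁ D₂ : KnotDiagram, D.PlanarIsotopic D₁ → ¬ KnotDiagram.IsMove 3 D₁ D₂) :
    (∀ F : KnotDiagram, KnotDiagram.Independent 2 D F →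
      ∃ (T : D.Edge → Tangle) (E : KnotDiagram),
        (∀ ε, (T ε).IsUnknotted) ∧ D.ReplaceEdges T E ∧ E.PlanarIsotopic F) ∧
    (∃ D' : KnotDiagram, D.CrossTwoEdges D') ∧
    (∀ D' : KnotDiagram, D.CrossTwoEdges D' → KnotDiagram.Dependent 2 D D') := by
  have hx : ∃ x, D.IsCrossing x := by
    by_contra h
    exact (h_gon D.outer).1 (Or.inl ⟨rfl, not_exists.1 h⟩)
  obtain ⟨R, ι, hRk, hι, hpi⟩ := D.isKnot.exists_reduction hx
  have hR : IsBase R fun r => D.edgeOf (ι r) := isBase_of_isReduction h_gon hRk hι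
  have hp : R.IsPlanar := (hι.isPlanar_iff D.isKnot hRk).1 D.isPlanar
  obtain ⟨d, hd⟩ := faceOf_surj D.outer
  obtain ⟨r₀, hr₀, -⟩ := hι.exists_same_face_edge d
  rw [hd] at hr₀
  have hDR : D.PlanarIsotopic (ofMap R hRk hp (R.faceOf r₀)) := by
    have := hpi D.isKnot hRk D.isPlanar hp r₀
    rwa [ofMap_eq D hr₀] at this
  have hself : Tangled R (fun r => D.edgeOf (ι r)) (R.faceOf r₀) D :=
    (Tangled.of_planarIsotopic hR hDR).2
      (tangled_self (D := ofMap R hRk hp (R.faceOf r₀)) hR)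
  have hind : ∀ F, Independent 2 D F → Tangled R (fun r => D.edgeOf (ι r)) (R.faceOf r₀) F :=
    fun F hF => Tangled.of_independent hR (faceOf_triangle_eq_outer
      (D := ofMap R hRk hp (R.faceOf r₀))
      (fun D₁ D₂ h => h_triple D₁ D₂ (.trans _ _ _ hDR h)) hι.isCrossing) hF hself
  -- A loop would be an edge of `R` bounding a monogon.
  have hloop : ¬ D.HasLoop := by
    rintro ⟨c, hc, hl⟩
    obtain ⟨r, rfl⟩ := hι.exists_eq c hc
    rw [← hι.rot] at hl
    rcases (hι.edgeOf_eq_iff _ _).1 hl with h | h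
    · exact hRk.rot_ne r h
    · exact hR.no_bigon r r h.symm h.symm
  refine ⟨fun F hF => (hind F hF).exists_replaceEdges hι hR fun r hr => ?_, ?_, ?_⟩
  · rw [(hι.faceOf_eq_iff r r₀).1 hr, hr₀]
  · refine D.exists_crossTwoEdges (z := fun b => if b then ι r₀ else D.next.symm (ι r₀)) ?_
      (D.next.apply_symm_apply _) (hι.crossing r₀) hr₀
    intro h
    refine hloop ⟨ι r₀, hι.crossing r₀, h.symm.trans ?_⟩
    rw [← edgeOf_edge]
    refine congrArg D.edgeOf ?_
    have h1 : D.next (D.next.symm (ι r₀)) = ι r₀ := D.next.apply_symm_apply _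
    rwa [next_apply, Equiv.symm_apply_eq] at h1
  · rintro D' ⟨D₁, ε₁, ε₂, hD₁, hne, hD'⟩ hdep
    obtain ⟨h1, h2⟩ := hD'.hasLoop_and_card_crossing hne
    obtain ⟨h3, h4⟩ := KnotDiagram.PlanarIsotopic.hasLoop_iff_and_card_crossing hD₁
    obtain ⟨S, -, hS⟩ := hind D' hdep
    refine hloop (h3.2 (h1 (S.hasLoop_of_card hR D'.isKnot (fun ε => ?_)
      (fun r => (hS r).choose_spec.choose) ?_)))
    · obtain ⟨d, rfl⟩ := edgeOf_surj ε
      exact (hι.exists_same_face_edge d).imp fun _ h => h.2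
    · rw [h2, ← h4]
      refine congrArg (· + 8) (Eq.symm ?_)
      exact Nat.card_eq_of_bijective (fun r => ⟨ι r, hι.crossing r⟩)
        ⟨fun r s h => hι.inj (congrArg Subtype.val h), fun x => (hι.exists_eq x.1 x.2).imp
          fun r hr => Subtype.ext hr⟩
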